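/- Let $d\ge1$ and let $D\subset\mathbb R^d$ be a non-empty bounded open set whose boundary is $C^{1,\alpha}$ for some $\alpha>0$. For $\epsilon>0$ put $D_\epsilon:=\{x\in\mathbb Z^d:\operatorname{dist}_\infty(x\epsilon,D^{\rm c})>\epsilon\}$, where $\operatorname{dist}_\infty$ is the $\ell^\infty$-distance, and for a function $\xi^{(\epsilon)}\colon D_\epsilon\to\mathbb R$ let $H_{D_\epsilon,\xi}$ be the symmetric matrix acting on functions $f\colon\mathbb Z^d\to\mathbb R$ that vanish outside $D_\epsilon$ by $$(H_{D_\epsilon,\xi}f)(x):=-\epsilon^{-2}\sum_{y\colon|y-x|_1=1}[f(y)-f(x)]+\xi^{(\epsilon)}(x)f(x),\qquad x\in D_\epsilon,$$ with eigenvalues $\lambda^{(1)}_{D_\epsilon,\xi}\le\dots\le\lambda^{(|D_\epsilon|)}_{D_\epsilon,\xi}$, counted with multiplicity. Suppose (Assumption 1) that there are real numbers $a<b$ and bounded continuous functions $U\colon D\to\mathbb R$ and $V\colon D\to(0,\infty)$ such that, for each $\epsilon>0$, the $\xi^{(\epsilon)}(x)$, $x\in D_\epsilon$, are independent random variables (on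 a probability space, with law $\mathbb P_\epsilon$, that may depend on $\epsilon$) and, for every $x\in D_\epsilon$, almost surely $a\le\xi^{(\epsilon)}(x)\le b$, and $$\mathbb E\,\xi^{(\epsilon)}(x)=U(x\epsilon),\qquad \operatorname{Var}\bigl(\xi^{(\epsilon)}(x)\bigr)=V(x\epsilon).$$ Let $H^1_0(D)$ be the closure of $C_c^\infty(D)$ in the norm $(\|f\|_{L^2(D)}^2+\|\nabla f\|_{L^2(D)}^2)^{1/2}$; a real number $\lambda$ is an eigenvalue of $-\Delta+U$ on $H^1_0(D)$ if there is a non-zero $u\in H^1_0(D)$ with $\int_D\nabla u\cdot\nabla v+\int_D Uuv=\lambda\int_D uv$ for all $v\in H^1_0(D)$. Then for each $k\ge1$ one has $|D_\epsilon|\ge k$ for all sufficiently small $\epsilon>0$, the $k$-th smallest eigenvalue $\lambda^{(k)}_D$ (counted with multiplicity) of $-\Delta+U$ on $H^1_0(D)$ exists, and $\lambda^{(k)}_{D_\epsilon,\xi}\to\lambda^{(k)}_D$ in probability as $\epsilon\downarrow0$; that is, for every $\delta>0$, $$\lim_{\epsilon\downarrow0}\mathbb P_\epsilon\bigl(|\lambda^{(k)}_{D_\epsilon,\xi}-\lambda^{(k)}_D|\ge\delta\bigr)=0.$$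 -/

import Mathlib

open MeasureTheory ProbabilityTheory Filter Topology
open scoped NNReal

/-! ### Domains -/

/-- `D ⊆ ℝᵈ` has a `C^{1,α}` boundary: near each boundary point, `D` is the set of points lying
strictly above the graph, over a hyperplane `nᗮ` and in the direction of its unit normal `n`,
of a `C¹` function with `α`-Hölder derivative. -/
def HasC1HolderBoundary {d : ℕ} (α : ℝ≥0) (D : Set (EuclideanSpace ℝ (Fin d))) : Prop :=
  ∀ x₀ ∈ frontier D, ∃ r : ℝ, 0 < r ∧
    ∃ n : EuclideanSpace ℝ (Fin d), ‖n‖ = 1 ∧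
    ∃ γ : ((ℝ ∙ n)ᗮ : Submodule ℝ (EuclideanSpace ℝ (Fin d))) → ℝ,
      ContDiff ℝ 1 γ ∧ (∃ C : ℝ≥0, HolderWith C α (fderiv ℝ γ)) ∧
      D ∩ Metric.ball x₀ r =
        {x | γ ((ℝ ∙ n)ᗮ.orthogonalProjectionOnto x) < inner ℝ n x} ∩ Metric.ball x₀ r

/-- The point `ε x` of `ℝᵈ`, for a lattice site `x ∈ ℤᵈ`. -/
noncomputable def latticePoint {d : ℕ} (ε : ℝ) (x : Fin d → ℤ) : EuclideanSpace ℝ (Fin d) :=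
  WithLp.toLp 2 fun i => ε * (x i : ℝ)

/-- The set `D_ε = {x ∈ ℤᵈ : dist_∞ (ε x, Dᶜ) > ε}`; the distance is taken in `Fin d → ℝ`, which
carries the sup metric. -/
def latticeSet {d : ℕ} (D : Set (EuclideanSpace ℝ (Fin d))) (ε : ℝ) : Set (Fin d → ℤ) :=
  {x | ε < Metric.infDist (WithLp.ofLp (latticePoint ε x)) (WithLp.ofLp '' Dᶜ)}

theorem latticeSet_finite {d : ℕ} {D : Set (EuclideanSpace ℝ (Fin d))}
    (hD : Bornology.IsBounded D) {ε : ℝ} (hε : 0 < ε) : (latticeSet D ε).Finite := by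
  obtain ⟨R, hR⟩ := hD.exists_norm_le
  refine (Set.finite_Icc (fun _ : Fin d => -⌈R / ε⌉) (fun _ => ⌈R / ε⌉)).subset ?_
  intro x hx
  have hxD : latticePoint ε x ∈ D := by
    by_contra h
    have h0 := Metric.infDist_zero_of_mem (Set.mem_image_of_mem WithLp.ofLp
      (show latticePoint ε x ∈ Dᶜ from h))
    have hx' : ε < _ := hx
    rw [h0] at hx'
    exact absurd hx' (not_lt.2 hε.le)
  have hi : ∀ i, |(x i : ℝ)| ≤ R / ε := fun i => by
    have h1 : ‖(latticePoint ε x) i‖ ≤ R := (PiLp.norm_apply_le _ i).trans (hR _ hxD)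
    have h2 : ‖(latticePoint ε x) i‖ = ε * |(x i : ℝ)| := by
      simp [latticePoint, abs_of_pos hε]
    rw [h2] at h1
    rw [le_div_iff₀ hε, mul_comm]
    exact h1
  have hc : ∀ i, |x i| ≤ ⌈R / ε⌉ := fun i => by
    have h1 := (hi i).trans (Int.le_ceil (R / ε))
    exact_mod_cast h1
  exact ⟨fun i => (abs_le.1 (hc i)).1, fun i => (abs_le.1 (hc i)).2⟩

open Classical in
/-- `D_ε` as a finite set (it is finite when `D` is bounded and `ε > 0`). -/
noncomputable def latticeDomain {d : ℕ} (D : Set (EuclideanSpace ℝ (Fin d))) (ε : ℝ) :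
    Finset (Fin d → ℤ) :=
  if h : (latticeSet D ε).Finite then h.toFinset else ∅

theorem mem_latticeDomain {d : ℕ} {D : Set (EuclideanSpace ℝ (Fin d))}
    (hD : Bornology.IsBounded D) {ε : ℝ} (hε : 0 < ε) (x : Fin d → ℤ) :
    x ∈ latticeDomain D ε ↔
      ε < Metric.infDist (WithLp.ofLp (latticePoint ε x)) (WithLp.ofLp '' Dᶜ) := by
  rw [latticeDomain, dif_pos (latticeSet_finite hD hε), Set.Finite.mem_toFinset]
  rfl

/-! ### The discrete operator -/

/-- The lattice Laplacian: the sum of `f y - f x` over the `2d` nearest neighbours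
`y = x ± eᵢ` of `x`. -/
def latticeLaplacian {d : ℕ} (f : (Fin d → ℤ) → ℝ) (x : Fin d → ℤ) : ℝ :=
  ∑ i : Fin d, ((f (x + Pi.single i 1) - f x) + (f (x - Pi.single i 1) - f x))

/-- The operator `f ↦ -ε⁻² Δ f + ξ f` on functions on `ℤᵈ`. -/
noncomputable def latticeSchrodinger {d : ℕ} (ε : ℝ) (ξ : (Fin d → ℤ) → ℝ)
    (f : (Fin d → ℤ) → ℝ) (x : Fin d → ℤ) : ℝ :=
  -(ε ^ 2)⁻¹ * latticeLaplacian f x + ξ x * f x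

/-- The matrix of `-ε⁻² Δ + ξ` on functions vanishing outside the finite set `Λ` (Dirichlet
boundary condition). -/
noncomputable def andersonMatrix {d : ℕ} (Λ : Finset (Fin d → ℤ)) (ε : ℝ)
    (ξ : (Fin d → ℤ) → ℝ) : Matrix Λ Λ ℝ :=
  Matrix.of fun x y => latticeSchrodinger ε ξ (Pi.single (y : Fin d → ℤ) 1) x

/-- The matrix acts as the operator does on functions extended by zero outside `Λ`. -/
theorem andersonMatrix_mulVec {d : ℕ} (Λ : Finset (Fin d → ℤ)) (ε : ℝ)
    (ξ : (Fin d → ℤ) → ℝ) (f : (Fin d → ℤ) → ℝ) (hf : ∀ x ∉ Λ, f x = 0) (x : Λ) :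
    ((andersonMatrix Λ ε ξ).mulVec fun y => f y) x = latticeSchrodinger ε ξ f x := by
  have key : ∀ z, ∑ y : Λ, (Pi.single (y : Fin d → ℤ) (1 : ℝ) : (Fin d → ℤ) → ℝ) z * f y
      = f z := by
    intro z
    rw [Finset.sum_coe_sort Λ fun y => (Pi.single y (1 : ℝ) : (Fin d → ℤ) → ℝ) z * f y]
    simp only [Pi.single_apply, ite_mul, one_mul, zero_mul, Finset.sum_ite_eq]
    split_ifs with h
    · rfl
    · exact (hf z h).symm
  simp only [Matrix.mulVec, dotProduct, andersonMatrix, Matrix.of_apply, latticeSchrodinger,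
    latticeLaplacian, add_mul, Finset.sum_add_distrib, mul_assoc, Finset.sum_mul, sub_mul,
    ← Finset.mul_sum]
  rw [key]
  congr 2
  rw [Finset.sum_comm, Finset.sum_comm (s := Finset.univ (α := Λ))]
  simp only [Finset.sum_sub_distrib, key]

theorem andersonMatrix_isHermitian {d : ℕ} (Λ : Finset (Fin d → ℤ)) (ε : ℝ)
    (ξ : (Fin d → ℤ) → ℝ) : (andersonMatrix Λ ε ξ).IsHermitian := by
  ext x y
  have h1 : ∀ i : Fin d, ((y : Fin d → ℤ) + Pi.single i 1 = (x : Fin d → ℤ)) ↔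
      ((x : Fin d → ℤ) - Pi.single i 1 = (y : Fin d → ℤ)) := fun i => by
    constructor <;> intro h <;> simp [← h]
  have h2 : ∀ i : Fin d, ((y : Fin d → ℤ) - Pi.single i 1 = (x : Fin d → ℤ)) ↔
      ((x : Fin d → ℤ) + Pi.single i 1 = (y : Fin d → ℤ)) := fun i => by
    constructor <;> intro h <;> simp [← h]
  simp only [Matrix.conjTranspose_apply, andersonMatrix, Matrix.of_apply, latticeSchrodinger,
    latticeLaplacian, Pi.single_apply, h1, h2, star_trivial]
  by_cases h : (x : Fin d → ℤ) = y
  · simp [h]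
  · have h' : ¬ (y : Fin d → ℤ) = x := fun e => h e.symm
    simp [h, h', add_comm]

/-- The `k`-th smallest eigenvalue (`1 ≤ k ≤ |Λ|`, counted with multiplicity) of `-ε⁻² Δ + ξ`
on `Λ` with Dirichlet boundary condition. `Matrix.IsHermitian.eigenvalues₀` lists the eigenvalues
in decreasing order. The value is `0` when `k` is out of range. -/
noncomputable def andersonEigenvalue {d : ℕ} (Λ : Finset (Fin d → ℤ)) (ε : ℝ)
    (ξ : (Fin d → ℤ) → ℝ) (k : ℕ) : ℝ :=
  if h : 1 ≤ k ∧ k ≤ Fintype.card Λ then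
    (andersonMatrix_isHermitian Λ ε ξ).eigenvalues₀
      ⟨Fintype.card Λ - k, Nat.sub_lt (h.1.trans h.2) h.1⟩
  else 0

/-! ### The continuum operator -/

/-- The Hilbert space `L²(D) × L²(D; ℝᵈ)`, with norm `(‖u‖² + ‖g‖²)^{1/2}`. -/
abbrev L2Pair {d : ℕ} (D : Set (EuclideanSpace ℝ (Fin d))) : Type :=
  WithLp 2 (Lp ℝ 2 (volume.restrict D) ×
    Lp (EuclideanSpace ℝ (Fin d)) 2 (volume.restrict D))

/-- `H¹₀(D)`, each `u` being recorded as the pair `(u, ∇u)`: the closure in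
`L²(D) × L²(D; ℝᵈ)`, that is, for the `H¹` norm, of the pairs `(φ, ∇φ)` with `φ` smooth and
compactly supported in `D`. -/
noncomputable def H10 {d : ℕ} (D : Set (EuclideanSpace ℝ (Fin d))) : Submodule ℝ (L2Pair D) :=
  (Submodule.span ℝ {p : L2Pair D | ∃ φ : EuclideanSpace ℝ (Fin d) → ℝ,
    ContDiff ℝ (⊤ : ℕ∞) φ ∧ HasCompactSupport φ ∧ tsupport φ ⊆ D ∧
    (p.fst : EuclideanSpace ℝ (Fin d) → ℝ) =ᵐ[volume.restrict D] φ ∧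
    (p.snd : EuclideanSpace ℝ (Fin d) → EuclideanSpace ℝ (Fin d))
      =ᵐ[volume.restrict D] gradient φ}).topologicalClosure

/-- `u ∈ H¹₀(D)` solves `-Δ u + U u = lam u` weakly:
`∫ ∇u · ∇v + ∫ U u v = lam ∫ u v` for all `v ∈ H¹₀(D)`. -/
def IsDirichletEigenvector {d : ℕ} (D : Set (EuclideanSpace ℝ (Fin d)))
    (U : EuclideanSpace ℝ (Fin d) → ℝ) (lam : ℝ) (u : H10 D) : Prop :=
  ∀ v : H10 D,
    (∫ x in D, inner ℝ (u.1.snd x) (v.1.snd x)) + (∫ x in D, U x * (u.1.fst x * v.1.fst x)) =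
      lam * ∫ x in D, u.1.fst x * v.1.fst x

/-- `lam` is the `k`-th smallest eigenvalue, counted with multiplicity, of `-Δ + U` on `H¹₀(D)`:
the eigenspaces for eigenvalues `< lam` have total dimension less than `k`, while those for
eigenvalues `≤ lam` have total dimension at least `k`. -/
def IsKthDirichletEigenvalue {d : ℕ} (D : Set (EuclideanSpace ℝ (Fin d)))
    (U : EuclideanSpace ℝ (Fin d) → ℝ) (k : ℕ) (lam : ℝ) : Prop :=
  Module.rank ℝ (Submodule.span ℝ {u : H10 D | ∃ m < lam, IsDirichletEigenvector D U m u})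
      < (k : Cardinal) ∧
  (k : Cardinal) ≤
    Module.rank ℝ (Submodule.span ℝ {u : H10 D | ∃ m ≤ lam, IsDirichletEigenvector D U m u})

/-- The `k`-th smallest eigenvalue is unique. -/
theorem IsKthDirichletEigenvalue.unique {d : ℕ} {D : Set (EuclideanSpace ℝ (Fin d))}
    {U : EuclideanSpace ℝ (Fin d) → ℝ} {k : ℕ} {s t : ℝ}
    (hs : IsKthDirichletEigenvalue D U k s) (ht : IsKthDirichletEigenvalue D U k t) : s = t := by
  have key : ∀ {s t : ℝ}, IsKthDirichletEigenvalue D U k s →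
      IsKthDirichletEigenvalue D U k t → ¬ s < t := by
    intro s t hs ht hst
    refine absurd (hs.2.trans (Submodule.rank_mono (Submodule.span_mono ?_))) (not_le.2 ht.1)
    rintro u ⟨m, hm, hu⟩
    exact ⟨m, hm.trans_lt hst, hu⟩
  exact le_antisymm (not_lt.1 (key ht hs)) (not_lt.1 (key hs ht))

/-!
By the min-max principle the `k`-th eigenvalue of the lattice operator, and likewise that of `-Δ + U`
on `H¹₀(D)`, is the infimum of the levels `t` of `k`-dimensional trial spaces, on which the form
is at most `t` times the squared `L²` norm (`HasTrialSpace`). In the continuum this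
rests on the compactness of `H¹₀(D) ⊆ L²(D)` (`rank_eigenvectors_lt`, `le_rank_eigenvectors`,
`isCompactOperator_h10ToL2`), on the lattice on the spectral theorem. It therefore suffices to move trial spaces back and forth between `ℤᵈ` and `D` at
a small cost in the level (`hasTrialSpace_of_perturbation`).

From `D` to the lattice, a test function is replaced by its averages over the cells
`∏ᵢ [ε xᵢ, ε (xᵢ + 1))`: this does not increase the Dirichlet energy (`edgeEnergy_cellAvg_le`), moves
the function by `O(ε)` in `L²` (`integral_sub_cellAvg_sq_le`), and gives a function on `D_ε` for small
`ε` because a finite-dimensional space of test functions has its support in one compact subset of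
`D`. From the lattice to `D`, a function on `D_ε` is interpolated by tensor products of smoothed hat
functions: this increases the energy by a factor `κ` as close to `1` as desired
(`integral_gradient_interp_sq_le`), again moves the function by `O(ε)` (`integral_interp_sub_sq_le`),
and gives a test function on `D` by the very definition of `D_ε` (`tsupport_interp_subset`). The
compact embedding also comes from cell averages, which are finite-rank approximations of the
identity.

Randomness enters only through the potential. For one test function `ψ`, the variable
`∫ ξ(⌊z / ε⌋) ψ(z)² dz` is a sum of independent terms with variance `O(ε^d)` and mean tending to
`∫ U ψ²`, so that it converges in probability by Chebyshev's inequality (`tendsto_prob_test`). The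
`H¹` unit ball is totally bounded in `L²` and the potentials are uniformly bounded, so finitely many
`ψ` control all test functions at once, relative to the squared `H¹` norm
(`tendsto_prob_potential`). On the event where the potentials are close in this sense, the comparison
of trial spaces is deterministic (`exists_forall_abs_andersonEigenvalue_sub_lt`).
-/

/-! ### Trial spaces and the eigenvalues of a compact form -/

/-- The functionals `Q` and `N` on `V` admit a `k`-dimensional trial space at level `t`: an
injective linear image of `ℝᵏ` on which `Q ≤ t N`. -/
def HasTrialSpace {V : Type*} [AddCommGroup V] [Module ℝ V] (Q N : V → ℝ) (k : ℕ) (t : ℝ) : Prop :=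
  ∃ P : (Fin k → ℝ) →ₗ[ℝ] V, Function.Injective P ∧ ∀ c, Q (P c) ≤ t * N (P c)

section CompactForm

variable {H L : Type*} [NormedAddCommGroup H] [NormedSpace ℝ H]
  [NormedAddCommGroup L] [InnerProductSpace ℝ L]

/-- `u` solves `q(u, ·) = m ⟨J u, J ·⟩`. -/
def IsFormEigenvector (q : H →L[ℝ] H →L[ℝ] ℝ) (J : H →L[ℝ] L) (m : ℝ) (u : H) : Prop :=
  ∀ v, q u v = m * inner ℝ (J u) (J v)

variable {q : H →L[ℝ] H →L[ℝ] ℝ} {J : H →L[ℝ] L}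

/-- Eigenvectors with different eigenvalues are orthogonal for the form and for `⟨J ·, J ·⟩`, so that
`M ‖J u‖² - q(u, u)` is the square `‖J ∑ⱼ cⱼ (M - mⱼ)^{1/2} wⱼ‖²`. No linear independence is needed. -/
theorem form_sum_le_of_eigenvectors (hq : ∀ u v, q u v = q v u) {ι : Type*} [Fintype ι]
    (w : ι → H) (m : ι → ℝ) (hw : ∀ j, IsFormEigenvector q J (m j) (w j)) {M : ℝ}
    (hM : ∀ j, m j ≤ M) (c : ι → ℝ) :
    q (∑ j, c j • w j) (∑ j, c j • w j) ≤ M * ‖J (∑ j, c j • w j)‖ ^ 2 := by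
  have key : ∀ i j, (M - m i) * inner ℝ (J (w i)) (J (w j)) =
      (√(M - m i) * √(M - m j)) * inner ℝ (J (w i)) (J (w j)) := by
    intro i j
    by_cases h : inner ℝ (J (w i)) (J (w j)) = 0
    · simp [h]
    · have h1 := hw i (w j)
      rw [hq, hw j (w i), real_inner_comm] at h1
      have h2 : m j = m i := mul_right_cancel₀ h h1
      rw [h2, Real.mul_self_sqrt (sub_nonneg.2 (hM i))]
  have h0 : M * ‖J (∑ j, c j • w j)‖ ^ 2 - q (∑ j, c j • w j) (∑ j, c j • w j) =
      ‖J (∑ j, (c j * √(M - m j)) • w j)‖ ^ 2 := by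
    rw [← real_inner_self_eq_norm_sq, ← real_inner_self_eq_norm_sq]
    simp only [map_sum, map_smul, sum_inner, inner_sum, sum_apply,
      smul_apply, inner_smul_left, inner_smul_right, smul_eq_mul,
      Finset.mul_sum, ← Finset.sum_sub_distrib]
    rw [Finset.sum_comm]
    refine Finset.sum_congr rfl fun i _ => Finset.sum_congr rfl fun j _ => ?_
    have h1 := hw j (w i)
    have h2 := key j i
    have h3 := real_inner_comm (J (w i)) (J (w j))
    have h4 := hq (w i) (w j)
    simp only [conj_trivial]
    rw [h4, h1, h3]
    rw [h3] at h2
    linear_combination (c i * c j) * h2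
  have := sq_nonneg ‖J (∑ j, (c j * √(M - m j)) • w j)‖
  linarith

/-- Otherwise `k` linearly independent eigenvectors for eigenvalues below `lam` would span a trial
space at the largest of these eigenvalues. -/
theorem rank_eigenvectors_lt (hq : ∀ u v, q u v = q v u) {k : ℕ} (hk : 1 ≤ k) {lam : ℝ}
    (h : ∀ t, HasTrialSpace (fun u => q u u) (fun u => ‖J u‖ ^ 2) k t → lam ≤ t) :
    Module.rank ℝ (Submodule.span ℝ {u : H | ∃ m < lam, IsFormEigenvector q J m u})
      < (k : Cardinal) := by
  by_contra hcon
  rw [not_lt] at hcon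
  obtain ⟨b, hbS, hspan, hli⟩ :=
    exists_linearIndependent ℝ {u : H | ∃ m < lam, IsFormEigenvector q J m u}
  rw [← hspan, rank_span_set hli] at hcon
  have hcon' : Cardinal.mk (ULift (Fin k)) ≤ Cardinal.mk b := by simpa using hcon
  obtain ⟨e⟩ := hcon'
  let w : Fin k → H := fun j => (e ⟨j⟩ : H)
  have hwli : LinearIndependent ℝ w := hli.comp (fun j => e ⟨j⟩) fun i j hij => by
    simpa using e.injective hij
  have hwS : ∀ j, ∃ m < lam, IsFormEigenvector q J m (w j) := fun j => hbS (e ⟨j⟩).2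
  choose m hm hw using hwS
  have : Nonempty (Fin k) := ⟨⟨0, hk⟩⟩
  obtain ⟨j0, hj0⟩ := Finite.exists_max m
  refine absurd (h (m j0) ⟨Fintype.linearCombination ℝ w,
    linearIndependent_iff_injective_fintypeLinearCombination.1 hwli, fun c => ?_⟩)
    (not_le.2 (hm j0))
  simp only [Fintype.linearCombination_apply]
  exact form_sum_le_of_eigenvectors hq w m hw hj0 c

/-- A minimising sequence of the form on a closed subspace is Cauchy: compactness of `J` gives
convergence of `J u_n`, and the parallelogram law upgrades it to convergence in `H`. -/
theorem exists_form_minimizer [CompleteSpace H]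
    (hJ : IsCompactOperator J) {c : ℝ}
    (hc : ∀ u, ‖u‖ ^ 2 ≤ q u u + c * ‖J u‖ ^ 2) (G : Submodule ℝ H) (hG : IsClosed (G : Set H))
    (hne : ∃ v ∈ G, J v ≠ 0) :
    ∃ u ∈ G, ‖J u‖ = 1 ∧ ∀ v ∈ G, q u u * ‖J v‖ ^ 2 ≤ q v v := by
  set S : Set ℝ := {r | ∃ v ∈ G, ‖J v‖ = 1 ∧ q v v = r} with hS
  have hSne : S.Nonempty := by
    obtain ⟨v, hv, hJv⟩ := hne
    refine ⟨_, ‖J v‖⁻¹ • v, G.smul_mem _ hv, ?_, rfl⟩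
    rw [map_smul, norm_smul, norm_inv, norm_norm, inv_mul_cancel₀ (norm_ne_zero_iff.2 hJv)]
  have hSbdd : BddBelow S := by
    refine ⟨-c, ?_⟩
    rintro r ⟨v, -, hv1, rfl⟩
    have := hc v
    rw [hv1] at this
    nlinarith [sq_nonneg ‖v‖]
  set μ := sInf S with hμ
  have hμle : ∀ v ∈ G, μ * ‖J v‖ ^ 2 ≤ q v v := by
    intro v hv
    by_cases hJv : J v = 0
    · have := hc v
      rw [hJv] at this ⊢
      simp only [norm_zero, ne_eq, OfNat.ofNat_ne_zero, not_false_eq_true, zero_pow, mul_zero,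
        add_zero] at this ⊢
      exact (sq_nonneg _).trans this
    · have hn : 0 < ‖J v‖ := norm_pos_iff.2 hJv
      have : μ ≤ q (‖J v‖⁻¹ • v) (‖J v‖⁻¹ • v) := by
        refine csInf_le hSbdd ⟨‖J v‖⁻¹ • v, G.smul_mem _ hv, ?_, rfl⟩
        rw [map_smul, norm_smul, norm_inv, norm_norm, inv_mul_cancel₀ hn.ne']
      simp only [map_smul, smul_apply, smul_eq_mul] at this
      have h2 := mul_le_mul_of_nonneg_right this (sq_nonneg ‖J v‖)
      refine h2.trans_eq ?_
      field_simp
  obtain ⟨r, -, hrlim, hrS⟩ := exists_seq_tendsto_sInf hSne hSbdd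
  choose v hvG hv1 hvr using hrS
  have hvlim : Tendsto (fun n => q (v n) (v n)) atTop (𝓝 μ) := by simpa only [hvr] using hrlim
  obtain ⟨R, hR⟩ := hvlim.bddAbove_range
  have hvb : ∀ n, v n ∈ Metric.closedBall (0 : H) (√(R + c)) := by
    intro n
    rw [mem_closedBall_zero_iff]
    apply Real.le_sqrt_of_sq_le
    have h1 := hc (v n)
    rw [hv1] at h1
    have h2 : q (v n) (v n) ≤ R := hR ⟨n, rfl⟩
    linarith
  obtain ⟨K, hK, hKsub⟩ := IsCompactOperator.image_closedBall_subset_compact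
    (f := (J : H →ₗ[ℝ] L)) hJ (√(R + c))
  obtain ⟨y, -, φ, hφ, hy⟩ := hK.tendsto_subseq (x := fun n => J (v n))
    fun n => hKsub ⟨v n, hvb n, rfl⟩
  set w : ℕ → H := fun n => v (φ n) with hw
  have hwlim : Tendsto (fun n => q (w n) (w n)) atTop (𝓝 μ) := hvlim.comp hφ.tendsto_atTop
  have hwJ : Tendsto (fun n => J (w n)) atTop (𝓝 y) := hy
  have hyn : ‖y‖ = 1 := tendsto_nhds_unique hwJ.norm (by simp [hw, hv1])
  -- parallelogram law: `q (a - b) = 2 q a + 2 q b - q (a + b)`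
  have hbound : ∀ m n, ‖w m - w n‖ ^ 2 ≤ 2 * q (w m) (w m) + 2 * q (w n) (w n)
      - μ * ‖J (w m) + J (w n)‖ ^ 2 + c * ‖J (w m) - J (w n)‖ ^ 2 := by
    intro m n
    have h1 := hc (w m - w n)
    have h2 := hμle (w m + w n) (G.add_mem (hvG _) (hvG _))
    simp only [map_sub, map_add, sub_apply, add_apply]
      at h1 h2
    linarith
  have hlim2 : Tendsto (fun p : ℕ × ℕ => 2 * q (w p.1) (w p.1) + 2 * q (w p.2) (w p.2)
      - μ * ‖J (w p.1) + J (w p.2)‖ ^ 2 + c * ‖J (w p.1) - J (w p.2)‖ ^ 2)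
      (atTop ×ˢ atTop) (𝓝 0) := by
    have e1 := hwlim.comp (tendsto_fst (f := (atTop : Filter ℕ)) (g := (atTop : Filter ℕ)))
    have e2 := hwlim.comp (tendsto_snd (f := (atTop : Filter ℕ)) (g := (atTop : Filter ℕ)))
    have j1 := hwJ.comp (tendsto_fst (f := (atTop : Filter ℕ)) (g := (atTop : Filter ℕ)))
    have j2 := hwJ.comp (tendsto_snd (f := (atTop : Filter ℕ)) (g := (atTop : Filter ℕ)))
    have := (((e1.const_mul 2).add (e2.const_mul 2)).sub (((j1.add j2).norm.pow 2).const_mul μ)).add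
      (((j1.sub j2).norm.pow 2).const_mul c)
    have hz : 2 * μ + 2 * μ - μ * ‖y + y‖ ^ 2 + c * ‖y - y‖ ^ 2 = 0 := by
      rw [← two_smul ℝ y, norm_smul, hyn]
      simp
      ring
    rw [hz] at this
    exact this
  have hcau : CauchySeq w := by
    rw [cauchySeq_iff_tendsto_dist_atTop_0, ← prod_atTop_atTop_eq]
    have h3 : Tendsto (fun p : ℕ × ℕ => ‖w p.1 - w p.2‖ ^ 2) (atTop ×ˢ atTop) (𝓝 0) :=
      squeeze_zero (fun _ => sq_nonneg _) (fun p => hbound p.1 p.2) hlim2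
    have h4 := h3.sqrt
    simpa [Real.sqrt_sq, dist_eq_norm] using h4
  obtain ⟨u, hu⟩ := cauchySeq_tendsto_of_complete hcau
  have huG : u ∈ G := hG.mem_of_tendsto hu (Eventually.of_forall fun n => hvG _)
  have hJu : J u = y := tendsto_nhds_unique ((J.continuous.tendsto u).comp hu) hwJ
  have hqu : q u u = μ := by
    refine tendsto_nhds_unique ?_ hwlim
    have hcont : Continuous fun x : H => q x x := by fun_prop
    exact (hcont.tendsto u).comp hu
  refine ⟨u, huG, by rw [hJu, hyn], fun v hv => ?_⟩
  rw [hqu]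
  exact hμle v hv

/-- The Euler-Lagrange equation of a minimizer. -/
theorem form_eq_of_minimizer (hq : ∀ u v, q u v = q v u) {G : Submodule ℝ H} {u : H} (hu : u ∈ G)
    (hu1 : ‖J u‖ = 1) (hmin : ∀ v ∈ G, q u u * ‖J v‖ ^ 2 ≤ q v v) {v : H} (hv : v ∈ G) :
    q u v = q u u * inner ℝ (J u) (J v) := by
  set μ := q u u with hμ
  have h : ∀ s : ℝ, 0 ≤ (q v v - μ * ‖J v‖ ^ 2) * (s * s) +
      (2 * (q u v - μ * inner ℝ (J u) (J v))) * s + 0 := by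
    intro s
    have h1 := hmin (u + s • v) (G.add_mem hu (G.smul_mem s hv))
    rw [map_add, map_smul, norm_add_sq_real, norm_smul, inner_smul_right, hu1, mul_pow,
      Real.norm_eq_abs, sq_abs] at h1
    simp only [map_add, map_smul, add_apply, smul_apply,
      smul_eq_mul] at h1
    rw [hq v u, ← hμ] at h1
    linarith
  have h2 := discrim_le_zero h
  simp only [discrim, mul_zero, sub_zero] at h2
  have h3 : q u v - μ * inner ℝ (J u) (J v) = 0 := by nlinarith [sq_nonneg (q u v - μ * inner ℝ (J u) (J v))]
  linarith

/-- If the span `F` of the eigenvectors had dimension less than `k`, trial spaces at all levels above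
`lam` would meet the space orthogonal to `J F`. The minimizer of the form there is then an
eigenvector for an eigenvalue at most `lam`, hence in `F`: a contradiction. -/
theorem le_rank_eigenvectors [CompleteSpace H] (hq : ∀ u v, q u v = q v u)
    (hJ : IsCompactOperator J) {c : ℝ}
    (hc : ∀ u, ‖u‖ ^ 2 ≤ q u u + c * ‖J u‖ ^ 2) {k : ℕ} {lam : ℝ}
    (h : ∀ t > lam, HasTrialSpace (fun u => q u u) (fun u => ‖J u‖ ^ 2) k t) :
    (k : Cardinal) ≤
      Module.rank ℝ (Submodule.span ℝ {u : H | ∃ m ≤ lam, IsFormEigenvector q J m u}) := by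
  by_contra hcon
  rw [not_le] at hcon
  set F := Submodule.span ℝ {u : H | ∃ m ≤ lam, IsFormEigenvector q J m u} with hF
  have : FiniteDimensional ℝ F :=
    Module.rank_lt_aleph0_iff.1 (hcon.trans (Cardinal.natCast_lt_aleph0))
  have hFk : Module.finrank ℝ F < k := by
    rw [← Module.finrank_eq_rank] at hcon
    exact_mod_cast hcon
  set JF := F.map (J : H →ₗ[ℝ] L) with hJF
  have hJFk : Module.finrank ℝ JF < k := (Submodule.finrank_map_le _ _).trans_lt hFk
  set G : Submodule ℝ H := (JFᗮ).comap (J : H →ₗ[ℝ] L) with hGdef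
  have hGcl : IsClosed (G : Set H) := by
    have : IsClosed (JFᗮ : Set L) := JF.isClosed_orthogonal
    exact this.preimage J.continuous
  have hmeet : ∀ t > lam, ∃ v ∈ G, J v ≠ 0 ∧ q v v ≤ t * ‖J v‖ ^ 2 := by
    intro t ht
    obtain ⟨P, hP, hPt⟩ := h t ht
    let T : (Fin k → ℝ) →ₗ[ℝ] JF :=
      (JF.orthogonalProjectionOnto : L →ₗ[ℝ] JF) ∘ₗ (J : H →ₗ[ℝ] L) ∘ₗ P
    have hT : LinearMap.ker T ≠ ⊥ := LinearMap.ker_ne_bot_of_finrank_lt (by simpa using hJFk)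
    obtain ⟨x, hx, hx0⟩ := Submodule.exists_mem_ne_zero_of_ne_bot hT
    have hxT : JF.orthogonalProjectionOnto (J (P x)) = 0 := by simpa [T] using hx
    refine ⟨P x, ?_, ?_, hPt x⟩
    · exact Submodule.orthogonalProjectionOnto_eq_zero_iff.1 hxT
    · intro hJ0
      have h1 := hc (P x)
      have h2 := hPt x
      simp only [hJ0, norm_zero, ne_eq, OfNat.ofNat_ne_zero, not_false_eq_true, zero_pow,
        mul_zero, add_zero] at h1 h2
      have h3 : ‖P x‖ = 0 := by nlinarith [norm_nonneg (P x)]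
      exact hx0 (hP (by simpa using h3))
  obtain ⟨u, huG, hu1, hmin⟩ := exists_form_minimizer hJ hc G hGcl (by
    obtain ⟨v, hv, hv0, -⟩ := hmeet (lam + 1) (by linarith)
    exact ⟨v, hv, hv0⟩)
  have hμ : q u u ≤ lam := by
    refine le_of_forall_gt_imp_ge_of_dense fun t ht => ?_
    obtain ⟨v, hv, hv0, hvt⟩ := hmeet t ht
    have hpos : 0 < ‖J v‖ ^ 2 := by positivity
    exact le_of_mul_le_mul_right ((hmin v hv).trans hvt) hpos
  have hort : ∀ w ∈ F, ∀ g ∈ G, inner ℝ (J w) (J g) = 0 := fun w hw g hg =>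
    Submodule.inner_right_of_mem_orthogonal (K := JF) (Submodule.mem_map_of_mem hw) hg
  have hqF : ∀ w ∈ F, q w u = 0 := by
    intro w hw
    have hw' := hw
    rw [hF] at hw'
    induction hw' using Submodule.span_induction with
    | mem x hx =>
      obtain ⟨m, -, hm⟩ := hx
      rw [hm u, hort x hw u huG, mul_zero]
    | zero => simp
    | add x y hx hy h1 h2 => simp [h1 hx, h2 hy]
    | smul a x hx h1 => simp [h1 hx]
  have huEig : IsFormEigenvector q J (q u u) u := by
    intro v
    -- `v` is the sum of an element `w` of `F` and an element of `G`
    obtain ⟨w, hw, hwv⟩ : ∃ w ∈ F, J w = JF.orthogonalProjectionOnto (J v) := by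
      exact Submodule.mem_map.1 (JF.orthogonalProjectionOnto (J v)).2
    have hg : v - w ∈ G := by
      show J (v - w) ∈ JFᗮ
      rw [map_sub, hwv]
      exact Submodule.sub_starProjection_mem_orthogonal (J v)
    have h1 := form_eq_of_minimizer hq huG hu1 hmin hg
    have h2 : q u w = 0 := by rw [hq, hqF w hw]
    have h3 : inner ℝ (J u) (J w) = 0 := by rw [real_inner_comm]; exact hort w hw u huG
    rw [map_sub, map_sub, inner_sub_right, h2, h3, sub_zero, sub_zero] at h1
    exact h1
  have huF : u ∈ F := Submodule.subset_span ⟨_, hμ, huEig⟩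
  have := hort u huF u huG
  rw [real_inner_self_eq_norm_sq, hu1] at this
  norm_num at this

/-- Trial spaces can be moved into a dense subspace at the price of an arbitrarily small increase
of the level: the strict inequality on the compact unit sphere is an open condition on a basis. -/
theorem HasTrialSpace.of_denseRange {c : ℝ}
    (hc : ∀ u, ‖u‖ ^ 2 ≤ q u u + c * ‖J u‖ ^ 2) {T : Type*} [AddCommGroup T] [Module ℝ T]
    (e : T →ₗ[ℝ] H) (he : DenseRange e) {k : ℕ} {s t : ℝ} (hst : s < t)
    (h : HasTrialSpace (fun u => q u u) (fun u => ‖J u‖ ^ 2) k s) :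
    HasTrialSpace (fun f => q (e f) (e f)) (fun f => ‖J (e f)‖ ^ 2) k t := by
  obtain ⟨P, hP, hPs⟩ := h
  let Fn : (Fin k → H) → (Fin k → ℝ) → ℝ := fun w x =>
    q (∑ j, x j • w j) (∑ j, x j • w j) - t * ‖J (∑ j, x j • w j)‖ ^ 2
  have hFc : Continuous fun p : (Fin k → H) × (Fin k → ℝ) => Fn p.1 p.2 := by
    simp only [Fn]
    fun_prop
  let w₀ : Fin k → H := fun j => P (Pi.single j 1)
  have hPw : ∀ x, P x = ∑ j, x j • w₀ j := fun x => by
    conv_lhs => rw [pi_eq_sum_univ' x]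
    simp [w₀, map_sum]
  have hneg : ∀ x ∈ Metric.sphere (0 : Fin k → ℝ) 1, Fn w₀ x < 0 := by
    intro x hx
    have hx0 : x ≠ 0 := by
      rintro rfl
      simp at hx
    simp only [Fn, ← hPw]
    have h1 := hPs x
    have h2 := hc (P x)
    have h3 : 0 < ‖P x‖ := norm_pos_iff.2 fun h0 => hx0 (hP (by simpa using h0))
    have h4 : 0 < ‖J (P x)‖ := by
      by_contra h5
      have h6 : ‖J (P x)‖ = 0 := le_antisymm (not_lt.1 h5) (norm_nonneg _)
      simp only [h6, ne_eq, OfNat.ofNat_ne_zero, not_false_eq_true, zero_pow, mul_zero,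
        add_zero] at h1 h2
      nlinarith
    simp only at h1
    nlinarith [mul_pos (sub_pos.2 hst) (pow_pos h4 2)]
  have hev : ∀ᶠ w in 𝓝 w₀, ∀ x ∈ Metric.sphere (0 : Fin k → ℝ) 1, Fn w x < 0 := by
    refine (isCompact_sphere (0 : Fin k → ℝ) 1).eventually_forall_of_forall_eventually ?_
    intro x hx
    exact (hFc.tendsto (w₀, x)).eventually_lt_const (hneg x hx)
  obtain ⟨f, hf⟩ := (DenseRange.piMap fun _ : Fin k => he).exists_mem_open
    isOpen_interior ⟨w₀, mem_interior_iff_mem_nhds.2 hev⟩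
  have hf' : ∀ x ∈ Metric.sphere (0 : Fin k → ℝ) 1, Fn (Pi.map (fun _ => e) f) x < 0 :=
    interior_subset hf
  have hcomb : ∀ x, e (Fintype.linearCombination ℝ f x) = ∑ j, x j • e (f j) := fun x => by
    simp [Fintype.linearCombination_apply, map_sum]
  have hlt : ∀ x : Fin k → ℝ, x ≠ 0 → q (e (Fintype.linearCombination ℝ f x))
      (e (Fintype.linearCombination ℝ f x)) <
        t * ‖J (e (Fintype.linearCombination ℝ f x))‖ ^ 2 := by
    intro x hx
    have hxn : 0 < ‖x‖ := norm_pos_iff.2 hx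
    have h1 := hf' (‖x‖⁻¹ • x) (by simp [norm_smul, hxn.ne'])
    have h2 : ∑ j, (‖x‖⁻¹ • x) j • Pi.map (fun _ => e) f j =
        ‖x‖⁻¹ • e (Fintype.linearCombination ℝ f x) := by
      rw [hcomb, Finset.smul_sum]
      simp [mul_smul]
    simp only [Fn, h2, map_smul, smul_apply, smul_eq_mul, norm_smul, norm_inv,
      norm_norm] at h1
    have h3 : ‖x‖⁻¹ ^ 2 * (q (e (Fintype.linearCombination ℝ f x))
      (e (Fintype.linearCombination ℝ f x)) -
        t * ‖J (e (Fintype.linearCombination ℝ f x))‖ ^ 2) < 0 := by linarith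
    have h4 : 0 < ‖x‖⁻¹ ^ 2 := by positivity
    nlinarith [(mul_neg_iff.1 h3).resolve_right fun h => absurd h.1 (not_lt.2 h4.le)]
  refine ⟨Fintype.linearCombination ℝ f, ?_, fun x => ?_⟩
  · rw [← LinearMap.ker_eq_bot, LinearMap.ker_eq_bot']
    intro x hx
    by_contra hx0
    have := hlt x hx0
    simp [hx] at this
  · by_cases hx : x = 0
    · simp [hx]
    · exact (hlt x hx).le

end CompactForm

/-! ### Trial spaces and the eigenvalues of a symmetric matrix -/

namespace Matrix.IsHermitian

variable {n : Type*} [Fintype n] [DecidableEq n] {A : Matrix n n ℝ} (hA : A.IsHermitian)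

/-- Coordinates in the eigenvector basis, indexed as `eigenvalues₀` is. -/
noncomputable def eigenCoord : (n → ℝ) ≃ₗ[ℝ] (Fin (Fintype.card n) → ℝ) :=
  (WithLp.linearEquiv 2 ℝ (n → ℝ)).symm ≪≫ₗ hA.eigenvectorBasis.repr.toLinearEquiv ≪≫ₗ
    WithLp.linearEquiv 2 ℝ (n → ℝ) ≪≫ₗ
    LinearEquiv.funCongrLeft ℝ ℝ (Fintype.equivOfCardEq (Fintype.card_fin _))

theorem eigenCoord_apply (f : n → ℝ) (i : Fin (Fintype.card n)) :
    hA.eigenCoord f i = inner ℝ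
      (hA.eigenvectorBasis (Fintype.equivOfCardEq (Fintype.card_fin _) i)) (WithLp.toLp 2 f) := by
  rw [← OrthonormalBasis.repr_apply_apply]
  rfl

theorem dotProduct_self_eq (f : n → ℝ) : f ⬝ᵥ f = ∑ i, hA.eigenCoord f i ^ 2 := by
  have h := hA.eigenvectorBasis.sum_sq_norm_inner_right (WithLp.toLp 2 f)
  have h2 : ‖(WithLp.toLp 2 f : EuclideanSpace ℝ n)‖ ^ 2 = f ⬝ᵥ f := by
    rw [EuclideanSpace.norm_sq_eq]
    simp [dotProduct, sq]
  rw [← h2, ← h, ← (Fintype.equivOfCardEq (Fintype.card_fin (Fintype.card n))).sum_comp]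
  simp [eigenCoord_apply]

theorem eigenCoord_mulVec (f : n → ℝ) (i : Fin (Fintype.card n)) :
    hA.eigenCoord (A *ᵥ f) i = hA.eigenvalues₀ i * hA.eigenCoord f i := by
  set e : Fin (Fintype.card n) ≃ n := Fintype.equivOfCardEq (Fintype.card_fin _) with he
  have h1 := hA.mulVec_eigenvectorBasis (e i)
  have h2 : hA.eigenvalues (e i) = hA.eigenvalues₀ i := by simp [eigenvalues, he]
  have key : ∀ g : n → ℝ, hA.eigenCoord g i = (hA.eigenvectorBasis (e i)).ofLp ⬝ᵥ g := by
    intro g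
    rw [eigenCoord_apply, EuclideanSpace.inner_eq_star_dotProduct, dotProduct_comm]
    rfl
  have hT : Aᵀ = A := by simpa [IsHermitian, conjTranspose] using hA
  rw [key, key, dotProduct_mulVec, ← mulVec_transpose, hT, h1, h2, smul_dotProduct, smul_eq_mul]

theorem dotProduct_mulVec_eq (f : n → ℝ) :
    f ⬝ᵥ (A *ᵥ f) = ∑ i, hA.eigenvalues₀ i * hA.eigenCoord f i ^ 2 := by
  have h1 := hA.dotProduct_self_eq (f + A *ᵥ f)
  have h2 := hA.dotProduct_self_eq (f - A *ᵥ f)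
  have h3 : (f + A *ᵥ f) ⬝ᵥ (f + A *ᵥ f) - (f - A *ᵥ f) ⬝ᵥ (f - A *ᵥ f) =
      4 * (f ⬝ᵥ (A *ᵥ f)) := by
    simp only [add_dotProduct, dotProduct_add, sub_dotProduct, dotProduct_sub]
    rw [dotProduct_comm (A *ᵥ f) f]
    ring
  rw [h1, h2, ← Finset.sum_sub_distrib] at h3
  have h4 : ∑ i, (hA.eigenCoord (f + A *ᵥ f) i ^ 2 - hA.eigenCoord (f - A *ᵥ f) i ^ 2) =
      4 * ∑ i, hA.eigenvalues₀ i * hA.eigenCoord f i ^ 2 := by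
    rw [Finset.mul_sum]
    refine Finset.sum_congr rfl fun i _ => ?_
    simp only [map_add, map_sub, Pi.add_apply, Pi.sub_apply, eigenCoord_mulVec]
    ring
  linarith

/-- One half of the Courant-Fischer principle: the eigenvectors of the `k` smallest eigenvalues
span a trial space. -/
theorem hasTrialSpace_eigenvalues₀ {k : ℕ} (hk : 1 ≤ k) (hkn : k ≤ Fintype.card n) :
    HasTrialSpace (fun f : n → ℝ => f ⬝ᵥ (A *ᵥ f)) (fun f => f ⬝ᵥ f) k
      (hA.eigenvalues₀ ⟨Fintype.card n - k, Nat.sub_lt (hk.trans hkn) hk⟩) := by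
  let σ : Fin k → Fin (Fintype.card n) := fun j => ⟨Fintype.card n - k + j, by omega⟩
  have hσ : Function.Injective σ := fun i j h => by
    simp only [σ, Fin.mk.injEq] at h
    exact Fin.ext (by omega)
  refine ⟨hA.eigenCoord.symm.toLinearMap ∘ₗ Function.ExtendByZero.linearMap ℝ σ, ?_, fun c => ?_⟩
  · refine hA.eigenCoord.symm.injective.comp fun x y hxy => ?_
    ext j
    have h : Function.extend σ x 0 (σ j) = Function.extend σ y 0 (σ j) := congrFun hxy (σ j)
    simpa only [hσ.extend_apply] using h
  · simp only [hA.dotProduct_self_eq, hA.dotProduct_mulVec_eq]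
    simp only [LinearMap.coe_comp, LinearEquiv.coe_coe, Function.comp_apply,
      LinearEquiv.apply_symm_apply, Finset.mul_sum]
    refine Finset.sum_le_sum fun i _ => ?_
    by_cases hi : ∃ j, σ j = i
    · obtain ⟨j, rfl⟩ := hi
      refine mul_le_mul_of_nonneg_right (hA.eigenvalues₀_antitone ?_) (sq_nonneg _)
      simp [σ, Fin.le_def]
    · have : Function.ExtendByZero.linearMap ℝ σ c i = 0 :=
        Function.extend_apply' c (0 : Fin (Fintype.card n) → ℝ) i hi
      simp [this]

/-- The other half of the Courant-Fischer principle: a `k`-dimensional trial space meets the span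
of the eigenvectors of all but the `k - 1` smallest eigenvalues. -/
theorem eigenvalues₀_le_of_hasTrialSpace {k : ℕ} (hk : 1 ≤ k) (hkn : k ≤ Fintype.card n) {t : ℝ}
    (h : HasTrialSpace (fun f : n → ℝ => f ⬝ᵥ (A *ᵥ f)) (fun f => f ⬝ᵥ f) k t) :
    hA.eigenvalues₀ ⟨Fintype.card n - k, Nat.sub_lt (hk.trans hkn) hk⟩ ≤ t := by
  obtain ⟨P, hP, hPt⟩ := h
  set m : Fin (Fintype.card n) := ⟨Fintype.card n - k, Nat.sub_lt (hk.trans hkn) hk⟩ with hm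
  let T : (Fin k → ℝ) →ₗ[ℝ] ({i // m < i} → ℝ) :=
    LinearMap.funLeft ℝ ℝ Subtype.val ∘ₗ hA.eigenCoord.toLinearMap ∘ₗ P
  have hT : LinearMap.ker T ≠ ⊥ := by
    refine LinearMap.ker_ne_bot_of_finrank_lt ?_
    have : Fintype.card {i // m < i} = Fintype.card n - 1 - m := by
      rw [Fintype.card_subtype]
      simp [Finset.filter_lt_eq_Ioi]
    rw [Module.finrank_fintype_fun_eq_card, this, Module.finrank_fintype_fun_eq_card,
      Fintype.card_fin]
    have : (m : ℕ) = Fintype.card n - k := rfl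
    omega
  obtain ⟨x, hx, hx0⟩ := Submodule.exists_mem_ne_zero_of_ne_bot hT
  have hxi : ∀ i, m < i → hA.eigenCoord (P x) i = 0 := fun i hi => by
    simpa [T, LinearMap.funLeft] using congrFun (LinearMap.mem_ker.1 hx) ⟨i, hi⟩
  have h1 := hPt x
  simp only at h1
  have hpos : 0 < P x ⬝ᵥ P x := by
    refine lt_of_le_of_ne (by rw [hA.dotProduct_self_eq]; positivity) fun h0 => ?_
    have := dotProduct_self_eq_zero.1 h0.symm
    exact hx0 (hP (by simpa using this))
  refine le_of_mul_le_mul_right (le_trans ?_ h1) hpos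
  rw [hA.dotProduct_self_eq, hA.dotProduct_mulVec_eq, Finset.mul_sum]
  refine Finset.sum_le_sum fun i _ => ?_
  by_cases hi : m < i
  · simp [hxi i hi]
  · exact mul_le_mul_of_nonneg_right (hA.eigenvalues₀_antitone (not_lt.1 hi)) (sq_nonneg _)

end Matrix.IsHermitian

/-! ### Lattice cells and step functions -/

/-- Cauchy-Schwarz against the constant function on a finite measure space. -/
theorem sq_integral_le {X : Type*} [MeasurableSpace X] {μ : Measure X} [IsFiniteMeasure μ]
    {g : X → ℝ} (hg : Integrable g μ) (hg2 : Integrable (fun x => g x ^ 2) μ) :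
    (∫ x, g x ∂μ) ^ 2 ≤ μ.real Set.univ * ∫ x, g x ^ 2 ∂μ := by
  set m := μ.real Set.univ with hm
  set I := ∫ x, g x ∂μ with hI
  by_cases h0 : m = 0
  · have : μ = 0 := by
      rw [← Measure.measure_univ_eq_zero]
      exact (measureReal_eq_zero_iff).1 h0
    simp [hI, this]
  have hmp : 0 < m := lt_of_le_of_ne measureReal_nonneg (Ne.symm h0)
  have h1 : 0 ≤ ∫ x, (m * g x - I) ^ 2 ∂μ := integral_nonneg fun _ => sq_nonneg _
  have h2 : ∫ x, (m * g x - I) ^ 2 ∂μ = m ^ 2 * (∫ x, g x ^ 2 ∂μ) - 2 * m * I * I + m * I ^ 2 := by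
    have e : ∀ x, (m * g x - I) ^ 2 = m ^ 2 * g x ^ 2 - 2 * m * I * g x + I ^ 2 := fun x => by ring
    simp only [e]
    have i2 : Integrable (fun x => m ^ 2 * g x ^ 2) μ := hg2.const_mul _
    have i1 : Integrable (fun x => 2 * m * I * g x) μ := hg.const_mul _
    have i0 : Integrable (fun x => m ^ 2 * g x ^ 2 - 2 * m * I * g x) μ := i2.sub i1
    rw [integral_add i0 (integrable_const _), integral_sub i2 i1, integral_const_mul, integral_const_mul,
      integral_const, smul_eq_mul]
  rw [h2] at h1
  have h3 : 0 ≤ m * (m * (∫ x, g x ^ 2 ∂μ) - I ^ 2) := by linarith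
  linarith [nonneg_of_mul_nonneg_right h3 hmp]

section Cells

variable {d : ℕ}

/-- The index of the cell `∏ᵢ [ε xᵢ, ε (xᵢ + 1))` that contains `z`. -/
noncomputable def cellIdx (ε : ℝ) (z : EuclideanSpace ℝ (Fin d)) : Fin d → ℤ := fun i => ⌊z i / ε⌋

/-- The half-open cube `∏ᵢ [ε xᵢ, ε (xᵢ + 1))`. -/
def cell (ε : ℝ) (x : Fin d → ℤ) : Set (EuclideanSpace ℝ (Fin d)) := cellIdx ε ⁻¹' {x}

theorem measurable_cellIdx (ε : ℝ) : Measurable (cellIdx (d := d) ε) := by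
  unfold cellIdx
  fun_prop

theorem measurableSet_cell (ε : ℝ) (x : Fin d → ℤ) : MeasurableSet (cell ε x) :=
  measurable_cellIdx ε (measurableSet_singleton x)

theorem mem_cell {ε : ℝ} {x : Fin d → ℤ} {z : EuclideanSpace ℝ (Fin d)} :
    z ∈ cell ε x ↔ cellIdx ε z = x := Iff.rfl

theorem mem_cell_iff {ε : ℝ} (hε : 0 < ε) {x : Fin d → ℤ} {z : EuclideanSpace ℝ (Fin d)} :
    z ∈ cell ε x ↔ ∀ i, ε * x i ≤ z i ∧ z i < ε * (x i + 1) := by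
  rw [mem_cell, funext_iff]
  refine forall_congr' fun i => ?_
  rw [cellIdx, Int.floor_eq_iff, le_div_iff₀ hε, div_lt_iff₀ hε, mul_comm ε, mul_comm ε]

theorem pairwise_disjoint_cell (ε : ℝ) :
    Pairwise (Function.onFun Disjoint (cell (d := d) ε)) := fun _ _ hxy =>
  Set.disjoint_left.2 fun _ hx hy => hxy (hx.symm.trans hy)

theorem iUnion_cell (ε : ℝ) : ⋃ x, cell (d := d) ε x = Set.univ :=
  Set.eq_univ_of_forall fun z => Set.mem_iUnion.2 ⟨cellIdx ε z, rfl⟩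

theorem volume_cell {ε : ℝ} (hε : 0 < ε) (x : Fin d → ℤ) :
    volume (cell ε x) = ENNReal.ofReal (ε ^ d) := by
  have h : cell ε x = (MeasurableEquiv.toLp 2 (Fin d → ℝ)).symm ⁻¹'
      (Set.univ.pi fun i => Set.Ico (ε * x i) (ε * (x i + 1))) := by
    ext z
    rw [mem_cell_iff hε]
    simp [Set.mem_pi]
  rw [h, (EuclideanSpace.volume_preserving_symm_measurableEquiv_toLp (Fin d)).measure_preimage
    (MeasurableSet.univ_pi fun i => measurableSet_Ico).nullMeasurableSet, Real.volume_pi_Ico]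
  have : ∀ i, ε * ((x i : ℝ) + 1) - ε * x i = ε := fun i => by ring
  simp [this, ENNReal.ofReal_pow hε.le]

theorem volume_real_cell {ε : ℝ} (hε : 0 < ε) (x : Fin d → ℤ) :
    volume.real (cell ε x) = ε ^ d := by
  rw [Measure.real, volume_cell hε, ENNReal.toReal_ofReal (by positivity)]

theorem isFiniteMeasure_restrict_cell {ε : ℝ} (hε : 0 < ε) (x : Fin d → ℤ) :
    IsFiniteMeasure ((volume : Measure (EuclideanSpace ℝ (Fin d))).restrict (cell ε x)) :=
  ⟨by rw [Measure.restrict_apply_univ, volume_cell hε]; exact ENNReal.ofReal_lt_top⟩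

theorem hasSum_integral_cell (ε : ℝ) {h : EuclideanSpace ℝ (Fin d) → ℝ} (hh : Integrable h) :
    HasSum (fun x => ∫ z in cell ε x, h z) (∫ z, h z) := by
  have := hasSum_integral_iUnion (f := h) (μ := volume) (measurableSet_cell (d := d) ε)
    (pairwise_disjoint_cell ε) hh.integrableOn
  rwa [iUnion_cell, setIntegral_univ] at this

theorem step_eq_sum {F : (Fin d → ℤ) → ℝ} (hF : F.support.Finite) (ε : ℝ)
    (z : EuclideanSpace ℝ (Fin d)) :
    F (cellIdx ε z) = ∑ x ∈ hF.toFinset, (cell ε x).indicator (fun _ => F x) z := by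
  have h1 : ∀ x, (cell ε x).indicator (fun _ => F x) z = if cellIdx ε z = x then F x else 0 := by
    intro x
    by_cases h : cellIdx ε z = x
    · rw [if_pos h, Set.indicator_of_mem (mem_cell.2 h)]
    · rw [if_neg h, Set.indicator_of_notMem (s := cell ε x) h]
  rw [Finset.sum_congr rfl fun x _ => h1 x, Finset.sum_ite_eq]
  split_ifs with h
  · rfl
  · simpa using h

theorem integrable_step {F : (Fin d → ℤ) → ℝ} (hF : F.support.Finite) {ε : ℝ} (hε : 0 < ε) :
    Integrable fun z : EuclideanSpace ℝ (Fin d) => F (cellIdx ε z) := by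
  simp only [step_eq_sum hF]
  refine integrable_finsetSum _ fun x _ => ?_
  refine (integrable_indicator_iff (measurableSet_cell ε x)).2 (integrableOn_const ?_)
  rw [volume_cell hε]
  exact ENNReal.ofReal_ne_top

theorem integral_step {F : (Fin d → ℤ) → ℝ} (hF : F.support.Finite) {ε : ℝ} (hε : 0 < ε) :
    ∫ z : EuclideanSpace ℝ (Fin d), F (cellIdx ε z) = ε ^ d * ∑' x, F x := by
  have h := (hasSum_integral_cell ε (integrable_step hF hε)).tsum_eq
  rw [← h, ← tsum_mul_left]
  refine tsum_congr fun x => ?_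
  rw [setIntegral_congr_fun (g := fun _ => F x) (measurableSet_cell ε x)
    (fun z hz => by simp only [mem_cell.1 hz]), setIntegral_const, volume_real_cell hε, smul_eq_mul]

/-- Moving a cell by one lattice step is a translation by `ε` in space. -/
theorem setIntegral_cell_add (ε : ℝ) (hε : 0 < ε) (x : Fin d → ℤ) (i : Fin d)
    (h : EuclideanSpace ℝ (Fin d) → ℝ) :
    ∫ z in cell ε (x + Pi.single i 1), h z =
      ∫ z in cell ε x, h (z + ε • EuclideanSpace.single i 1) := by
  have hpre : (fun z => z + ε • EuclideanSpace.single i (1 : ℝ)) ⁻¹' cell ε (x + Pi.single i 1) =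
      cell ε x := by
    ext z
    simp only [Set.mem_preimage, mem_cell_iff hε]
    refine forall_congr' fun j => ?_
    by_cases hj : j = i
    · subst hj
      simp only [PiLp.add_apply, PiLp.smul_apply, PiLp.single_apply, if_true, Pi.add_apply,
        Pi.single_eq_same, smul_eq_mul]
      push_cast
      constructor <;> rintro ⟨h1, h2⟩ <;> constructor <;> linarith
    · simp [hj]
  rw [← hpre]
  exact ((measurePreserving_add_right volume (ε • EuclideanSpace.single i (1 : ℝ))).setIntegral_preimage_emb
    (measurableEmbedding_addRight _) h _).symm

/-! ### Translations and averages over cells -/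

/-- The mean of `φ` over the cell with index `x`. -/
noncomputable def cellAvg (ε : ℝ) (φ : EuclideanSpace ℝ (Fin d) → ℝ) (x : Fin d → ℤ) : ℝ :=
  (ε ^ d)⁻¹ * ∫ z in cell ε x, φ z

/-- The sum of the squared differences over all nearest-neighbour edges of `ℤᵈ`. -/
noncomputable def edgeEnergy (f : (Fin d → ℤ) → ℝ) : ℝ :=
  ∑' x, ∑ i, (f (x + Pi.single i 1) - f x) ^ 2

theorem norm_gradient (φ : EuclideanSpace ℝ (Fin d) → ℝ) (z : EuclideanSpace ℝ (Fin d)) :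
    ‖gradient φ z‖ = ‖fderiv ℝ φ z‖ := by
  simp [gradient]

theorem gradient_apply (φ : EuclideanSpace ℝ (Fin d) → ℝ) (z : EuclideanSpace ℝ (Fin d))
    (i : Fin d) : gradient φ z i = fderiv ℝ φ z (EuclideanSpace.single i 1) := by
  have h : inner ℝ (gradient φ z) (EuclideanSpace.single i (1 : ℝ)) =
      fderiv ℝ φ z (EuclideanSpace.single i 1) := by
    rw [gradient, InnerProductSpace.toDual_symm_apply]
  rw [← h, EuclideanSpace.inner_single_right]
  simp

theorem norm_gradient_sq (φ : EuclideanSpace ℝ (Fin d) → ℝ) (z : EuclideanSpace ℝ (Fin d)) :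
    ‖gradient φ z‖ ^ 2 = ∑ i, fderiv ℝ φ z (EuclideanSpace.single i 1) ^ 2 := by
  rw [EuclideanSpace.norm_sq_eq]
  simp [gradient_apply]

theorem continuous_gradient {φ : EuclideanSpace ℝ (Fin d) → ℝ} (hφ : ContDiff ℝ 1 φ) :
    Continuous (gradient φ) :=
  (InnerProductSpace.toDual ℝ _).symm.continuous.comp (hφ.continuous_fderiv one_ne_zero)

theorem hasCompactSupport_gradient {φ : EuclideanSpace ℝ (Fin d) → ℝ} (hφ : HasCompactSupport φ) :
    HasCompactSupport (gradient φ) :=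
  (hφ.fderiv ℝ).comp_left (g := (InnerProductSpace.toDual ℝ _).symm) (map_zero _)

theorem HasCompactSupport.sq {X : Type*} [TopologicalSpace X] {φ : X → ℝ}
    (hφ : HasCompactSupport φ) : HasCompactSupport fun z => φ z ^ 2 :=
  hφ.comp_left (g := fun t : ℝ => t ^ 2) (by simp)

theorem integrable_sq {φ : EuclideanSpace ℝ (Fin d) → ℝ} (hφ : Continuous φ)
    (hc : HasCompactSupport φ) : Integrable fun z => φ z ^ 2 :=
  (hφ.pow 2).integrable_of_hasCompactSupport hc.sq

theorem integrable_gradient_sq {φ : EuclideanSpace ℝ (Fin d) → ℝ} (hφ : ContDiff ℝ 1 φ)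
    (hc : HasCompactSupport φ) : Integrable fun z => ‖gradient φ z‖ ^ 2 :=
  ((continuous_gradient hφ).norm.pow 2).integrable_of_hasCompactSupport
    ((hasCompactSupport_gradient hc).norm.sq)

/-- Translation estimate in `L²`: `φ (z + h) - φ z` is the integral of the derivative along the
segment, and translations preserve the integral. -/
theorem lintegral_translate_sub_sq_le {φ : EuclideanSpace ℝ (Fin d) → ℝ} (hφ : ContDiff ℝ 1 φ)
    (h : EuclideanSpace ℝ (Fin d)) :
    ∫⁻ z, ENNReal.ofReal ((φ (z + h) - φ z) ^ 2) ≤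
      ∫⁻ z, ENNReal.ofReal (fderiv ℝ φ z h ^ 2) := by
  have hD : Continuous fun p : EuclideanSpace ℝ (Fin d) × ℝ => fderiv ℝ φ (p.1 + p.2 • h) h := by
    have := hφ.continuous_fderiv one_ne_zero
    fun_prop
  have hpt : ∀ z, ENNReal.ofReal ((φ (z + h) - φ z) ^ 2) ≤
      ∫⁻ t in Set.Ioc (0 : ℝ) 1, ENNReal.ofReal (fderiv ℝ φ (z + t • h) h ^ 2) := by
    intro z
    have hDz : Continuous fun t : ℝ => fderiv ℝ φ (z + t • h) h :=
      hD.comp (by fun_prop : Continuous fun t : ℝ => (z, t))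
    have hftc : φ (z + h) - φ z = ∫ t in Set.Ioc (0 : ℝ) 1, fderiv ℝ φ (z + t • h) h := by
      rw [← intervalIntegral.integral_of_le zero_le_one,
        intervalIntegral.integral_eq_sub_of_hasDerivAt (f := fun t : ℝ => φ (z + t • h))]
      · simp
      · intro t _
        have h1 : HasFDerivAt φ (fderiv ℝ φ (z + t • h)) (z + t • h) :=
          (hφ.differentiable one_ne_zero _).hasFDerivAt
        have h2 : HasDerivAt (fun t : ℝ => z + t • h) h t := by
          simpa using ((hasDerivAt_id t).smul_const h).const_add z
        exact h1.comp_hasDerivAt t h2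
      · exact hDz.intervalIntegrable _ _
    have hi1 : IntegrableOn (fun t : ℝ => fderiv ℝ φ (z + t • h) h) (Set.Ioc 0 1) :=
      (hDz.integrableOn_Icc).mono_set Set.Ioc_subset_Icc_self
    have hi2 : IntegrableOn (fun t : ℝ => fderiv ℝ φ (z + t • h) h ^ 2) (Set.Ioc 0 1) :=
      ((hDz.pow 2).integrableOn_Icc).mono_set Set.Ioc_subset_Icc_self
    rw [← ofReal_integral_eq_lintegral_ofReal hi2 (ae_of_all _ fun _ => sq_nonneg _), hftc]
    refine ENNReal.ofReal_le_ofReal ((sq_integral_le hi1 hi2).trans_eq ?_)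
    simp
  calc ∫⁻ z, ENNReal.ofReal ((φ (z + h) - φ z) ^ 2)
      ≤ ∫⁻ z, ∫⁻ t in Set.Ioc (0 : ℝ) 1, ENNReal.ofReal (fderiv ℝ φ (z + t • h) h ^ 2) :=
        lintegral_mono hpt
    _ = ∫⁻ t in Set.Ioc (0 : ℝ) 1, ∫⁻ z, ENNReal.ofReal (fderiv ℝ φ (z + t • h) h ^ 2) :=
        lintegral_lintegral_swap
          (ENNReal.continuous_ofReal.comp (hD.pow 2)).measurable.aemeasurable
    _ = ∫⁻ t in Set.Ioc (0 : ℝ) 1, ∫⁻ z, ENNReal.ofReal (fderiv ℝ φ z h ^ 2) := by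
        refine lintegral_congr fun t => ?_
        exact lintegral_add_right_eq_self (fun z => ENNReal.ofReal (fderiv ℝ φ z h ^ 2)) (t • h)
    _ = ∫⁻ z, ENNReal.ofReal (fderiv ℝ φ z h ^ 2) := by simp

theorem integral_translate_sub_sq_le {φ : EuclideanSpace ℝ (Fin d) → ℝ} (hφ : ContDiff ℝ 1 φ)
    (hc : HasCompactSupport φ) (h : EuclideanSpace ℝ (Fin d)) :
    ∫ z, (φ (z + h) - φ z) ^ 2 ≤ ∫ z, fderiv ℝ φ z h ^ 2 := by
  have hd : Continuous fun z => fderiv ℝ φ z h := by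
    have := hφ.continuous_fderiv one_ne_zero
    fun_prop
  have hdc : HasCompactSupport fun z => fderiv ℝ φ z h :=
    (hc.fderiv ℝ).comp_left (g := fun L : EuclideanSpace ℝ (Fin d) →L[ℝ] ℝ => L h) (by simp)
  rw [integral_eq_lintegral_of_nonneg_ae (ae_of_all _ fun _ => sq_nonneg _)
    (by have := hφ.continuous; fun_prop),
    integral_eq_lintegral_of_nonneg_ae (ae_of_all _ fun _ => sq_nonneg _)
    (hd.pow 2).aestronglyMeasurable]
  refine ENNReal.toReal_mono ?_ (lintegral_translate_sub_sq_le hφ h)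
  exact ((integrable_sq hd hdc).lintegral_lt_top).ne

theorem integrable_translate_sub_sq {φ : EuclideanSpace ℝ (Fin d) → ℝ} (hφ : Continuous φ)
    (hc : HasCompactSupport φ) (h : EuclideanSpace ℝ (Fin d)) :
    Integrable fun z => (φ (z + h) - φ z) ^ 2 := by
  have h1 : MemLp φ 2 := hφ.memLp_of_hasCompactSupport hc
  have h2 : MemLp (fun z => φ (z + h)) 2 :=
    h1.comp_measurePreserving (measurePreserving_add_right volume h)
  exact (h2.sub h1).integrable_sq

/-- Averaging over cells does not increase the Dirichlet energy. -/
theorem edgeEnergy_cellAvg_le {φ : EuclideanSpace ℝ (Fin d) → ℝ} (hφ : ContDiff ℝ 1 φ)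
    (hc : HasCompactSupport φ) {ε : ℝ} (hε : 0 < ε) :
    ε ^ d * edgeEnergy (cellAvg ε φ) ≤ ε ^ 2 * ∫ z, ‖gradient φ z‖ ^ 2 := by
  have hεd : 0 < ε ^ d := by positivity
  have hφi : Integrable φ := hφ.continuous.integrable_of_hasCompactSupport hc
  set e : Fin d → EuclideanSpace ℝ (Fin d) := fun i => ε • EuclideanSpace.single i 1 with he
  have hpt : ∀ x i, (cellAvg ε φ (x + Pi.single i 1) - cellAvg ε φ x) ^ 2 ≤
      (ε ^ d)⁻¹ * ∫ z in cell ε x, (φ (z + e i) - φ z) ^ 2 := by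
    intro x i
    have := isFiniteMeasure_restrict_cell hε x
    have hi1 : Integrable (fun z => φ (z + e i)) := hφi.comp_add_right (e i)
    have h1 : cellAvg ε φ (x + Pi.single i 1) - cellAvg ε φ x =
        (ε ^ d)⁻¹ * ∫ z in cell ε x, (φ (z + e i) - φ z) := by
      rw [cellAvg, cellAvg, setIntegral_cell_add ε hε, integral_sub hi1.integrableOn hφi.integrableOn]
      ring
    have h2 := sq_integral_le (μ := volume.restrict (cell ε x)) (g := fun z => φ (z + e i) - φ z)
      (hi1.sub hφi).integrableOn (integrable_translate_sub_sq hφ.continuous hc _).integrableOn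
    rw [Measure.real, Measure.restrict_apply_univ, ← Measure.real, volume_real_cell hε] at h2
    rw [h1, mul_pow, inv_pow, sq (ε ^ d), mul_inv, mul_assoc]
    refine mul_le_mul_of_nonneg_left ?_ (by positivity)
    rw [inv_mul_le_iff₀ hεd]
    exact h2
  have hsum : HasSum (fun x => ∑ i, (ε ^ d)⁻¹ * ∫ z in cell ε x, (φ (z + e i) - φ z) ^ 2)
      (∑ i, (ε ^ d)⁻¹ * ∫ z, (φ (z + e i) - φ z) ^ 2) :=
    hasSum_sum fun i _ =>
      (hasSum_integral_cell ε (integrable_translate_sub_sq hφ.continuous hc (e i))).mul_left _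
  have hle : edgeEnergy (cellAvg ε φ) ≤ ∑ i, (ε ^ d)⁻¹ * ∫ z, (φ (z + e i) - φ z) ^ 2 := by
    rw [← hsum.tsum_eq]
    have hle' : ∀ x, ∑ i, (cellAvg ε φ (x + Pi.single i 1) - cellAvg ε φ x) ^ 2 ≤
        ∑ i, (ε ^ d)⁻¹ * ∫ z in cell ε x, (φ (z + e i) - φ z) ^ 2 := fun x =>
      Finset.sum_le_sum fun i _ => hpt x i
    exact (Summable.of_nonneg_of_le (fun x => Finset.sum_nonneg fun i _ => sq_nonneg _) hle'
      hsum.summable).tsum_le_tsum hle' hsum.summable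
  have hgr : ∑ i, ∫ z, fderiv ℝ φ z (EuclideanSpace.single i 1) ^ 2 = ∫ z, ‖gradient φ z‖ ^ 2 := by
    simp only [norm_gradient_sq]
    rw [integral_finsetSum]
    intro i _
    refine integrable_sq ?_ ?_
    · have := hφ.continuous_fderiv one_ne_zero
      fun_prop
    · exact (hc.fderiv ℝ).comp_left
        (g := fun L : EuclideanSpace ℝ (Fin d) →L[ℝ] ℝ => L (EuclideanSpace.single i 1)) (by simp)
  rw [← hgr, Finset.mul_sum]
  refine (mul_le_mul_of_nonneg_left hle hεd.le).trans ?_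
  rw [Finset.mul_sum]
  refine Finset.sum_le_sum fun i _ => ?_
  rw [mul_inv_cancel_left₀ hεd.ne', ← integral_const_mul]
  refine (integral_translate_sub_sq_le hφ hc (e i)).trans_eq (integral_congr_ae (ae_of_all _ fun z => ?_))
  simp [he, mul_pow]

/-- Poincaré inequality: on a cell, `φ z - cellAvg` is an average of differences `φ z - φ (z + h)`
with `h` in the cube `[-ε, ε]ᵈ`, so that the translation estimate applies. -/
theorem lintegral_sub_cellAvg_sq_le {φ : EuclideanSpace ℝ (Fin d) → ℝ} (hφ : ContDiff ℝ 1 φ)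
    (hc : HasCompactSupport φ) {ε : ℝ} (hε : 0 < ε) :
    ∫⁻ z, ENNReal.ofReal ((φ z - cellAvg ε φ (cellIdx ε z)) ^ 2) ≤
      ENNReal.ofReal (2 ^ d * d * ε ^ 2 * ∫ z, ‖gradient φ z‖ ^ 2) := by
  have hεd : 0 < ε ^ d := by positivity
  have hφi : Integrable φ := hφ.continuous.integrable_of_hasCompactSupport hc
  set box : Set (EuclideanSpace ℝ (Fin d)) := (MeasurableEquiv.toLp 2 (Fin d → ℝ)).symm ⁻¹'
      (Set.univ.pi fun _ => Set.Icc (-ε) ε) with hbox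
  have hboxm : MeasurableSet box := (MeasurableEquiv.measurable _)
    (MeasurableSet.univ_pi fun i => measurableSet_Icc)
  have hboxv : volume box = ENNReal.ofReal ((2 * ε) ^ d) := by
    rw [hbox, (EuclideanSpace.volume_preserving_symm_measurableEquiv_toLp (Fin d)).measure_preimage
      (MeasurableSet.univ_pi fun i => measurableSet_Icc).nullMeasurableSet, volume_pi_pi]
    have : ε - -ε = 2 * ε := by ring
    simp only [Real.volume_Icc, this, Finset.prod_const, Finset.card_univ, Fintype.card_fin]
    rw [ENNReal.ofReal_pow (by positivity)]
  have hmemb : ∀ h, h ∈ box ↔ ∀ i, -ε ≤ h i ∧ h i ≤ ε := by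
    intro h
    simp [hbox, Pi.le_def, forall_and]
  have hpt : ∀ z, ENNReal.ofReal ((φ z - cellAvg ε φ (cellIdx ε z)) ^ 2) ≤
      ENNReal.ofReal (ε ^ d)⁻¹ * ∫⁻ h in box, ENNReal.ofReal ((φ (z + h) - φ z) ^ 2) := by
    intro z
    set x := cellIdx ε z with hx
    have hzx : z ∈ cell ε x := rfl
    have := isFiniteMeasure_restrict_cell hε x
    have h1 : φ z - cellAvg ε φ x = (ε ^ d)⁻¹ * ∫ w in cell ε x, (φ z - φ w) := by
      rw [cellAvg, integral_sub (integrable_const _) hφi.integrableOn, setIntegral_const,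
        volume_real_cell hε, smul_eq_mul]
      field_simp
    have hg1 : Integrable (fun w => φ z - φ w) (volume.restrict (cell ε x)) :=
      (integrable_const _).sub hφi.integrableOn
    have hg2 : Integrable (fun w => (φ z - φ w) ^ 2) (volume.restrict (cell ε x)) := by
      have e : ∀ w, (φ z - φ w) ^ 2 = φ z ^ 2 - 2 * φ z * φ w + φ w ^ 2 := fun w => by ring
      simp only [e]
      exact ((integrable_const _).sub (hφi.integrableOn.const_mul _)).add
        (integrable_sq hφ.continuous hc).integrableOn
    have h2 := sq_integral_le hg1 hg2
    rw [Measure.real, Measure.restrict_apply_univ, ← Measure.real, volume_real_cell hε] at h2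
    have h3 : (φ z - cellAvg ε φ x) ^ 2 ≤ (ε ^ d)⁻¹ * ∫ w in cell ε x, (φ z - φ w) ^ 2 := by
      rw [h1, mul_pow, inv_pow, sq (ε ^ d), mul_inv, mul_assoc]
      refine mul_le_mul_of_nonneg_left ?_ (by positivity)
      rw [inv_mul_le_iff₀ hεd]
      exact h2
    refine (ENNReal.ofReal_le_ofReal h3).trans ?_
    rw [ENNReal.ofReal_mul (by positivity),
      ofReal_integral_eq_lintegral_ofReal hg2 (ae_of_all _ fun _ => sq_nonneg _)]
    refine mul_le_mul_right ?_ _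
    rw [← lintegral_indicator (measurableSet_cell ε x), ← lintegral_indicator hboxm,
      ← lintegral_add_left_eq_self _ z]
    refine lintegral_mono fun h => ?_
    by_cases hh : z + h ∈ cell ε x
    · have hhb : h ∈ box := by
        rw [hmemb]
        intro i
        have e1 := (mem_cell_iff hε).1 hzx i
        have e2 := (mem_cell_iff hε).1 hh i
        simp only [PiLp.add_apply] at e2
        constructor <;> linarith
      rw [Set.indicator_of_mem hh, Set.indicator_of_mem hhb, ← neg_sub, neg_sq]
    · rw [Set.indicator_of_notMem hh]
      exact zero_le
  have hnorm : ∀ h ∈ box, ‖h‖ ^ 2 ≤ d * ε ^ 2 := by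
    intro h hh
    rw [EuclideanSpace.norm_sq_eq]
    calc ∑ i, ‖h i‖ ^ 2 ≤ ∑ _i : Fin d, ε ^ 2 := by
          refine Finset.sum_le_sum fun i _ => ?_
          rw [Real.norm_eq_abs, sq_abs]
          have := (hmemb h).1 hh i
          nlinarith
      _ = d * ε ^ 2 := by simp
  have hin : ∀ h ∈ box, ∫⁻ z, ENNReal.ofReal ((φ (z + h) - φ z) ^ 2) ≤
      ENNReal.ofReal (d * ε ^ 2 * ∫ z, ‖gradient φ z‖ ^ 2) := by
    intro h hh
    refine (lintegral_translate_sub_sq_le hφ h).trans ?_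
    rw [← integral_const_mul, ofReal_integral_eq_lintegral_ofReal
      ((integrable_gradient_sq hφ hc).const_mul _) (ae_of_all _ fun _ => by positivity)]
    refine lintegral_mono fun z => ENNReal.ofReal_le_ofReal ?_
    have h1 := (fderiv ℝ φ z).le_opNorm h
    rw [← norm_gradient] at h1
    calc fderiv ℝ φ z h ^ 2 = ‖fderiv ℝ φ z h‖ ^ 2 := by rw [Real.norm_eq_abs, sq_abs]
      _ ≤ (‖gradient φ z‖ * ‖h‖) ^ 2 := by gcongr
      _ = ‖h‖ ^ 2 * ‖gradient φ z‖ ^ 2 := by ring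
      _ ≤ d * ε ^ 2 * ‖gradient φ z‖ ^ 2 := by
        gcongr
        exact hnorm h hh
  have hswap : Continuous fun p : EuclideanSpace ℝ (Fin d) × EuclideanSpace ℝ (Fin d) =>
      (φ (p.1 + p.2) - φ p.1) ^ 2 := by
    have := hφ.continuous
    fun_prop
  have hI : 0 ≤ ∫ z, ‖gradient φ z‖ ^ 2 := integral_nonneg fun _ => sq_nonneg _
  calc ∫⁻ z, ENNReal.ofReal ((φ z - cellAvg ε φ (cellIdx ε z)) ^ 2)
      ≤ ∫⁻ z, ENNReal.ofReal (ε ^ d)⁻¹ * ∫⁻ h in box, ENNReal.ofReal ((φ (z + h) - φ z) ^ 2) :=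
        lintegral_mono hpt
    _ = ENNReal.ofReal (ε ^ d)⁻¹ * ∫⁻ z, ∫⁻ h in box, ENNReal.ofReal ((φ (z + h) - φ z) ^ 2) :=
        lintegral_const_mul' _ _ ENNReal.ofReal_ne_top
    _ = ENNReal.ofReal (ε ^ d)⁻¹ * ∫⁻ h in box, ∫⁻ z, ENNReal.ofReal ((φ (z + h) - φ z) ^ 2) := by
        congr 1
        exact lintegral_lintegral_swap
          (ENNReal.continuous_ofReal.comp hswap).measurable.aemeasurable
    _ ≤ ENNReal.ofReal (ε ^ d)⁻¹ * ∫⁻ _h in box,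
          ENNReal.ofReal (d * ε ^ 2 * ∫ z, ‖gradient φ z‖ ^ 2) := by
        gcongr 1
        exact setLIntegral_mono measurable_const hin
    _ = ENNReal.ofReal (2 ^ d * d * ε ^ 2 * ∫ z, ‖gradient φ z‖ ^ 2) := by
        rw [setLIntegral_const, hboxv, ← ENNReal.ofReal_mul (by positivity),
          ← ENNReal.ofReal_mul (by positivity)]
        congr 1
        rw [mul_pow]
        field_simp

theorem integral_sub_cellAvg_sq_le {φ : EuclideanSpace ℝ (Fin d) → ℝ} (hφ : ContDiff ℝ 1 φ)
    (hc : HasCompactSupport φ) {ε : ℝ} (hε : 0 < ε) :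
    ∫ z, (φ z - cellAvg ε φ (cellIdx ε z)) ^ 2 ≤
      2 ^ d * d * ε ^ 2 * ∫ z, ‖gradient φ z‖ ^ 2 := by
  have hI : 0 ≤ ∫ z, ‖gradient φ z‖ ^ 2 := integral_nonneg fun _ => sq_nonneg _
  have hm : Measurable fun z => (φ z - cellAvg ε φ (cellIdx ε z)) ^ 2 :=
    (hφ.continuous.measurable.sub
      ((measurable_of_countable (cellAvg ε φ)).comp (measurable_cellIdx ε))).pow_const 2
  rw [integral_eq_lintegral_of_nonneg_ae (ae_of_all _ fun _ => sq_nonneg _)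
    hm.aestronglyMeasurable]
  exact ENNReal.toReal_le_of_le_ofReal (by positivity) (lintegral_sub_cellAvg_sq_le hφ hc hε)

end Cells

/-! ### Smooth interpolation of lattice functions -/

/-- A smooth probability density `g` on `[0, 1]` bounded by `κ`. For `κ` close to `1`, its primitive
is a smooth substitute for the linear ramp `t ↦ t` whose Dirichlet energy `∫ g²` is at most `κ`. -/
structure RampDensity (κ : ℝ) where
  /-- The density. -/
  g : ℝ → ℝ
  contDiff : ContDiff ℝ (⊤ : ℕ∞) g
  nonneg : ∀ t, 0 ≤ g t
  le : ∀ t, g t ≤ κ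
  eq_zero : ∀ t, t ∉ Set.Ioo (0 : ℝ) 1 → g t = 0
  integral_eq : ∫ t, g t = 1

/-- A normalized bump equal to `1` on most of `[0, 1]`. -/
theorem RampDensity.nonempty {κ : ℝ} (hκ : 1 < κ) : Nonempty (RampDensity κ) := by
  let f : ContDiffBump (1 / 2 : ℝ) :=
    { rIn := 1 / (2 * κ)
      rOut := 1 / 2
      rIn_pos := by positivity
      rIn_lt_rOut := by
        rw [div_lt_div_iff₀ (by positivity) (by positivity)]
        linarith }
  have hI : κ⁻¹ ≤ ∫ t, f t := by
    have h1 := f.measure_closedBall_le_integral (volume : Measure ℝ)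
    rw [Real.volume_real_closedBall f.rIn_pos.le] at h1
    refine le_trans (le_of_eq ?_) h1
    show κ⁻¹ = 2 * (1 / (2 * κ))
    field_simp
  have hIpos : 0 < ∫ t, f t := lt_of_lt_of_le (by positivity) hI
  refine ⟨⟨f.normed volume, f.contDiff_normed, f.nonneg_normed, fun t => ?_, fun t ht => ?_,
    f.integral_normed⟩⟩
  · rw [f.normed_def, div_le_iff₀ hIpos]
    have h2 : κ * κ⁻¹ ≤ κ * ∫ t, f t := by gcongr
    rw [mul_inv_cancel₀ (by positivity)] at h2
    exact f.le_one.trans h2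
  · by_contra h
    have h3 : t ∈ Function.support (f.normed volume) := h
    rw [f.support_normed_eq, Real.ball_eq_Ioo] at h3
    refine ht ?_
    have h4 : f.rOut = 1 / 2 := rfl
    rw [h4] at h3
    norm_num at h3
    exact h3

namespace RampDensity

variable {κ : ℝ} (p : RampDensity κ)

/-- The primitive of the density: a smooth ramp from `0` to `1` on `[0, 1]`. -/
noncomputable def ramp (t : ℝ) : ℝ := ∫ s in (0 : ℝ)..t, p.g s

/-- The smooth hat function `t ↦ ramp (t + 1) - ramp t`, supported in `[-1, 1]`. -/
noncomputable def hat (t : ℝ) : ℝ := p.ramp (t + 1) - p.ramp t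

theorem continuous_g : Continuous p.g := p.contDiff.continuous

theorem hasDerivAt_ramp (t : ℝ) : HasDerivAt p.ramp (p.g t) t :=
  intervalIntegral.integral_hasDerivAt_right (p.continuous_g.intervalIntegrable _ _)
    p.continuous_g.stronglyMeasurable.stronglyMeasurableAtFilter p.continuous_g.continuousAt

theorem contDiff_ramp : ContDiff ℝ (⊤ : ℕ∞) p.ramp := by
  have hd : deriv p.ramp = p.g := funext fun t => (p.hasDerivAt_ramp t).deriv
  rw [contDiff_infty_iff_deriv, hd]
  exact ⟨fun t => (p.hasDerivAt_ramp t).differentiableAt, p.contDiff⟩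

theorem contDiff_hat : ContDiff ℝ (⊤ : ℕ∞) p.hat :=
  (p.contDiff_ramp.comp (contDiff_id.add contDiff_const)).sub p.contDiff_ramp

theorem hasDerivAt_hat (t : ℝ) : HasDerivAt p.hat (p.g (t + 1) - p.g t) t :=
  ((p.hasDerivAt_ramp (t + 1)).comp_add_const t 1).sub (p.hasDerivAt_ramp t)

theorem hasDerivAt_hat_line (a b ε : ℝ) : HasDerivAt (fun t => p.hat ((a + t) / ε - b))
    ((p.g (a / ε - b + 1) - p.g (a / ε - b)) * ε⁻¹) 0 := by
  have h4 : HasDerivAt (fun t : ℝ => (a + t) / ε - b) ε⁻¹ 0 := by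
    simpa using (((hasDerivAt_id (0 : ℝ)).const_add a).div_const ε).sub_const b
  have h5 := p.hasDerivAt_hat ((a + 0) / ε - b)
  have h6 := h5.comp (0 : ℝ) h4
  rw [add_zero] at h6
  exact h6

theorem ramp_of_nonpos {t : ℝ} (ht : t ≤ 0) : p.ramp t = 0 := by
  rw [ramp, intervalIntegral.integral_symm, neg_eq_zero]
  refine intervalIntegral.integral_zero_ae (ae_of_all _ fun s hs => p.eq_zero s ?_)
  rw [Set.uIoc_of_le ht] at hs
  exact fun h => absurd h.1 (not_lt.2 hs.2)

theorem ramp_of_one_le {t : ℝ} (ht : 1 ≤ t) : p.ramp t = 1 := by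
  rw [ramp, intervalIntegral.integral_of_le (by linarith), ← p.integral_eq]
  refine setIntegral_eq_integral_of_forall_compl_eq_zero fun s hs => p.eq_zero s fun h => hs ?_
  exact ⟨h.1, h.2.le.trans ht⟩

theorem monotone_ramp : Monotone p.ramp := by
  refine monotone_of_deriv_nonneg (fun t => (p.hasDerivAt_ramp t).differentiableAt) fun t => ?_
  rw [(p.hasDerivAt_ramp t).deriv]
  exact p.nonneg t

theorem hat_nonneg (t : ℝ) : 0 ≤ p.hat t := sub_nonneg.2 (p.monotone_ramp (by linarith))

theorem hat_eq_zero {t : ℝ} (ht : t ∉ Set.Ioo (-1 : ℝ) 1) : p.hat t = 0 := by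
  rw [hat]
  rcases le_or_gt t (-1) with h | h
  · rw [p.ramp_of_nonpos (by linarith), p.ramp_of_nonpos (by linarith), sub_zero]
  · have h1 : 1 ≤ t := by
      by_contra h2
      exact ht ⟨h, not_le.1 h2⟩
    rw [p.ramp_of_one_le (by linarith), p.ramp_of_one_le h1, sub_self]

theorem hat_add_hat_sub_one {t : ℝ} (h0 : 0 ≤ t) (h1 : t ≤ 1) : p.hat t + p.hat (t - 1) = 1 := by
  rw [hat, hat, sub_add_cancel, p.ramp_of_one_le (by linarith), p.ramp_of_nonpos (t := t - 1)
    (by linarith)]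
  ring

theorem continuous_ramp : Continuous p.ramp := p.contDiff_ramp.continuous

theorem integral_hat : ∫ t, p.hat t = 1 := by
  have h1 : ∫ t, p.hat t = ∫ t in (-1 : ℝ)..1, p.hat t := by
    rw [intervalIntegral.integral_of_le (by norm_num)]
    refine (setIntegral_eq_integral_of_forall_compl_eq_zero fun s hs => p.hat_eq_zero ?_).symm
    exact fun h => hs ⟨h.1, h.2.le⟩
  have hi : ∀ a b, IntervalIntegrable p.ramp volume a b :=
    fun a b => p.continuous_ramp.intervalIntegrable a b
  have h2 : ∫ t in (-1 : ℝ)..1, p.hat t =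
      (∫ t in (-1 : ℝ)..1, p.ramp (t + 1)) - ∫ t in (-1 : ℝ)..1, p.ramp t :=
    intervalIntegral.integral_sub
      ((p.continuous_ramp.comp (continuous_id.add continuous_const)).intervalIntegrable _ _) (hi _ _)
  rw [h1, h2, intervalIntegral.integral_comp_add_right (fun t => p.ramp t)]
  norm_num
  rw [← intervalIntegral.integral_add_adjacent_intervals (hi 0 1) (hi 1 2),
    ← intervalIntegral.integral_add_adjacent_intervals (hi (-1) 0) (hi 0 1)]
  have h3 : ∫ t in (1 : ℝ)..2, p.ramp t = ∫ _t in (1 : ℝ)..2, (1 : ℝ) := by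
    refine intervalIntegral.integral_congr fun t ht => ?_
    rw [Set.uIcc_of_le (by norm_num)] at ht
    exact p.ramp_of_one_le ht.1
  have h4 : ∫ t in (-1 : ℝ)..0, p.ramp t = ∫ _t in (-1 : ℝ)..0, (0 : ℝ) := by
    refine intervalIntegral.integral_congr fun t ht => ?_
    rw [Set.uIcc_of_le (by norm_num)] at ht
    exact p.ramp_of_nonpos ht.2
  rw [h3, h4]
  norm_num

end RampDensity

section Tensor

variable {d : ℕ}

/-- The product kernel `∏ⱼ ηⱼ (zⱼ / ε - xⱼ)` centred at the lattice point `ε x`. -/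
noncomputable def tensorKernel (η : Fin d → ℝ → ℝ) (ε : ℝ) (x : Fin d → ℤ)
    (z : EuclideanSpace ℝ (Fin d)) : ℝ := ∏ j, η j (z j / ε - x j)

/-- The vertices `{0, 1}ᵈ` of the unit cube. -/
def cubeVertices (d : ℕ) : Finset (Fin d → ℤ) := Fintype.piFinset fun _ => {0, 1}

theorem card_cubeVertices : (cubeVertices d).card = 2 ^ d := by
  simp [cubeVertices, Fintype.card_piFinset]

variable {η : Fin d → ℝ → ℝ}

theorem tensorKernel_nonneg (h0 : ∀ j t, 0 ≤ η j t) (ε : ℝ) (x : Fin d → ℤ)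
    (z : EuclideanSpace ℝ (Fin d)) : 0 ≤ tensorKernel η ε x z :=
  Finset.prod_nonneg fun _ _ => h0 _ _

/-- Only the kernels centred at the vertices of the cell of `z` contribute at `z`. -/
theorem tensorKernel_eq_zero (hs : ∀ j t, t ∉ Set.Ioo (-1 : ℝ) 1 → η j t = 0) (ε : ℝ)
    (z : EuclideanSpace ℝ (Fin d)) (e : Fin d → ℤ) (he : e ∉ cubeVertices d) :
    tensorKernel η ε (cellIdx ε z + e) z = 0 := by
  simp only [cubeVertices, Fintype.mem_piFinset, not_forall] at he
  obtain ⟨j, hj⟩ := he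
  refine Finset.prod_eq_zero (Finset.mem_univ j) (hs j _ fun h => hj ?_)
  have h1 := Int.floor_le (z j / ε)
  have h2 := Int.lt_floor_add_one (z j / ε)
  simp only [Pi.add_apply, cellIdx, Int.cast_add, Set.mem_Ioo] at h
  have h3 : (e j : ℝ) < 2 := by linarith
  have h4 : (-1 : ℝ) < e j := by linarith
  have h5 : e j < 2 := by exact_mod_cast h3
  have h6 : -1 < e j := by exact_mod_cast h4
  simp only [Finset.mem_insert, Finset.mem_singleton]
  omega

theorem tsum_mul_tensorKernel (hs : ∀ j t, t ∉ Set.Ioo (-1 : ℝ) 1 → η j t = 0) (ε : ℝ)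
    (z : EuclideanSpace ℝ (Fin d)) (F : (Fin d → ℤ) → ℝ) :
    ∑' x, F x * tensorKernel η ε x z = ∑ e ∈ cubeVertices d,
      F (cellIdx ε z + e) * tensorKernel η ε (cellIdx ε z + e) z := by
  rw [← (Equiv.addLeft (cellIdx ε z)).tsum_eq]
  refine tsum_eq_sum fun e he => ?_
  simp [tensorKernel_eq_zero hs ε z e he]

/-- The total mass of the kernels at a point factorizes over the coordinates. -/
theorem sum_tensorKernel (ε : ℝ) (z : EuclideanSpace ℝ (Fin d)) :
    ∑ e ∈ cubeVertices d, tensorKernel η ε (cellIdx ε z + e) z =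
      ∏ j, (η j (z j / ε - ⌊z j / ε⌋) + η j (z j / ε - ⌊z j / ε⌋ - 1)) := by
  have h := Finset.prod_univ_sum (fun _ : Fin d => ({0, 1} : Finset ℤ))
    (fun j n => η j (z j / ε - ⌊z j / ε⌋ - n))
  have h1 : ∀ j : Fin d, ∑ n ∈ ({0, 1} : Finset ℤ), η j (z j / ε - ⌊z j / ε⌋ - n) =
      η j (z j / ε - ⌊z j / ε⌋) + η j (z j / ε - ⌊z j / ε⌋ - 1) := fun j => by
    rw [Finset.sum_pair (by norm_num)]
    simp
  simp only [h1] at h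
  rw [h]
  refine Finset.sum_congr rfl fun e _ => Finset.prod_congr rfl fun j _ => ?_
  simp only [cellIdx, Pi.add_apply, Int.cast_add, sub_sub]

/-- Jensen's inequality for the kernel weights, whose total mass is at most `c`. -/
theorem sq_tsum_mul_tensorKernel_le (h0 : ∀ j t, 0 ≤ η j t)
    (hs : ∀ j t, t ∉ Set.Ioo (-1 : ℝ) 1 → η j t = 0) (ε : ℝ) (z : EuclideanSpace ℝ (Fin d)) {c : ℝ}
    (hc : ∑ e ∈ cubeVertices d, tensorKernel η ε (cellIdx ε z + e) z ≤ c)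
    (F : (Fin d → ℤ) → ℝ) :
    (∑' x, F x * tensorKernel η ε x z) ^ 2 ≤ c * ∑' x, F x ^ 2 * tensorKernel η ε x z := by
  rw [tsum_mul_tensorKernel hs, tsum_mul_tensorKernel hs ε z (fun x => F x ^ 2)]
  have hw := fun e => tensorKernel_nonneg h0 ε (cellIdx ε z + e) z
  refine (Finset.sum_sq_le_sum_mul_sum_of_sq_le_mul (cubeVertices d)
    (f := fun e => tensorKernel η ε (cellIdx ε z + e) z)
    (g := fun e => F (cellIdx ε z + e) ^ 2 * tensorKernel η ε (cellIdx ε z + e) z)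
    (fun e _ => hw e) (fun e _ => mul_nonneg (sq_nonneg _) (hw e)) fun e _ => ?_).trans ?_
  · exact le_of_eq (by ring)
  · exact mul_le_mul_of_nonneg_right hc
      (Finset.sum_nonneg fun e _ => mul_nonneg (sq_nonneg _) (hw e))

theorem integral_tensorKernel {ε : ℝ} (hε : 0 < ε) (h1 : ∀ j, ∫ t, η j t = 1) (x : Fin d → ℤ) :
    ∫ z, tensorKernel η ε x z = ε ^ d := by
  have h := (EuclideanSpace.volume_preserving_symm_measurableEquiv_toLp (Fin d)).integral_comp'
    (fun y : Fin d → ℝ => ∏ j, η j (y j / ε - x j))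
  refine Eq.trans h ?_
  rw [integral_fintype_prod_volume_eq_prod (fun j (t : ℝ) => η j (t / ε - x j))]
  have h2 : ∀ j, ∫ t : ℝ, η j (t / ε - x j) = ε := fun j => by
    rw [Measure.integral_comp_div (fun t => η j (t - x j)),
      integral_sub_right_eq_self (fun t => η j t), h1 j, abs_of_pos hε, smul_eq_mul, mul_one]
  simp [h2]

theorem integrable_tensorKernel {ε : ℝ} (hε : 0 < ε) (h1 : ∀ j, ∫ t, η j t = 1)
    (x : Fin d → ℤ) : Integrable (tensorKernel η ε x) := by
  by_contra h
  -- the integral of a non-integrable function is `0` by convention, and not `ε ^ d`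
  have h2 := integral_tensorKernel hε h1 x
  rw [integral_undef h] at h2
  exact absurd h2 (by positivity)

end Tensor

section Interpolation

variable {d : ℕ} {κ : ℝ} (p : RampDensity κ)

/-- The smooth interpolation of the lattice function that equals `f` on `Λ` and vanishes
elsewhere. -/
noncomputable def interp (ε : ℝ) (Λ : Finset (Fin d → ℤ)) (f : (Fin d → ℤ) → ℝ)
    (z : EuclideanSpace ℝ (Fin d)) : ℝ := ∑ x ∈ Λ, f x * tensorKernel (fun _ => p.hat) ε x z

theorem contDiff_interp (ε : ℝ) (Λ : Finset (Fin d → ℤ)) (f : (Fin d → ℤ) → ℝ) :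
    ContDiff ℝ (⊤ : ℕ∞) (interp p ε Λ f) := by
  unfold interp tensorKernel
  refine ContDiff.sum fun x _ => contDiff_const.mul (contDiff_prod fun j _ => ?_)
  refine p.contDiff_hat.comp ?_
  fun_prop

variable {p}

theorem support_finite_of_eq_zero {Λ : Finset (Fin d → ℤ)} {f : (Fin d → ℤ) → ℝ}
    (hf : ∀ x ∉ Λ, f x = 0) : f.support.Finite :=
  Λ.finite_toSet.subset fun x hx => by
    by_contra h
    exact hx (hf x (by exact_mod_cast h))

theorem interp_eq_tsum (ε : ℝ) {Λ : Finset (Fin d → ℤ)} {f : (Fin d → ℤ) → ℝ}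
    (hf : ∀ x ∉ Λ, f x = 0) (z : EuclideanSpace ℝ (Fin d)) :
    interp p ε Λ f z = ∑' x, f x * tensorKernel (fun _ => p.hat) ε x z :=
  (tsum_eq_sum fun x hx => by rw [hf x hx, zero_mul]).symm

theorem interp_ne_zero {ε : ℝ} (hε : 0 < ε) {Λ : Finset (Fin d → ℤ)} {f : (Fin d → ℤ) → ℝ}
    {z : EuclideanSpace ℝ (Fin d)} (hz : interp p ε Λ f z ≠ 0) :
    ∃ x ∈ Λ, ∀ j, |z j - ε * x j| ≤ ε := by
  obtain ⟨x, hx, hx0⟩ := Finset.exists_ne_zero_of_sum_ne_zero hz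
  refine ⟨x, hx, fun j => ?_⟩
  by_contra hj
  refine hx0 (mul_eq_zero_of_right _ (Finset.prod_eq_zero (Finset.mem_univ j)
    (p.hat_eq_zero fun h => hj ?_)))
  have h1 : z j - ε * x j = ε * (z j / ε - x j) := by field_simp
  rw [h1, abs_mul, abs_of_pos hε]
  have : |z j / ε - x j| ≤ 1 := abs_le.2 ⟨h.1.le, h.2.le⟩
  nlinarith

/-- The kernels that represent the `i`-th partial derivative: `g` in direction `i`, hats in the
others. -/
noncomputable def derivKernel (p : RampDensity κ) (i : Fin d) (j : Fin d) : ℝ → ℝ :=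
  if j = i then p.g else p.hat

theorem derivKernel_nonneg (i j : Fin d) (t : ℝ) : 0 ≤ derivKernel p i j t := by
  unfold derivKernel
  split_ifs
  exacts [p.nonneg t, p.hat_nonneg t]

theorem derivKernel_eq_zero (i j : Fin d) (t : ℝ) (ht : t ∉ Set.Ioo (-1 : ℝ) 1) :
    derivKernel p i j t = 0 := by
  unfold derivKernel
  split_ifs
  · exact p.eq_zero t fun h => ht ⟨by linarith [h.1], h.2⟩
  · exact p.hat_eq_zero ht

theorem integral_derivKernel (i j : Fin d) : ∫ t, derivKernel p i j t = 1 := by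
  unfold derivKernel
  split_ifs
  exacts [p.integral_eq, p.integral_hat]

/-- The hats in the directions other than `i` are a partition of unity, and in direction `i` only
one of the two translates of `g` is non-zero. This is where the energy picks up the factor `κ`. -/
theorem sum_derivKernel_le (ε : ℝ) (z : EuclideanSpace ℝ (Fin d)) (i : Fin d) :
    ∑ e ∈ cubeVertices d, tensorKernel (derivKernel p i) ε (cellIdx ε z + e) z ≤ κ := by
  rw [sum_tensorKernel, ← Finset.mul_prod_erase _ _ (Finset.mem_univ i), Finset.prod_eq_one]
  · have h0 := Int.floor_le (z i / ε)
    have h1 := Int.lt_floor_add_one (z i / ε)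
    simp only [derivKernel, if_true, mul_one]
    rw [p.eq_zero (z i / ε - ⌊z i / ε⌋ - 1) fun h => by linarith [h.1], add_zero]
    exact p.le _
  · intro j hj
    have h0 := Int.floor_le (z j / ε)
    have h1 := Int.lt_floor_add_one (z j / ε)
    simp only [derivKernel, if_neg (Finset.ne_of_mem_erase hj)]
    exact p.hat_add_hat_sub_one (by linarith) (by linarith)

/-- Summation by parts: the derivative of the interpolation is the interpolation, with the kernels
`derivKernel`, of the difference quotients. -/
theorem fderiv_interp_single {ε : ℝ} {Λ : Finset (Fin d → ℤ)}
    {f : (Fin d → ℤ) → ℝ} (hf : ∀ x ∉ Λ, f x = 0) (z : EuclideanSpace ℝ (Fin d)) (i : Fin d) :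
    fderiv ℝ (interp p ε Λ f) z (EuclideanSpace.single i 1) =
      ε⁻¹ * ∑' x, (f (x + Pi.single i 1) - f x) * tensorKernel (derivKernel p i) ε x z := by
  have hsplit : ∀ (η : Fin d → ℝ → ℝ) (x : Fin d → ℤ) (y : EuclideanSpace ℝ (Fin d)),
      tensorKernel η ε x y = η i (y i / ε - x i) *
        ∏ j ∈ Finset.univ.erase i, η j (y j / ε - x j) :=
    fun η x y => (Finset.mul_prod_erase _ _ (Finset.mem_univ i)).symm
  have hker : ∀ x, HasDerivAt (fun t : ℝ => tensorKernel (fun _ => p.hat) ε x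
      (z + t • EuclideanSpace.single i (1 : ℝ)))
      (ε⁻¹ * (tensorKernel (derivKernel p i) ε (x - Pi.single i 1) z -
        tensorKernel (derivKernel p i) ε x z)) 0 := by
    intro x
    have h1 : ∀ t : ℝ, tensorKernel (fun _ => p.hat) ε x
        (z + t • EuclideanSpace.single i (1 : ℝ)) = p.hat ((z i + t) / ε - x i) *
          ∏ j ∈ Finset.univ.erase i, p.hat (z j / ε - x j) := by
      intro t
      rw [hsplit]
      congr 1
      · simp
      · refine Finset.prod_congr rfl fun j hj => ?_
        simp [Finset.ne_of_mem_erase hj]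
    have h2 : ∀ y : Fin d → ℤ, (∀ j ≠ i, y j = x j) →
        ∏ j ∈ Finset.univ.erase i, derivKernel p i j (z j / ε - y j) =
          ∏ j ∈ Finset.univ.erase i, p.hat (z j / ε - x j) := fun y hy =>
      Finset.prod_congr rfl fun j hj => by
        rw [derivKernel, if_neg (Finset.ne_of_mem_erase hj), hy j (Finset.ne_of_mem_erase hj)]
    have h7 := (p.hasDerivAt_hat_line (z i) (x i) ε).mul_const
      (∏ j ∈ Finset.univ.erase i, p.hat (z j / ε - x j))
    rw [← funext h1] at h7
    refine h7.congr_deriv ?_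
    rw [hsplit, hsplit, h2 _ fun j hj => by simp [hj], h2 _ fun j _ => rfl]
    simp only [derivKernel, if_true, Pi.sub_apply, Pi.single_eq_same, Int.cast_sub, Int.cast_one]
    rw [show z i / ε - ((x i : ℝ) - 1) = z i / ε - x i + 1 by ring]
    ring
  have hline : HasLineDerivAt ℝ (interp p ε Λ f)
      (∑ x ∈ Λ, f x * (ε⁻¹ * (tensorKernel (derivKernel p i) ε (x - Pi.single i 1) z -
        tensorKernel (derivKernel p i) ε x z))) z (EuclideanSpace.single i 1) :=
    HasDerivAt.fun_sum fun x _ => (hker x).const_mul (f x)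
  have hdiff : DifferentiableAt ℝ (interp p ε Λ f) z :=
    ((contDiff_interp p ε Λ f).differentiable (by simp)) z
  rw [← hdiff.lineDeriv_eq_fderiv, hline.lineDeriv]
  have hfs : f.support.Finite := support_finite_of_eq_zero hf
  have hsum : ∀ w : (Fin d → ℤ) → ℝ, Summable fun x => f x * w x := fun w =>
    summable_of_hasFiniteSupport (hfs.subset (Function.support_mul_subset_left _ _))
  have hsum' : ∀ w : (Fin d → ℤ) → ℝ, Summable fun x => f (x + Pi.single i 1) * w x := fun w => by
    have := (Equiv.addRight (Pi.single i (1 : ℤ))).summable_iff.2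
      (hsum fun x => w (x - Pi.single i 1))
    simpa [Function.comp_def] using this
  have e1 : ∑' x, f x * tensorKernel (derivKernel p i) ε (x - Pi.single i 1) z =
      ∑' x, f (x + Pi.single i 1) * tensorKernel (derivKernel p i) ε x z := by
    rw [← (Equiv.addRight (Pi.single i (1 : ℤ))).tsum_eq]
    simp
  simp only [sub_mul]
  rw [(hsum' _).tsum_sub (hsum _), ← e1, ← (hsum _).tsum_sub (hsum _),
    tsum_eq_sum (s := Λ) fun x hx => by simp [hf x hx], Finset.mul_sum]
  exact Finset.sum_congr rfl fun x _ => by ring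

theorem finite_support_diff {f : (Fin d → ℤ) → ℝ} (hf : f.support.Finite) (e : Fin d → ℤ) :
    (Function.support fun x => f (x + e) - f x).Finite := by
  refine ((hf.preimage (add_left_injective e).injOn).union hf).subset fun x hx => ?_
  by_contra h
  simp only [Set.mem_union, Set.mem_preimage, Function.mem_support, not_or, not_not] at h
  exact hx (by simp [h.1, h.2])

theorem finite_support_diff_sq {f : (Fin d → ℤ) → ℝ} (hf : f.support.Finite) (e : Fin d → ℤ) :
    (Function.support fun x => (f (x + e) - f x) ^ 2).Finite :=
  (finite_support_diff hf e).subset fun x hx h => hx (by simp [h])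

theorem edgeEnergy_eq_sum {f : (Fin d → ℤ) → ℝ} (hf : f.support.Finite) :
    edgeEnergy f = ∑ i, ∑' x, (f (x + Pi.single i 1) - f x) ^ 2 :=
  Summable.tsum_finsetSum fun _ _ => summable_of_hasFiniteSupport (finite_support_diff_sq hf _)

theorem edgeEnergy_nonneg (f : (Fin d → ℤ) → ℝ) : 0 ≤ edgeEnergy f :=
  tsum_nonneg fun _ => Finset.sum_nonneg fun _ _ => sq_nonneg _

/-- Interpolation increases the Dirichlet energy by at most the factor `κ`. -/
theorem integral_gradient_interp_sq_le {ε : ℝ} (hε : 0 < ε) {Λ : Finset (Fin d → ℤ)}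
    {f : (Fin d → ℤ) → ℝ} (hf : ∀ x ∉ Λ, f x = 0) (hc : HasCompactSupport (interp p ε Λ f)) :
    ∫ z, ‖gradient (interp p ε Λ f) z‖ ^ 2 ≤ κ * (ε ^ 2)⁻¹ * (ε ^ d * edgeEnergy f) := by
  have hfs : f.support.Finite := support_finite_of_eq_zero hf
  have hκ : 0 ≤ κ := (p.nonneg 0).trans (p.le 0)
  have hC1 : ContDiff ℝ 1 (interp p ε Λ f) := (contDiff_interp p ε Λ f).of_le (by norm_cast)
  have hint : ∀ i : Fin d, Integrable fun z =>
      fderiv ℝ (interp p ε Λ f) z (EuclideanSpace.single i 1) ^ 2 := by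
    intro i
    refine integrable_sq ?_ ?_
    · have := hC1.continuous_fderiv one_ne_zero
      fun_prop
    · exact (hc.fderiv ℝ).comp_left
        (g := fun L : EuclideanSpace ℝ (Fin d) →L[ℝ] ℝ => L (EuclideanSpace.single i 1)) (by simp)
  simp only [norm_gradient_sq]
  rw [integral_finsetSum _ fun i _ => hint i, edgeEnergy_eq_sum hfs, Finset.mul_sum, Finset.mul_sum]
  refine Finset.sum_le_sum fun i _ => ?_
  set S := (finite_support_diff_sq hfs (Pi.single i 1)).toFinset with hS
  have hSz : ∀ x ∉ S, (f (x + Pi.single i 1) - f x) ^ 2 = 0 := fun x hx => by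
    simpa [hS] using hx
  have hbound : ∀ z, fderiv ℝ (interp p ε Λ f) z (EuclideanSpace.single i 1) ^ 2 ≤
      (ε ^ 2)⁻¹ * κ * ∑ x ∈ S, (f (x + Pi.single i 1) - f x) ^ 2 *
        tensorKernel (derivKernel p i) ε x z := by
    intro z
    have hts : ∑' x, (f (x + Pi.single i 1) - f x) ^ 2 * tensorKernel (derivKernel p i) ε x z =
        ∑ x ∈ S, (f (x + Pi.single i 1) - f x) ^ 2 * tensorKernel (derivKernel p i) ε x z :=
      tsum_eq_sum fun x hx => by rw [hSz x hx, zero_mul]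
    rw [fderiv_interp_single hf, mul_pow, inv_pow, mul_assoc, ← hts]
    refine mul_le_mul_of_nonneg_left ?_ (by positivity)
    exact sq_tsum_mul_tensorKernel_le (fun j t => derivKernel_nonneg i j t)
      (fun j t => derivKernel_eq_zero i j t) ε z (sum_derivKernel_le ε z i)
      fun x => f (x + Pi.single i 1) - f x
  have hik : ∀ x, Integrable (tensorKernel (derivKernel p i) ε x) :=
    integrable_tensorKernel hε (integral_derivKernel i)
  refine (integral_mono (hint i) ((integrable_finsetSum _ fun x _ =>
    (hik x).const_mul _).const_mul _) hbound).trans_eq ?_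
  rw [integral_const_mul, integral_finsetSum _ fun x _ => (hik x).const_mul _, tsum_eq_sum hSz,
    Finset.mul_sum, Finset.mul_sum, Finset.mul_sum]
  refine Finset.sum_congr rfl fun x _ => ?_
  rw [integral_const_mul, integral_tensorKernel hε (integral_derivKernel i)]
  ring

theorem tsum_shift_add_sub_sq_le {f : (Fin d → ℤ) → ℝ} (hf : f.support.Finite)
    (σ τ : Fin d → ℤ) :
    ∑' x, (f (x + (σ + τ)) - f x) ^ 2 ≤
      2 * ∑' x, (f (x + τ) - f x) ^ 2 + 2 * ∑' x, (f (x + σ) - f x) ^ 2 := by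
  have hs : ∀ e : Fin d → ℤ, Summable fun x => (f (x + e) - f x) ^ 2 := fun e =>
    summable_of_hasFiniteSupport (finite_support_diff_sq hf e)
  have hsτ : Summable fun x => (f (x + σ + τ) - f (x + σ)) ^ 2 :=
    (hs τ).comp_injective (i := fun x => x + σ) (add_left_injective σ)
  have hshift : ∑' x, (f (x + σ + τ) - f (x + σ)) ^ 2 = ∑' x, (f (x + τ) - f x) ^ 2 :=
    (Equiv.addRight σ).tsum_eq fun x => (f (x + τ) - f x) ^ 2
  rw [← hshift, ← tsum_mul_left, ← tsum_mul_left,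
    ← (hsτ.mul_left 2).tsum_add ((hs σ).mul_left 2)]
  refine Summable.tsum_le_tsum (fun x => ?_) (hs _) ((hsτ.mul_left 2).add ((hs σ).mul_left 2))
  rw [← add_assoc]
  nlinarith [sq_nonneg ((f (x + σ + τ) - f (x + σ)) - (f (x + σ) - f x))]

/-- A shift to a vertex of the unit cube is made of at most `d` nearest-neighbour steps. -/
theorem tsum_shift_sub_sq_le {f : (Fin d → ℤ) → ℝ} (hf : f.support.Finite) (s : Finset (Fin d)) :
    ∑' x, (f (x + ∑ i ∈ s, Pi.single i 1) - f x) ^ 2 ≤ 4 ^ s.card * edgeEnergy f := by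
  have hE := edgeEnergy_nonneg f
  induction s using Finset.induction_on with
  | empty => simpa using hE
  | insert i s hi ih =>
    have hi1 : ∑' x, (f (x + Pi.single i 1) - f x) ^ 2 ≤ edgeEnergy f := by
      rw [edgeEnergy_eq_sum hf]
      exact Finset.single_le_sum (f := fun i => ∑' x, (f (x + Pi.single i 1) - f x) ^ 2)
        (fun j _ => tsum_nonneg fun _ => sq_nonneg _) (Finset.mem_univ i)
    have hle := tsum_shift_add_sub_sq_le hf (Pi.single i 1) (∑ i ∈ s, Pi.single i 1)
    rw [Finset.sum_insert hi, Finset.card_insert_of_notMem hi]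
    have h4 : (1 : ℝ) ≤ 4 ^ s.card := one_le_pow₀ (by norm_num)
    rw [pow_succ]
    nlinarith

/-- The interpolation is close in `L²` to the step function with the values of `f`. -/
theorem integral_interp_sub_sq_le {ε : ℝ} (hε : 0 < ε) {Λ : Finset (Fin d → ℤ)}
    {f : (Fin d → ℤ) → ℝ} (hf : ∀ x ∉ Λ, f x = 0) :
    ∫ z, (interp p ε Λ f z - f (cellIdx ε z)) ^ 2 ≤ 8 ^ d * (ε ^ d * edgeEnergy f) := by
  have hfs : f.support.Finite := support_finite_of_eq_zero hf
  have hs : ∀ (j : Fin d) (t : ℝ), t ∉ Set.Ioo (-1 : ℝ) 1 → p.hat t = 0 :=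
    fun j t ht => p.hat_eq_zero ht
  have h0 : ∀ (j : Fin d) (t : ℝ), 0 ≤ p.hat t := fun j t => p.hat_nonneg t
  have hbound : ∀ z, (interp p ε Λ f z - f (cellIdx ε z)) ^ 2 ≤
      ∑ e ∈ cubeVertices d, (f (cellIdx ε z + e) - f (cellIdx ε z)) ^ 2 := by
    intro z
    set n := cellIdx ε z with hn
    have hone : ∑ e ∈ cubeVertices d, tensorKernel (fun _ => p.hat) ε (n + e) z = 1 := by
      rw [hn, sum_tensorKernel]
      refine Finset.prod_eq_one fun j _ => ?_
      have h0 := Int.floor_le (z j / ε)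
      have h1 := Int.lt_floor_add_one (z j / ε)
      exact p.hat_add_hat_sub_one (by linarith) (by linarith)
    have hw := fun e => tensorKernel_nonneg h0 ε (n + e) z
    have h1 : interp p ε Λ f z - f n =
        ∑' x, (f x - f n) * tensorKernel (fun _ => p.hat) ε x z := by
      rw [interp_eq_tsum ε hf, tsum_mul_tensorKernel hs, tsum_mul_tensorKernel hs]
      simp only [sub_mul, Finset.sum_sub_distrib]
      rw [← Finset.mul_sum, ← hn, hone, mul_one]
    rw [h1]
    refine (sq_tsum_mul_tensorKernel_le h0 hs ε z hone.le _).trans ?_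
    rw [one_mul, tsum_mul_tensorKernel hs]
    refine Finset.sum_le_sum fun e he => ?_
    have hle : tensorKernel (fun _ => p.hat) ε (n + e) z ≤ 1 := by
      rw [← hone]
      exact Finset.single_le_sum (f := fun e => tensorKernel (fun _ => p.hat) ε (n + e) z)
        (fun e _ => hw e) he
    exact mul_le_of_le_one_right (sq_nonneg _) hle
  have hi : ∀ e, Integrable fun z : EuclideanSpace ℝ (Fin d) =>
      (f (cellIdx ε z + e) - f (cellIdx ε z)) ^ 2 :=
    fun e => integrable_step (finite_support_diff_sq hfs e) hε
  refine (integral_mono_of_nonneg (ae_of_all _ fun _ => sq_nonneg _)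
    (integrable_finsetSum (cubeVertices d) fun e _ => hi e) (ae_of_all _ hbound)).trans ?_
  rw [integral_finsetSum _ fun e _ => hi e]
  have hE := edgeEnergy_nonneg f
  calc ∑ e ∈ cubeVertices d, ∫ z : EuclideanSpace ℝ (Fin d),
        (f (cellIdx ε z + e) - f (cellIdx ε z)) ^ 2
      ≤ ∑ _e ∈ cubeVertices d, ε ^ d * (4 ^ d * edgeEnergy f) := by
        refine Finset.sum_le_sum fun e he => ?_
        rw [integral_step (finite_support_diff_sq hfs e) hε]
        refine mul_le_mul_of_nonneg_left ?_ (by positivity)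
        have hes : e = ∑ i ∈ Finset.univ.filter (fun i => e i = 1), Pi.single i 1 := by
          ext j
          simp only [cubeVertices, Fintype.mem_piFinset, Finset.mem_insert,
            Finset.mem_singleton] at he
          rw [Finset.sum_apply]
          simp only [Pi.single_apply, Finset.sum_ite_eq, Finset.mem_filter, Finset.mem_univ,
            true_and]
          rcases he j with h | h <;> simp [h]
        rw [hes]
        refine (tsum_shift_sub_sq_le hfs _).trans ?_
        refine mul_le_mul_of_nonneg_right (pow_le_pow_right₀ (by norm_num) ?_) hE
        exact (Finset.card_le_univ _).trans_eq (Fintype.card_fin d)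
    _ = 8 ^ d * (ε ^ d * edgeEnergy f) := by
        rw [Finset.sum_const, card_cubeVertices, nsmul_eq_mul]
        push_cast
        rw [show (8 : ℝ) = 2 * 4 by norm_num, mul_pow]
        ring

end Interpolation

/-! ### Test functions and `H¹₀(D)` -/

section Sobolev

variable {d : ℕ}

/-- The smooth functions with compact support in `D`. -/
def testFunctions (D : Set (EuclideanSpace ℝ (Fin d))) :
    Submodule ℝ (EuclideanSpace ℝ (Fin d) → ℝ) where
  carrier := {φ | ContDiff ℝ (⊤ : ℕ∞) φ ∧ HasCompactSupport φ ∧ tsupport φ ⊆ D}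
  add_mem' := fun {φ ψ} hφ hψ => ⟨hφ.1.add hψ.1, hφ.2.1.add hψ.2.1,
    (tsupport_add φ ψ).trans (Set.union_subset hφ.2.2 hψ.2.2)⟩
  zero_mem' := ⟨contDiff_const, HasCompactSupport.zero, by simp⟩
  smul_mem' := fun c φ hφ => by
    refine ⟨contDiff_const.smul hφ.1, hφ.2.1.smul_left (f := fun _ => c), ?_⟩
    exact (closure_mono (Function.support_const_smul_subset c φ)).trans hφ.2.2

variable {D : Set (EuclideanSpace ℝ (Fin d))}

theorem test_contDiff_one (φ : testFunctions D) : ContDiff ℝ 1 φ.1 :=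
  φ.2.1.of_le (by norm_cast)

theorem test_continuous (φ : testFunctions D) : Continuous φ.1 := φ.2.1.continuous

theorem test_hasCompactSupport (φ : testFunctions D) : HasCompactSupport φ.1 := φ.2.2.1

theorem test_eq_zero (φ : testFunctions D) {z : EuclideanSpace ℝ (Fin d)} (hz : z ∉ D) :
    φ.1 z = 0 :=
  image_eq_zero_of_notMem_tsupport fun h => hz (φ.2.2.2 h)

theorem test_gradient_eq_zero (φ : testFunctions D) {z : EuclideanSpace ℝ (Fin d)}
    (hz : z ∉ D) : gradient φ.1 z = 0 := by
  rw [← norm_eq_zero, norm_gradient, norm_eq_zero]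
  exact image_eq_zero_of_notMem_tsupport fun h => hz (φ.2.2.2 (tsupport_fderiv_subset ℝ h))

theorem test_memLp (φ : testFunctions D) (μ : Measure (EuclideanSpace ℝ (Fin d)))
    [IsFiniteMeasureOnCompacts μ] : MemLp φ.1 2 μ :=
  (test_continuous φ).memLp_of_hasCompactSupport (test_hasCompactSupport φ)

theorem test_memLp_gradient (φ : testFunctions D)
    (μ : Measure (EuclideanSpace ℝ (Fin d))) [IsFiniteMeasureOnCompacts μ] :
    MemLp (gradient φ.1) 2 μ :=
  (continuous_gradient (test_contDiff_one φ)).memLp_of_hasCompactSupport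
    (hasCompactSupport_gradient (test_hasCompactSupport φ))

theorem test_gradient_add (φ ψ : testFunctions D) :
    gradient (φ.1 + ψ.1) = gradient φ.1 + gradient ψ.1 := by
  ext1 z
  have h := fderiv_add ((test_contDiff_one φ).differentiable one_ne_zero z)
    ((test_contDiff_one ψ).differentiable one_ne_zero z)
  simp only [gradient, h, map_add, Pi.add_apply]

theorem test_gradient_smul (c : ℝ) (φ : testFunctions D) :
    gradient (c • φ.1) = c • gradient φ.1 := by
  ext1 z
  have h := fderiv_const_smul ((test_contDiff_one φ).differentiable one_ne_zero z) c
  simp only [gradient, h, Pi.smul_apply]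
  simp

/-- The pair `(φ, ∇φ)` of a test function. -/
noncomputable def testPair (D : Set (EuclideanSpace ℝ (Fin d))) : testFunctions D →ₗ[ℝ] L2Pair D where
  toFun φ := WithLp.toLp 2 ((test_memLp φ (volume.restrict D)).toLp φ.1,
    (test_memLp_gradient φ (volume.restrict D)).toLp (gradient φ.1))
  map_add' φ ψ := by
    rw [← WithLp.toLp_add, Prod.mk_add_mk, ← MemLp.toLp_add, ← MemLp.toLp_add]
    congr 2
    exact MemLp.toLp_congr _ _ (by rw [← test_gradient_add]; rfl)
  map_smul' c φ := by
    rw [RingHom.id_apply, ← WithLp.toLp_smul, Prod.smul_mk, ← MemLp.toLp_const_smul,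
      ← MemLp.toLp_const_smul]
    congr 2
    exact MemLp.toLp_congr _ _ (by rw [← test_gradient_smul]; rfl)

theorem H10_eq_closure (D : Set (EuclideanSpace ℝ (Fin d))) :
    H10 D = (LinearMap.range (testPair D)).topologicalClosure := by
  refine congrArg Submodule.topologicalClosure (le_antisymm (Submodule.span_le.2 ?_) ?_)
  · rintro p ⟨φ, h1, h2, h3, h4, h5⟩
    let φ' : testFunctions D := ⟨φ, h1, h2, h3⟩
    have e1 : (test_memLp φ' (volume.restrict D)).toLp φ = p.fst :=
      Lp.ext ((MemLp.coeFn_toLp _).trans h4.symm)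
    have e2 : (test_memLp_gradient φ' (volume.restrict D)).toLp (gradient φ) = p.snd :=
      Lp.ext ((MemLp.coeFn_toLp _).trans h5.symm)
    exact ⟨φ', WithLp.ofLp_injective 2 (Prod.ext e1 e2)⟩
  · rintro _ ⟨φ, rfl⟩
    exact Submodule.subset_span ⟨φ.1, φ.2.1, φ.2.2.1, φ.2.2.2,
      MemLp.coeFn_toLp (test_memLp φ (volume.restrict D)),
      MemLp.coeFn_toLp (test_memLp_gradient φ (volume.restrict D))⟩

/-- A test function as an element of `H¹₀(D)`. -/
noncomputable def testToH10 (D : Set (EuclideanSpace ℝ (Fin d))) : testFunctions D →ₗ[ℝ] H10 D :=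
  (testPair D).codRestrict (H10 D) fun φ => by
    rw [H10_eq_closure]
    exact Submodule.le_topologicalClosure _ ⟨φ, rfl⟩

theorem denseRange_testToH10 (D : Set (EuclideanSpace ℝ (Fin d))) : DenseRange (testToH10 D) := by
  intro u
  rw [closure_subtype, ← Set.range_comp]
  have h : u.1 ∈ (LinearMap.range (testPair D)).topologicalClosure := by
    rw [← H10_eq_closure]
    exact u.2
  exact h

/-- The embedding of `H¹₀(D)` into `L²(D)`. -/
noncomputable def h10ToL2 (D : Set (EuclideanSpace ℝ (Fin d))) :
    H10 D →L[ℝ] Lp ℝ 2 (volume.restrict D) :=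
  WithLp.fstL 2 ℝ _ _ ∘L (H10 D).subtypeL

/-- The weak gradient on `H¹₀(D)`. -/
noncomputable def h10Grad (D : Set (EuclideanSpace ℝ (Fin d))) :
    H10 D →L[ℝ] Lp (EuclideanSpace ℝ (Fin d)) 2 (volume.restrict D) :=
  WithLp.sndL 2 ℝ _ _ ∘L (H10 D).subtypeL

theorem h10_norm_sq (u : H10 D) : ‖u‖ ^ 2 = ‖h10ToL2 D u‖ ^ 2 + ‖h10Grad D u‖ ^ 2 :=
  WithLp.prod_norm_sq_eq_of_L2 u.1

theorem h10ToL2_testToH10_ae (φ : testFunctions D) :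
    h10ToL2 D (testToH10 D φ) =ᵐ[volume.restrict D] φ.1 :=
  MemLp.coeFn_toLp (test_memLp φ (volume.restrict D))

theorem h10Grad_testToH10_ae (φ : testFunctions D) :
    h10Grad D (testToH10 D φ) =ᵐ[volume.restrict D] gradient φ.1 :=
  MemLp.coeFn_toLp (test_memLp_gradient φ (volume.restrict D))

theorem L2_norm_sq {X : Type*} [MeasurableSpace X] {μ : Measure X} {F : Type*}
    [NormedAddCommGroup F] [InnerProductSpace ℝ F] (f : Lp F 2 μ) :
    ‖f‖ ^ 2 = ∫ x, ‖f x‖ ^ 2 ∂μ := by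
  rw [← real_inner_self_eq_norm_sq, L2.inner_def]
  simp

theorem norm_h10ToL2_testToH10_sq (φ : testFunctions D) :
    ‖h10ToL2 D (testToH10 D φ)‖ ^ 2 = ∫ z, φ.1 z ^ 2 := by
  rw [L2_norm_sq, ← setIntegral_eq_integral_of_forall_compl_eq_zero (s := D)
    (f := fun z => φ.1 z ^ 2) fun z hz => by rw [test_eq_zero φ hz]; simp]
  refine integral_congr_ae ?_
  filter_upwards [h10ToL2_testToH10_ae φ] with z hz
  rw [hz, Real.norm_eq_abs, sq_abs]

theorem norm_h10Grad_testToH10_sq (φ : testFunctions D) :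
    ‖h10Grad D (testToH10 D φ)‖ ^ 2 = ∫ z, ‖gradient φ.1 z‖ ^ 2 := by
  rw [L2_norm_sq, ← setIntegral_eq_integral_of_forall_compl_eq_zero (s := D)
    (f := fun z => ‖gradient φ.1 z‖ ^ 2) fun z hz => by rw [test_gradient_eq_zero φ hz]; simp]
  refine integral_congr_ae ?_
  filter_upwards [h10Grad_testToH10_ae φ] with z hz
  rw [hz]

/-! ### The form of the Schrödinger operator -/

/-- The form `∫_D ∇u · ∇v + ∫_D W u v` on `H¹₀(D)`. The potential is an element of `L^∞(D)`, so that
multiplication by it is a bounded operator on `L²(D)` by Hölder's inequality. -/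
noncomputable def dirichletForm (D : Set (EuclideanSpace ℝ (Fin d)))
    (W : Lp ℝ ⊤ (volume.restrict D)) : H10 D →L[ℝ] H10 D →L[ℝ] ℝ :=
  (innerSL ℝ).bilinearComp (h10Grad D) (h10Grad D) +
    (innerSL ℝ).bilinearComp (h10ToL2 D)
      ((ContinuousLinearMap.mul ℝ ℝ).holderL (volume.restrict D) ⊤ 2 2 W ∘L h10ToL2 D)

theorem dirichletForm_apply {W : Lp ℝ ⊤ (volume.restrict D)} {U : EuclideanSpace ℝ (Fin d) → ℝ}
    (hW : W =ᵐ[volume.restrict D] U) (u v : H10 D) :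
    dirichletForm D W u v = (∫ x in D, inner ℝ (u.1.snd x) (v.1.snd x)) +
      ∫ x in D, U x * (u.1.fst x * v.1.fst x) := by
  have h : dirichletForm D W u v = inner ℝ (h10Grad D u) (h10Grad D v) +
    inner ℝ (h10ToL2 D u) ((ContinuousLinearMap.mul ℝ ℝ).holder 2 W (h10ToL2 D v)) := rfl
  rw [h, L2.inner_def, L2.inner_def]
  congr 1
  refine integral_congr_ae ?_
  filter_upwards [hW, (ContinuousLinearMap.mul ℝ ℝ).coeFn_holder (r := 2) W (h10ToL2 D v)]
    with z h1 h2
  rw [h2]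
  simp only [ContinuousLinearMap.mul_apply', RCLike.inner_apply, conj_trivial, h1]
  show U z * v.1.fst z * u.1.fst z = _
  ring

theorem dirichletForm_symm (W : Lp ℝ ⊤ (volume.restrict D)) (u v : H10 D) :
    dirichletForm D W u v = dirichletForm D W v u := by
  rw [dirichletForm_apply (Filter.EventuallyEq.refl _ _),
    dirichletForm_apply (Filter.EventuallyEq.refl _ _)]
  congr 1
  · exact integral_congr_ae (ae_of_all _ fun x => real_inner_comm _ _)
  · refine integral_congr_ae (ae_of_all _ fun x => ?_)
    show W x * (u.1.fst x * v.1.fst x) = W x * (v.1.fst x * u.1.fst x)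
    ring

theorem abs_setIntegral_mul_sq_le {U : EuclideanSpace ℝ (Fin d) → ℝ} (hD : MeasurableSet D)
    {C : ℝ} (hC : ∀ x ∈ D, |U x| ≤ C) (f : Lp ℝ 2 (volume.restrict D)) :
    |∫ x in D, U x * (f x * f x)| ≤ C * ‖f‖ ^ 2 := by
  rw [L2_norm_sq, ← integral_const_mul, ← Real.norm_eq_abs]
  refine norm_integral_le_of_norm_le (((Lp.memLp f).integrable_norm_pow (by norm_num)).const_mul C) ?_
  filter_upwards [ae_restrict_mem hD] with x hx
  rw [norm_mul, norm_mul, Real.norm_eq_abs (U x), sq]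
  exact mul_le_mul_of_nonneg_right (hC x hx) (by positivity)

/-- Gårding's inequality. -/
theorem dirichletForm_coercive {W : Lp ℝ ⊤ (volume.restrict D)}
    {U : EuclideanSpace ℝ (Fin d) → ℝ} (hW : W =ᵐ[volume.restrict D] U) (hD : MeasurableSet D)
    {C : ℝ} (hC : ∀ x ∈ D, |U x| ≤ C) (u : H10 D) :
    ‖u‖ ^ 2 ≤ dirichletForm D W u u + (1 + C) * ‖h10ToL2 D u‖ ^ 2 := by
  have h1 := abs_setIntegral_mul_sq_le hD hC (h10ToL2 D u)
  have h2 : ∫ x in D, inner ℝ (u.1.snd x) (u.1.snd x) = ‖h10Grad D u‖ ^ 2 := by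
    rw [L2_norm_sq]
    simp only [real_inner_self_eq_norm_sq]
    rfl
  rw [h10_norm_sq, dirichletForm_apply hW, h2]
  have h3 := (abs_le.1 h1).1
  have h4 : ∫ x in D, U x * (h10ToL2 D u x * h10ToL2 D u x) =
    ∫ x in D, U x * (u.1.fst x * u.1.fst x) := rfl
  rw [h4] at h3
  linarith

theorem dirichletForm_testToH10 {W : Lp ℝ ⊤ (volume.restrict D)}
    {U : EuclideanSpace ℝ (Fin d) → ℝ} (hW : W =ᵐ[volume.restrict D] U) (φ : testFunctions D) :
    dirichletForm D W (testToH10 D φ) (testToH10 D φ) =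
      (∫ z, ‖gradient φ.1 z‖ ^ 2) + ∫ z, U z * φ.1 z ^ 2 := by
  rw [dirichletForm_apply hW, ← norm_h10Grad_testToH10_sq, L2_norm_sq,
    ← setIntegral_eq_integral_of_forall_compl_eq_zero (s := D) (f := fun z => U z * φ.1 z ^ 2)
    fun z hz => by rw [(test_eq_zero φ) hz]; simp]
  congr 1
  · simp only [real_inner_self_eq_norm_sq]
    rfl
  · refine integral_congr_ae ?_
    filter_upwards [h10ToL2_testToH10_ae φ] with z hz
    have hz' : (testToH10 D φ).1.fst z = φ.1 z := hz
    rw [hz', sq]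

theorem isFormEigenvector_iff {W : Lp ℝ ⊤ (volume.restrict D)}
    {U : EuclideanSpace ℝ (Fin d) → ℝ} (hW : W =ᵐ[volume.restrict D] U) (m : ℝ) (u : H10 D) :
    IsFormEigenvector (dirichletForm D W) (h10ToL2 D) m u ↔ IsDirichletEigenvector D U m u := by
  refine forall_congr' fun v => ?_
  rw [dirichletForm_apply hW, L2.inner_def]
  have h : ∫ x in D, inner ℝ (h10ToL2 D u x) (h10ToL2 D v x) =
      ∫ x in D, u.1.fst x * v.1.fst x := by
    refine integral_congr_ae (ae_of_all _ fun x => ?_)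
    simp only [RCLike.inner_apply, conj_trivial]
    exact mul_comm _ _
  rw [h]

/-! ### The compact embedding into `L²` -/

theorem finite_cellIdx_image {B : Set (EuclideanSpace ℝ (Fin d))} (hB : Bornology.IsBounded B)
    {ε : ℝ} (hε : 0 < ε) : (cellIdx ε '' B).Finite := by
  obtain ⟨R, hR⟩ := hB.exists_norm_le
  refine (Set.finite_Icc (fun _ : Fin d => ⌊-R / ε⌋) (fun _ => ⌊R / ε⌋)).subset ?_
  rintro _ ⟨z, hz, rfl⟩
  have h : ∀ i, |z i| ≤ R := fun i => (PiLp.norm_apply_le z i).trans (hR z hz)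
  exact ⟨fun i => Int.floor_le_floor (by gcongr; exact (abs_le.1 (h i)).1),
    fun i => Int.floor_le_floor (by gcongr; exact (abs_le.1 (h i)).2)⟩

theorem exists_of_cellAvg_ne_zero {ε : ℝ} {φ : EuclideanSpace ℝ (Fin d) → ℝ} {x : Fin d → ℤ}
    (h : cellAvg ε φ x ≠ 0) : ∃ z, cellIdx ε z = x ∧ φ z ≠ 0 := by
  by_contra! hcon
  refine h ?_
  rw [cellAvg, setIntegral_congr_fun (g := fun _ => 0) (measurableSet_cell ε x)
    (fun z hz => hcon z hz)]
  simp

theorem finite_support_cellAvg {ε : ℝ} (hε : 0 < ε) {φ : EuclideanSpace ℝ (Fin d) → ℝ}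
    (hc : HasCompactSupport φ) : (cellAvg ε φ).support.Finite := by
  refine (finite_cellIdx_image hc.isBounded hε).subset fun x hx => ?_
  obtain ⟨z, hz, hz0⟩ := exists_of_cellAvg_ne_zero hx
  exact ⟨z, subset_tsupport _ hz0, hz⟩

theorem memLp_step {F : (Fin d → ℤ) → ℝ} (hF : F.support.Finite) {ε : ℝ} (hε : 0 < ε) :
    MemLp (fun z : EuclideanSpace ℝ (Fin d) => F (cellIdx ε z)) 2 := by
  simp only [step_eq_sum hF]
  refine memLp_finsetSum _ fun x _ => memLp_indicator_const 2 (measurableSet_cell ε x) _ (Or.inr ?_)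
  rw [volume_cell hε]
  exact ENNReal.ofReal_ne_top

/-- The indicator function of a cell in `L²(D)`. -/
noncomputable def cellIndicator (D : Set (EuclideanSpace ℝ (Fin d))) {η : ℝ} (hη : 0 < η)
    (x : Fin d → ℤ) : Lp ℝ 2 (volume.restrict D) :=
  indicatorConstLp 2 (measurableSet_cell η x)
    ((Measure.restrict_apply_le D _).trans_lt
      (by rw [volume_cell hη]; exact ENNReal.ofReal_lt_top)).ne (1 : ℝ)

/-- The averaging operator over the cells of size `η` with index in `S`, on `L²(D)`: functions are
extended by zero outside `D`, averaged, and restricted to `D` again. -/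
noncomputable def avgOperator (D : Set (EuclideanSpace ℝ (Fin d))) (S : Finset (Fin d → ℤ)) {η : ℝ}
    (hη : 0 < η) : Lp ℝ 2 (volume.restrict D) →L[ℝ] Lp ℝ 2 (volume.restrict D) :=
  ∑ x ∈ S, (ContinuousLinearMap.toSpanSingleton ℝ ((η ^ d)⁻¹ • cellIndicator D hη x)) ∘L
    innerSL ℝ (cellIndicator D hη x)

theorem isCompactOperator_avgOperator (S : Finset (Fin d → ℤ)) {η : ℝ} (hη : 0 < η) :
    IsCompactOperator (avgOperator D S hη) := by
  unfold avgOperator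
  have h : ∀ T : Finset (Fin d → ℤ), ∀ A : (Fin d → ℤ) →
      (Lp ℝ 2 (volume.restrict D) →L[ℝ] Lp ℝ 2 (volume.restrict D)),
      (∀ x, IsCompactOperator (A x)) → IsCompactOperator (∑ x ∈ T, A x : _ →L[ℝ] _) := by
    classical
    intro T A hA
    induction T using Finset.induction_on with
    | empty => exact isCompactOperator_zero
    | insert x T hx ih =>
      rw [Finset.sum_insert hx]
      exact (hA x).add ih
  refine h S _ fun x => ?_
  have hc : IsCompactOperator
      (ContinuousLinearMap.toSpanSingleton ℝ ((η ^ d)⁻¹ • cellIndicator D hη x)) :=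
    isCompactOperator_of_locallyCompactSpace_rng _
  exact hc.comp_clm (innerSL ℝ (cellIndicator D hη x))

/-- With all cells that meet `D`, the averaging operator takes cell averages. -/
theorem avgOperator_testToH10_ae (hD : Bornology.IsBounded D) (hDm : MeasurableSet D) {η : ℝ}
    (hη : 0 < η) (φ : testFunctions D) :
    avgOperator D (finite_cellIdx_image hD hη).toFinset hη (h10ToL2 D (testToH10 D φ))
      =ᵐ[volume.restrict D] fun z => cellAvg η φ.1 (cellIdx η z) := by
  set S := (finite_cellIdx_image hD hη).toFinset with hS
  have h1 : avgOperator D S hη (h10ToL2 D (testToH10 D φ)) =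
      ∑ x ∈ S, cellAvg η φ.1 x • cellIndicator D hη x := by
    rw [avgOperator, sum_apply]
    refine Finset.sum_congr rfl fun x _ => ?_
    have h2 : inner ℝ (cellIndicator D hη x) (h10ToL2 D (testToH10 D φ)) =
        ∫ z in cell η x, φ.1 z := by
      rw [cellIndicator, L2.inner_indicatorConstLp_one, Measure.restrict_restrict
        (measurableSet_cell η x), Set.inter_comm]
      have h3 : ∫ z in D ∩ cell η x, h10ToL2 D (testToH10 D φ) z =
          ∫ z in D ∩ cell η x, φ.1 z := by
        refine integral_congr_ae ?_
        exact ae_mono (Measure.restrict_mono Set.inter_subset_left le_rfl) (h10ToL2_testToH10_ae φ)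
      rw [h3]
      exact (setIntegral_eq_of_subset_of_forall_sdiff_eq_zero (measurableSet_cell η x)
        Set.inter_subset_right fun z hz => test_eq_zero φ fun hzD => hz.2 ⟨hzD, hz.1⟩).symm
    rw [ContinuousLinearMap.comp_apply, innerSL_apply_apply, h2,
      ContinuousLinearMap.toSpanSingleton_apply, smul_smul, cellAvg, mul_comm]
  rw [h1]
  have h2 : ∀ᵐ z ∂(volume.restrict D), ∀ x ∈ S, (cellIndicator D hη x) z =
      (cell η x).indicator (fun _ => (1 : ℝ)) z := by
    rw [Filter.eventually_all_finset]
    exact fun x _ => indicatorConstLp_coeFn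
  have h3 : ∀ᵐ z ∂(volume.restrict D), ∀ x ∈ S, (cellAvg η φ.1 x • cellIndicator D hη x :
      Lp ℝ 2 (volume.restrict D)) z = cellAvg η φ.1 x • cellIndicator D hη x z := by
    rw [Filter.eventually_all_finset]
    exact fun x _ => Lp.coeFn_smul _ _
  filter_upwards [Lp.coeFn_finsetSum S fun x => cellAvg η φ.1 x • cellIndicator D hη x, h2, h3,
    ae_restrict_mem hDm] with z hz1 hz2 hz3 hzD
  rw [hz1, Finset.sum_apply, Finset.sum_congr rfl hz3,
    Finset.sum_congr rfl fun x hx => by rw [hz2 x hx]]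
  have hmem : cellIdx η z ∈ S := by
    rw [hS, Set.Finite.mem_toFinset]
    exact ⟨z, hzD, rfl⟩
  rw [Finset.sum_eq_single_of_mem _ hmem]
  · rw [Set.indicator_of_mem (s := cell η (cellIdx η z)) rfl, smul_eq_mul, mul_one]
  · intro x _ hx
    rw [Set.indicator_of_notMem (s := cell η x) fun h => hx (mem_cell.1 h).symm, smul_zero]

theorem integrable_sub_cellAvg_sq (φ : testFunctions D) {η : ℝ} (hη : 0 < η) :
    Integrable fun z => (φ.1 z - cellAvg η φ.1 (cellIdx η z)) ^ 2 :=
  ((test_memLp φ volume).sub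
    (memLp_step (finite_support_cellAvg hη (test_hasCompactSupport φ)) hη)).integrable_sq

theorem norm_sub_avgOperator_le (hD : Bornology.IsBounded D) (hDm : MeasurableSet D) {η : ℝ}
    (hη : 0 < η) (u : H10 D) :
    ‖h10ToL2 D u - avgOperator D (finite_cellIdx_image hD hη).toFinset hη (h10ToL2 D u)‖ ≤
      √(2 ^ d * d) * η * ‖u‖ := by
  refine (denseRange_testToH10 D).induction_on u (isClosed_le (by fun_prop) (by fun_prop)) ?_
  intro φ
  refine abs_le_of_sq_le_sq' ?_ (by positivity) |>.2
  rw [mul_pow, mul_pow, Real.sq_sqrt (by positivity), h10_norm_sq, norm_h10Grad_testToH10_sq,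
    L2_norm_sq]
  have h1 : ∫ z in D, ‖(h10ToL2 D (testToH10 D φ) -
      avgOperator D (finite_cellIdx_image hD hη).toFinset hη (h10ToL2 D (testToH10 D φ)) :
      Lp ℝ 2 (volume.restrict D)) z‖ ^ 2 =
      ∫ z in D, (φ.1 z - cellAvg η φ.1 (cellIdx η z)) ^ 2 := by
    refine integral_congr_ae ?_
    filter_upwards [Lp.coeFn_sub (h10ToL2 D (testToH10 D φ)) (avgOperator D
      (finite_cellIdx_image hD hη).toFinset hη (h10ToL2 D (testToH10 D φ))),
      h10ToL2_testToH10_ae φ, avgOperator_testToH10_ae hD hDm hη φ] with z hz1 hz2 hz3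
    rw [hz1, Pi.sub_apply, hz2, hz3, Real.norm_eq_abs, sq_abs]
  rw [h1]
  refine (setIntegral_le_integral (integrable_sub_cellAvg_sq φ hη)
    (ae_of_all _ fun _ => sq_nonneg _)).trans ?_
  refine (integral_sub_cellAvg_sq_le (test_contDiff_one φ) (test_hasCompactSupport φ) hη).trans ?_
  refine mul_le_mul_of_nonneg_left ?_ (by positivity)
  exact le_add_of_nonneg_left (sq_nonneg _)

/-- Rellich's theorem for `H¹₀(D)`: the embedding is the norm limit of its compositions with the
finite-rank averaging operators. -/
theorem isCompactOperator_h10ToL2 (hD : Bornology.IsBounded D) (hDm : MeasurableSet D) :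
    IsCompactOperator (h10ToL2 D) := by
  have hpos : ∀ n : ℕ, (0 : ℝ) < 1 / (n + 1) := fun n => Nat.one_div_pos_of_nat
  let A : ℕ → (H10 D →L[ℝ] Lp ℝ 2 (volume.restrict D)) := fun n =>
    avgOperator D (finite_cellIdx_image hD (hpos n)).toFinset (hpos n) ∘L h10ToL2 D
  have hlim : Tendsto A atTop (𝓝 (h10ToL2 D)) := by
    refine (tendsto_iff_norm_sub_tendsto_zero
      (E := H10 D →L[ℝ] Lp ℝ 2 (volume.restrict D))).2 ?_
    refine squeeze_zero (fun n => norm_nonneg (A n - h10ToL2 D)) (fun n => ?_)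
      (g := fun n : ℕ => √(2 ^ d * d) * (1 / ((n : ℝ) + 1))) ?_
    · refine ContinuousLinearMap.opNorm_le_bound _ (by positivity) fun u => ?_
      rw [← norm_neg]
      have := norm_sub_avgOperator_le hD hDm (hpos n) u
      simpa [A] using this
    · simpa using tendsto_one_div_add_atTop_nhds_zero_nat.const_mul (√(2 ^ d * d))
  refine isCompactOperator_of_tendsto hlim (Eventually.of_forall fun n => ?_)
  exact (isCompactOperator_avgOperator _ (hpos n)).comp_clm _

end Sobolev

/-! ### Potentials as quadratic forms -/

section Potential

variable {d : ℕ}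

/-- The potential `F` on `Λ`, extended by zero. -/
noncomputable def siteField (Λ : Finset (Fin d → ℤ)) (F : (Fin d → ℤ) → ℝ) (x : Fin d → ℤ) : ℝ :=
  (Λ : Set (Fin d → ℤ)).indicator F x

theorem siteField_of_mem {Λ : Finset (Fin d → ℤ)} {x : Fin d → ℤ} (hx : x ∈ Λ)
    (F : (Fin d → ℤ) → ℝ) : siteField Λ F x = F x :=
  Set.indicator_of_mem (by exact_mod_cast hx) F

theorem siteField_of_notMem {Λ : Finset (Fin d → ℤ)} {x : Fin d → ℤ} (hx : x ∉ Λ)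
    (F : (Fin d → ℤ) → ℝ) : siteField Λ F x = 0 :=
  Set.indicator_of_notMem (by exact_mod_cast hx) F

theorem abs_siteField_le {Λ : Finset (Fin d → ℤ)} {F : (Fin d → ℤ) → ℝ} {C : ℝ} (hC0 : 0 ≤ C)
    (hC : ∀ x ∈ Λ, |F x| ≤ C) (x : Fin d → ℤ) : |siteField Λ F x| ≤ C := by
  by_cases hx : x ∈ Λ
  · rw [siteField_of_mem hx]
    exact hC x hx
  · rw [siteField_of_notMem hx, abs_zero]
    exact hC0

theorem aestronglyMeasurable_comp_cellIdx (F : (Fin d → ℤ) → ℝ) (ε : ℝ)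
    (μ : Measure (EuclideanSpace ℝ (Fin d))) :
    AEStronglyMeasurable (fun z => F (cellIdx ε z)) μ :=
  ((measurable_of_countable F).comp (measurable_cellIdx ε)).aestronglyMeasurable

theorem integral_siteField_mul (Λ : Finset (Fin d → ℤ)) (F : (Fin d → ℤ) → ℝ) (ε : ℝ)
    {h : EuclideanSpace ℝ (Fin d) → ℝ} (hh : Integrable h) :
    ∫ z, siteField Λ F (cellIdx ε z) * h z = ∑ x ∈ Λ, F x * ∫ z in cell ε x, h z := by
  have h1 : ∀ z, siteField Λ F (cellIdx ε z) * h z =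
      ∑ x ∈ Λ, (cell ε x).indicator (fun z => F x * h z) z := by
    intro z
    by_cases hz : cellIdx ε z ∈ Λ
    · rw [siteField_of_mem hz, Finset.sum_eq_single_of_mem _ hz,
        Set.indicator_of_mem (s := cell ε (cellIdx ε z)) rfl]
      intro x _ hx
      exact Set.indicator_of_notMem (s := cell ε x) (fun h => hx (mem_cell.1 h).symm) _
    · rw [siteField_of_notMem hz, zero_mul, Finset.sum_eq_zero]
      intro x hx
      exact Set.indicator_of_notMem (s := cell ε x) (fun h => hz (mem_cell.1 h ▸ hx)) _
  simp only [h1]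
  rw [integral_finsetSum]
  · refine Finset.sum_congr rfl fun x _ => ?_
    rw [integral_indicator (measurableSet_cell ε x), integral_const_mul]
  · intro x _
    exact (hh.const_mul _).indicator (measurableSet_cell ε x)

/-- Stability of `∫ W X²` under `L²`-perturbations of `X`, from
`|X² - Y²| ≤ (1 + τ⁻¹) (X - Y)² + τ Y²`. -/
theorem abs_integral_mul_sq_sub_le {X : Type*} [MeasurableSpace X] {μ : Measure X} {W f g : X → ℝ}
    (hW : AEStronglyMeasurable W μ) {C : ℝ} (hC : ∀ z, |W z| ≤ C) (hf : MemLp f 2 μ)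
    (hg : MemLp g 2 μ) {τ : ℝ} (hτ : 0 < τ) :
    |(∫ z, W z * f z ^ 2 ∂μ) - ∫ z, W z * g z ^ 2 ∂μ| ≤
      C * ((1 + τ⁻¹) * (∫ z, (f z - g z) ^ 2 ∂μ) + τ * ∫ z, g z ^ 2 ∂μ) := by
  have hWi : ∀ {h : X → ℝ}, Integrable h μ → Integrable (fun z => W z * h z) μ := fun hh =>
    hh.bdd_mul hW (ae_of_all _ hC)
  have i1 := hf.integrable_sq
  have i2 := hg.integrable_sq
  have i3 : Integrable (fun z => (f z - g z) ^ 2) μ := (hf.sub hg).integrable_sq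
  have i4 : Integrable (fun z => (1 + τ⁻¹) * (f z - g z) ^ 2) μ := i3.const_mul _
  have i5 : Integrable (fun z => τ * g z ^ 2) μ := i2.const_mul _
  rw [← integral_sub (hWi i1) (hWi i2), ← integral_const_mul, ← integral_const_mul,
    ← integral_add i4 i5, ← integral_const_mul, ← Real.norm_eq_abs]
  refine norm_integral_le_of_norm_le ((i4.add i5).const_mul C) (ae_of_all _ fun z => ?_)
  rw [← mul_sub, norm_mul, Real.norm_eq_abs, Real.norm_eq_abs]
  have hC0 : 0 ≤ C := (abs_nonneg _).trans (hC z)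
  refine mul_le_mul (hC z) ?_ (abs_nonneg _) hC0
  set s := f z - g z with hs
  have e : f z ^ 2 - g z ^ 2 = s ^ 2 + 2 * s * g z := by rw [hs]; ring
  have h2 : 2 * |s * g z| ≤ τ⁻¹ * s ^ 2 + τ * g z ^ 2 := by
    have h3 : 0 ≤ τ⁻¹ * (|s| - τ * |g z|) ^ 2 := by positivity
    have h4 : τ⁻¹ * (|s| - τ * |g z|) ^ 2 =
        τ⁻¹ * |s| ^ 2 + τ * |g z| ^ 2 - 2 * (|s| * |g z|) := by
      field_simp
      ring
    rw [sq_abs, sq_abs, ← abs_mul] at h4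
    linarith
  rw [e]
  calc |s ^ 2 + 2 * s * g z| ≤ |s ^ 2| + |2 * s * g z| := abs_add_le _ _
    _ = s ^ 2 + 2 * |s * g z| := by
        rw [abs_of_nonneg (sq_nonneg s), mul_assoc, abs_mul 2, abs_two]
    _ ≤ (1 + τ⁻¹) * s ^ 2 + τ * g z ^ 2 := by linarith

variable {D : Set (EuclideanSpace ℝ (Fin d))}

theorem integral_indicator_mul_test_sq (U : EuclideanSpace ℝ (Fin d) → ℝ) (φ : testFunctions D) :
    ∫ z, D.indicator U z * φ.1 z ^ 2 = ∫ z, U z * φ.1 z ^ 2 := by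
  refine integral_congr_ae (ae_of_all _ fun z => ?_)
  by_cases hz : z ∈ D
  · simp only [Set.indicator_of_mem hz]
  · simp only [test_eq_zero φ hz]
    simp

/-- The distance to `Dᶜ` is a genuine one: `Metric.infDist` to the empty set would be `0`. This
requires positive dimension. -/
theorem compl_nonempty_of_isBounded (hd : 1 ≤ d) (hD : Bornology.IsBounded D) : Dᶜ.Nonempty := by
  rw [Set.nonempty_compl]
  rintro rfl
  have : Nonempty (Fin d) := ⟨⟨0, hd⟩⟩
  exact NormedSpace.unbounded_univ ℝ (EuclideanSpace ℝ (Fin d)) hD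

/-- Lattice points close to a compact subset of `D` belong to `D_ε` for small `ε`. -/
theorem exists_forall_mem_latticeDomain (hd : 1 ≤ d) (hDo : IsOpen D) (hDb : Bornology.IsBounded D)
    {K : Set (EuclideanSpace ℝ (Fin d))} (hK : IsCompact K) (hKD : K ⊆ D) :
    ∃ r > 0, ∀ ε, 0 < ε → ε < r → ∀ z ∈ K, ∀ x : Fin d → ℤ, (∀ i, |z i - ε * x i| ≤ ε) →
      x ∈ latticeDomain D ε := by
  rcases K.eq_empty_or_nonempty with rfl | hKne
  · exact ⟨1, one_pos, fun _ _ _ z hz => absurd hz (Set.notMem_empty z)⟩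
  set A : Set (Fin d → ℝ) := WithLp.ofLp '' Dᶜ with hA
  have hAc : IsClosed A :=
    (PiLp.homeomorph 2 (fun _ : Fin d => ℝ)).isClosedMap _ hDo.isClosed_compl
  have hAne : A.Nonempty := (compl_nonempty_of_isBounded hd hDb).image _
  have hcont : Continuous fun z : EuclideanSpace ℝ (Fin d) => Metric.infDist (WithLp.ofLp z) A :=
    (Metric.continuous_infDist_pt A).comp (PiLp.continuous_ofLp 2 _)
  obtain ⟨z₀, hz₀, hmin⟩ := hK.exists_isMinOn hKne hcont.continuousOn
  have hpos : 0 < Metric.infDist (WithLp.ofLp z₀) A := by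
    rw [← hAc.notMem_iff_infDist_pos hAne]
    rintro ⟨y, hy, hyz⟩
    exact hy (WithLp.ofLp_injective 2 hyz ▸ hKD hz₀)
  refine ⟨Metric.infDist (WithLp.ofLp z₀) A / 2, by positivity, fun ε hε hεr z hz x hx => ?_⟩
  rw [mem_latticeDomain hDb hε]
  have h1 : Metric.infDist (WithLp.ofLp z₀) A ≤ Metric.infDist (WithLp.ofLp z) A := hmin hz
  have h2 : Metric.infDist (WithLp.ofLp z) A ≤
      Metric.infDist (WithLp.ofLp (latticePoint ε x)) A +
        dist (WithLp.ofLp z) (WithLp.ofLp (latticePoint ε x)) :=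
    Metric.infDist_le_infDist_add_dist
  have h3 : dist (WithLp.ofLp z) (WithLp.ofLp (latticePoint ε x)) ≤ ε := by
    rw [dist_pi_le_iff hε.le]
    intro i
    rw [Real.dist_eq]
    exact hx i
  linarith

theorem abs_sub_cellIdx_le {ε : ℝ} (hε : 0 < ε) (z : EuclideanSpace ℝ (Fin d)) (i : Fin d) :
    |z i - ε * (cellIdx ε z i : ℤ)| ≤ ε := by
  have h := (mem_cell_iff hε).1 (show z ∈ cell ε (cellIdx ε z) from rfl) i
  rw [abs_le]
  constructor <;> linarith

theorem tendsto_latticePoint_cellIdx (z : EuclideanSpace ℝ (Fin d)) :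
    Tendsto (fun ε => latticePoint ε (cellIdx ε z)) (𝓝[>] (0 : ℝ)) (𝓝 z) := by
  have h : Tendsto (fun ε : ℝ => fun i => ε * (cellIdx ε z i : ℝ)) (𝓝[>] (0 : ℝ))
      (𝓝 (WithLp.ofLp z)) := by
    rw [tendsto_pi_nhds]
    intro i
    rw [tendsto_iff_norm_sub_tendsto_zero]
    refine squeeze_zero' (Eventually.of_forall fun _ => norm_nonneg _) ?_
      (tendsto_nhdsWithin_of_tendsto_nhds tendsto_id)
    filter_upwards [self_mem_nhdsWithin] with ε hε
    rw [norm_sub_rev]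
    exact abs_sub_cellIdx_le hε z i
  exact ((PiLp.continuous_toLp 2 (fun _ : Fin d => ℝ)).tendsto _).comp h

/-- The mean potential converges, tested against the square of a test function. -/
theorem tendsto_integral_mean_potential (hd : 1 ≤ d) (hDo : IsOpen D)
    (hDb : Bornology.IsBounded D) {U : EuclideanSpace ℝ (Fin d) → ℝ} (hU : ContinuousOn U D)
    {C : ℝ} (hC : ∀ x ∈ D, |U x| ≤ C) (ψ : testFunctions D) :
    Tendsto (fun ε => ∫ z, siteField (latticeDomain D ε) (fun x => U (latticePoint ε x))
      (cellIdx ε z) * ψ.1 z ^ 2) (𝓝[>] (0 : ℝ)) (𝓝 (∫ z, U z * ψ.1 z ^ 2)) := by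
  have hi := (test_memLp ψ volume).integrable_sq
  refine tendsto_integral_filter_of_dominated_convergence (fun z => |C| * ψ.1 z ^ 2)
    (Eventually.of_forall fun ε => (aestronglyMeasurable_comp_cellIdx _ ε _).mul
      hi.aestronglyMeasurable) ?_ (hi.const_mul _) (ae_of_all _ fun z => ?_)
  · filter_upwards [self_mem_nhdsWithin] with ε (hε : 0 < ε)
    refine ae_of_all _ fun z => ?_
    rw [norm_mul, Real.norm_eq_abs, Real.norm_eq_abs, abs_of_nonneg (sq_nonneg (ψ.1 z))]
    refine mul_le_mul_of_nonneg_right (abs_siteField_le (abs_nonneg C) (fun x hx => ?_) _)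
      (sq_nonneg _)
    refine (hC _ ?_).trans (le_abs_self C)
    by_contra hcon
    rw [mem_latticeDomain hDb hε, Metric.infDist_zero_of_mem
      (Set.mem_image_of_mem WithLp.ofLp (show latticePoint ε x ∈ Dᶜ from hcon))] at hx
    exact absurd hx (not_lt.2 hε.le)
  · by_cases hz : z ∈ D
    · obtain ⟨r, hr, hmem⟩ := exists_forall_mem_latticeDomain hd hDo hDb
        (isCompact_singleton (x := z)) (Set.singleton_subset_iff.2 hz)
      refine Tendsto.mul_const _ ?_
      refine (((hU.continuousAt (hDo.mem_nhds hz)).tendsto.comp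
        (tendsto_latticePoint_cellIdx z))).congr' ?_
      filter_upwards [self_mem_nhdsWithin, mem_nhdsWithin_of_mem_nhds (Iio_mem_nhds hr)]
        with ε hε hεr
      rw [siteField_of_mem (hmem ε hε hεr z rfl _ (abs_sub_cellIdx_le hε z))]
      rfl
    · simp only [test_eq_zero ψ hz]
      simp

end Potential

/-! ### Convergence of the random potential -/

section Random

variable {d : ℕ} {D : Set (EuclideanSpace ℝ (Fin d))}

/-- Chebyshev's inequality for the random potential tested against a function of small cell
masses. -/
theorem prob_weighted_sum_le {Ω : Type*} [MeasurableSpace Ω] {P : Measure Ω} [IsProbabilityMeasure P]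
    {Λ : Finset (Fin d → ℤ)} {ξ : (Fin d → ℤ) → Ω → ℝ} (hmeas : ∀ x ∈ Λ, Measurable (ξ x))
    (hind : iIndepFun (fun x : Λ => ξ x) P) {a b : ℝ}
    (hbdd : ∀ x ∈ Λ, ∀ᵐ ω ∂P, a ≤ ξ x ω ∧ ξ x ω ≤ b) {C : ℝ}
    (hvar : ∀ x ∈ Λ, variance (ξ x) P ≤ C) (m : (Fin d → ℤ) → ℝ) {ρ : ℝ} (hρ : 0 < ρ) :
    P {ω | ρ ≤ |∑ x ∈ Λ, ξ x ω * m x - ∑ x ∈ Λ, (∫ ω, ξ x ω ∂P) * m x|} ≤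
      ENNReal.ofReal (C * (∑ x ∈ Λ, m x ^ 2) / ρ ^ 2) := by
  have hL2 : ∀ x ∈ Λ, MemLp (ξ x) 2 P := fun x hx =>
    MemLp.of_bound (hmeas x hx).aestronglyMeasurable (max |a| |b|) (by
      filter_upwards [hbdd x hx] with ω hω
      exact abs_le_max_abs_abs hω.1 hω.2)
  let Y : Λ → Ω → ℝ := fun x ω => m x * ξ x ω
  have hY : ∀ x ∈ (Finset.univ : Finset Λ), MemLp (Y x) 2 P :=
    fun x _ => (hL2 x x.2).const_mul (m x)
  have hpair : ((Finset.univ : Finset Λ) : Set Λ).Pairwise fun i j => IndepFun (Y i) (Y j) P := by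
    intro i _ j _ hij
    exact (hind.indepFun hij).comp (measurable_const_mul (m i)) (measurable_const_mul (m j))
  have hsum : ∀ ω, (∑ x : Λ, Y x) ω = ∑ x ∈ Λ, ξ x ω * m x := by
    intro ω
    rw [Finset.sum_apply, ← Finset.sum_coe_sort Λ fun x => ξ x ω * m x]
    exact Finset.sum_congr rfl fun x _ => mul_comm _ _
  have hmean : ∫ ω, (∑ x : Λ, Y x) ω ∂P = ∑ x ∈ Λ, (∫ ω, ξ x ω ∂P) * m x := by
    simp only [hsum]
    rw [integral_finsetSum _ fun x hx => ((hL2 x hx).integrable (by norm_num)).mul_const _]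
    exact Finset.sum_congr rfl fun x _ => integral_mul_const _ _
  have hV : variance (∑ x : Λ, Y x) P ≤ C * ∑ x ∈ Λ, m x ^ 2 := by
    rw [IndepFun.variance_sum hY hpair, Finset.mul_sum,
      ← Finset.sum_coe_sort Λ fun x => C * m x ^ 2]
    refine Finset.sum_le_sum fun x _ => ?_
    rw [variance_const_mul, mul_comm C]
    exact mul_le_mul_of_nonneg_left (hvar x x.2) (sq_nonneg _)
  have hch := meas_ge_le_variance_div_sq (memLp_finsetSum' Finset.univ hY) hρ
  rw [hmean] at hch
  simp only [hsum] at hch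
  refine hch.trans (ENNReal.ofReal_le_ofReal ?_)
  gcongr

variable {U V : EuclideanSpace ℝ (Fin d) → ℝ} {Ω : ℝ → Type*} [∀ ε, MeasurableSpace (Ω ε)]
  {P : ∀ ε, Measure (Ω ε)} [∀ ε, IsProbabilityMeasure (P ε)] {ξ : ∀ ε, (Fin d → ℤ) → Ω ε → ℝ}
  {a b C C' : ℝ}

/-- Weak law of large numbers for the random potential, tested against the square of a fixed test
function. -/
theorem tendsto_prob_test (hd : 1 ≤ d) (hDo : IsOpen D)
    (hDb : Bornology.IsBounded D) (hU : ContinuousOn U D) (hC : ∀ x ∈ D, |U x| ≤ C)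
    (hC' : ∀ x ∈ D, |V x| ≤ C')
    (hmeas : ∀ ε > 0, ∀ x ∈ latticeDomain D ε, Measurable (ξ ε x))
    (hind : ∀ ε > 0, iIndepFun (fun x : latticeDomain D ε => ξ ε x) (P ε))
    (hbdd : ∀ ε > 0, ∀ x ∈ latticeDomain D ε, ∀ᵐ ω ∂(P ε), a ≤ ξ ε x ω ∧ ξ ε x ω ≤ b)
    (hmean : ∀ ε > 0, ∀ x ∈ latticeDomain D ε, ∫ ω, ξ ε x ω ∂(P ε) = U (latticePoint ε x))
    (hvar : ∀ ε > 0, ∀ x ∈ latticeDomain D ε, variance (ξ ε x) (P ε) = V (latticePoint ε x))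
    (ψ : testFunctions D) {ρ : ℝ} (hρ : 0 < ρ) :
    Tendsto (fun ε => P ε {ω | ρ ≤ |(∫ z, siteField (latticeDomain D ε) (fun x => ξ ε x ω)
      (cellIdx ε z) * ψ.1 z ^ 2) - ∫ z, U z * ψ.1 z ^ 2|}) (𝓝[>] (0 : ℝ)) (𝓝 0) := by
  have hi := (test_memLp ψ volume).integrable_sq
  obtain ⟨B, hB⟩ := (test_continuous ψ).bounded_above_of_compact_support (test_hasCompactSupport ψ)
  have hmemD : ∀ ε > 0, ∀ x ∈ latticeDomain D ε, latticePoint ε x ∈ D := by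
    intro ε hε x hx
    by_contra hcon
    rw [mem_latticeDomain hDb hε, Metric.infDist_zero_of_mem
      (Set.mem_image_of_mem WithLp.ofLp (show latticePoint ε x ∈ Dᶜ from hcon))] at hx
    exact absurd hx (not_lt.2 hε.le)
  have hlim : Tendsto (fun ε : ℝ => ENNReal.ofReal
      (|C'| * (B ^ 2 * ε ^ d * ∫ z, ψ.1 z ^ 2) / (ρ / 2) ^ 2)) (𝓝[>] (0 : ℝ)) (𝓝 0) := by
    have h1 : Continuous fun ε : ℝ => |C'| * (B ^ 2 * ε ^ d * ∫ z, ψ.1 z ^ 2) / (ρ / 2) ^ 2 := by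
      fun_prop
    have h2 := (h1.tendsto 0).mono_left (nhdsWithin_le_nhds (s := Set.Ioi 0))
    rw [zero_pow (by omega : d ≠ 0)] at h2
    simpa using ENNReal.tendsto_ofReal h2
  refine tendsto_of_tendsto_of_tendsto_of_le_of_le' tendsto_const_nhds hlim
    (Eventually.of_forall fun _ => zero_le) ?_
  have hdet := (Metric.tendsto_nhds.1 (tendsto_integral_mean_potential hd hDo hDb hU hC ψ)) (ρ / 2)
    (by positivity)
  filter_upwards [hdet, self_mem_nhdsWithin] with ε hdε (hε : 0 < ε)
  set Λ := latticeDomain D ε with hΛ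
  set m : (Fin d → ℤ) → ℝ := fun x => ∫ z in cell ε x, ψ.1 z ^ 2 with hm
  have hm0 : ∀ x, 0 ≤ m x := fun x => integral_nonneg fun _ => sq_nonneg _
  have hmB : ∀ x, m x ≤ B ^ 2 * ε ^ d := by
    intro x
    have := isFiniteMeasure_restrict_cell hε x
    have h1 : m x ≤ ∫ _z in cell ε x, B ^ 2 := by
      refine integral_mono hi.integrableOn (integrable_const _) fun z => ?_
      have := hB z
      rw [Real.norm_eq_abs] at this
      exact sq_le_sq' (by linarith [(abs_le.1 this).1]) (abs_le.1 this).2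
    rwa [setIntegral_const, volume_real_cell hε, smul_eq_mul, mul_comm] at h1
  have hm2 : ∑ x ∈ Λ, m x ^ 2 ≤ B ^ 2 * ε ^ d * ∫ z, ψ.1 z ^ 2 := by
    calc ∑ x ∈ Λ, m x ^ 2 ≤ ∑ x ∈ Λ, B ^ 2 * ε ^ d * m x := by
          refine Finset.sum_le_sum fun x _ => ?_
          rw [sq (m x)]
          exact mul_le_mul_of_nonneg_right (hmB x) (hm0 x)
      _ = B ^ 2 * ε ^ d * ∑ x ∈ Λ, m x := by rw [Finset.mul_sum]
      _ ≤ B ^ 2 * ε ^ d * ∫ z, ψ.1 z ^ 2 := by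
          gcongr
          exact sum_le_hasSum Λ (fun x _ => hm0 x) (hasSum_integral_cell ε hi)
  have hprob := prob_weighted_sum_le (P := P ε) (ξ := ξ ε) (hmeas ε hε) (hind ε hε) (hbdd ε hε)
    (C := |C'|) (fun x hx => by
      rw [hvar ε hε x hx]
      exact (le_abs_self _).trans ((hC' _ (hmemD ε hε x hx)).trans (le_abs_self _))) m
    (half_pos hρ)
  refine (measure_mono ?_).trans (hprob.trans (ENNReal.ofReal_le_ofReal ?_))
  · intro ω (hω : ρ ≤ _)
    show ρ / 2 ≤ _
    rw [integral_siteField_mul _ _ _ hi] at hω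
    rw [integral_siteField_mul _ _ _ hi, Real.dist_eq] at hdε
    have e : ∑ x ∈ Λ, (∫ ω, ξ ε x ω ∂(P ε)) * m x = ∑ x ∈ Λ, U (latticePoint ε x) * m x :=
      Finset.sum_congr rfl fun x hx => by rw [hmean ε hε x hx]
    rw [e]
    have h3 := abs_sub_le (∑ x ∈ Λ, ξ ε x ω * m x) (∑ x ∈ Λ, U (latticePoint ε x) * m x)
      (∫ z, U z * ψ.1 z ^ 2)
    linarith
  · gcongr

/-- Compactness of the unit ball of `H¹₀(D)` in `L²(D)`: finitely many test functions suffice to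
control the potential on the whole unit ball. -/
theorem exists_finite_net (hDo : IsOpen D) (hDb : Bornology.IsBounded D) {η : ℝ} (hη : 0 < η) :
    ∃ t : Finset (testFunctions D), (∀ ψ ∈ t, ‖testToH10 D ψ‖ ≤ 1) ∧
      ∀ φ : testFunctions D, ‖testToH10 D φ‖ ≤ 1 → ∃ ψ ∈ t, ∫ z, (φ.1 z - ψ.1 z) ^ 2 ≤ η := by
  classical
  set B : Set (testFunctions D) := {φ | ‖testToH10 D φ‖ ≤ 1} with hB
  obtain ⟨K, hK, hKsub⟩ := IsCompactOperator.image_closedBall_subset_compact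
    (f := (h10ToL2 D : H10 D →ₗ[ℝ] Lp ℝ 2 (volume.restrict D))) (isCompactOperator_h10ToL2 hDb hDo.measurableSet) 1
  have htb : TotallyBounded ((fun φ => h10ToL2 D (testToH10 D φ)) '' B) := by
    refine hK.totallyBounded.subset ?_
    rintro _ ⟨φ, hφ, rfl⟩
    exact hKsub ⟨testToH10 D φ, mem_closedBall_zero_iff.2 hφ, rfl⟩
  obtain ⟨s, hsB, hsf, hcov⟩ := htb.exists_subset (Metric.dist_mem_uniformity (Real.sqrt_pos.2 hη))
  have hsB' : ∀ y ∈ s, ∃ φ, φ ∈ B ∧ h10ToL2 D (testToH10 D φ) = y := fun y hy => hsB hy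
  choose! g hgB hg using hsB'
  refine ⟨hsf.toFinset.image g, ?_, fun φ hφ => ?_⟩
  · intro ψ hψ
    simp only [Finset.mem_image, Set.Finite.mem_toFinset] at hψ
    obtain ⟨y, hy, rfl⟩ := hψ
    exact hgB y hy
  · obtain ⟨y, hy, hdist⟩ := Set.mem_iUnion₂.1 (hcov ⟨φ, hφ, rfl⟩)
    refine ⟨g y, Finset.mem_image_of_mem g (hsf.mem_toFinset.2 hy), ?_⟩
    have h1 : dist (h10ToL2 D (testToH10 D φ)) y < √η := hdist
    have h2 : h10ToL2 D (testToH10 D (g y)) = y := hg y hy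
    rw [← h2, dist_eq_norm, ← map_sub, ← map_sub] at h1
    have h3 : ‖h10ToL2 D (testToH10 D (φ - g y))‖ ^ 2 ≤ η := by
      rw [← Real.sq_sqrt hη.le]
      exact pow_le_pow_left₀ (norm_nonneg _) h1.le 2
    rwa [norm_h10ToL2_testToH10_sq] at h3

/-- A bounded weight whose quadratic form is small on a fine enough net of the unit ball is small
relative to the `H¹` norm. -/
theorem abs_integral_mul_test_sq_le {W : EuclideanSpace ℝ (Fin d) → ℝ}
    (hWm : AEStronglyMeasurable W volume) {M : ℝ} (hM0 : 0 < M) (hWM : ∀ z, |W z| ≤ M) {ρ τ η : ℝ}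
    (hτ0 : 0 < τ) (hτ : M * τ = ρ / 4) (hη : M * ((1 + τ⁻¹) * η) = ρ / 4)
    {t : Finset (testFunctions D)} (ht1 : ∀ ψ ∈ t, ‖testToH10 D ψ‖ ≤ 1)
    (ht : ∀ φ : testFunctions D, ‖testToH10 D φ‖ ≤ 1 → ∃ ψ ∈ t, ∫ z, (φ.1 z - ψ.1 z) ^ 2 ≤ η)
    (hgood : ∀ ψ ∈ t, |∫ z, W z * ψ.1 z ^ 2| < ρ / 2) (φ : testFunctions D) :
    |∫ z, W z * φ.1 z ^ 2| ≤ ρ * ‖testToH10 D φ‖ ^ 2 := by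
  have hunit : ∀ φ : testFunctions D, ‖testToH10 D φ‖ ≤ 1 → |∫ z, W z * φ.1 z ^ 2| ≤ ρ := by
    intro φ hφ
    obtain ⟨ψ, hψt, hψ⟩ := ht φ hφ
    have h1 := hgood ψ hψt
    have h2 := abs_integral_mul_sq_sub_le hWm hWM (test_memLp φ volume) (test_memLp ψ volume) hτ0
    have h3 : ∫ z, ψ.1 z ^ 2 ≤ 1 := by
      rw [← norm_h10ToL2_testToH10_sq]
      have h4 := h10_norm_sq (testToH10 D ψ)
      have h5 := pow_le_pow_left₀ (norm_nonneg _) (ht1 ψ hψt) 2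
      nlinarith [sq_nonneg ‖h10Grad D (testToH10 D ψ)‖]
    have h4 : M * ((1 + τ⁻¹) * (∫ z, (φ.1 z - ψ.1 z) ^ 2) + τ * ∫ z, ψ.1 z ^ 2) ≤
        M * ((1 + τ⁻¹) * η + τ * 1) := by gcongr
    have h5 : M * ((1 + τ⁻¹) * η + τ * 1) = ρ / 2 := by
      linarith
    have h6 := abs_sub_abs_le_abs_sub (∫ z, W z * φ.1 z ^ 2) (∫ z, W z * ψ.1 z ^ 2)
    linarith
  by_cases h0 : ‖testToH10 D φ‖ = 0
  · have h1 : testToH10 D φ = 0 := norm_eq_zero.1 h0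
    have h2 : ∫ z, φ.1 z ^ 2 = 0 := by rw [← norm_h10ToL2_testToH10_sq, h1]; simp
    have h3 := abs_integral_mul_sq_sub_le hWm hWM (test_memLp φ volume)
      (test_memLp (0 : testFunctions D) volume) one_pos
    have h4 : ∀ z, (0 : testFunctions D).1 z = 0 := fun _ => rfl
    simp only [h4, sub_zero, h2] at h3
    rw [h0]
    simpa using h3
  · have hn : 0 < ‖testToH10 D φ‖ := lt_of_le_of_ne (norm_nonneg _) (Ne.symm h0)
    have h1 := hunit (‖testToH10 D φ‖⁻¹ • φ) (by
      rw [map_smul, norm_smul, norm_inv, norm_norm, inv_mul_cancel₀ h0])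
    have h2 : ∀ z, W z * (‖testToH10 D φ‖⁻¹ • φ).1 z ^ 2 =
        ‖testToH10 D φ‖⁻¹ ^ 2 * (W z * φ.1 z ^ 2) := by
      intro z
      show W z * (‖testToH10 D φ‖⁻¹ * φ.1 z) ^ 2 = _
      ring
    simp only [h2] at h1
    rw [integral_const_mul, abs_mul, abs_of_nonneg (by positivity), inv_pow,
      inv_mul_le_iff₀ (by positivity)] at h1
    linarith

/-- If a bounded site potential is close to `U` on a fine enough net of the unit ball, it is close to
`U` as a quadratic form relative to the `H¹` norm. -/
theorem abs_integral_siteField_sub_le (hDo : IsOpen D) (hU : ContinuousOn U D)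
    (hC : ∀ x ∈ D, |U x| ≤ C) {Λ : Finset (Fin d → ℤ)} {F : (Fin d → ℤ) → ℝ} {C₁ : ℝ} (hC₁0 : 0 ≤ C₁)
    (hω : ∀ x ∈ Λ, |F x| ≤ C₁) (ε : ℝ) {M ρ τ η : ℝ} (hM : M = C₁ + |C| + 1)
    (hτ0 : 0 < τ) (hτ : M * τ = ρ / 4) (hη : M * ((1 + τ⁻¹) * η) = ρ / 4)
    {t : Finset (testFunctions D)} (ht1 : ∀ ψ ∈ t, ‖testToH10 D ψ‖ ≤ 1)
    (ht : ∀ φ : testFunctions D, ‖testToH10 D φ‖ ≤ 1 → ∃ ψ ∈ t, ∫ z, (φ.1 z - ψ.1 z) ^ 2 ≤ η)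
    (hgood : ∀ ψ ∈ t, |(∫ z, siteField Λ F (cellIdx ε z) * ψ.1 z ^ 2) -
      ∫ z, U z * ψ.1 z ^ 2| < ρ / 2) (φ : testFunctions D) :
    |(∫ z, siteField Λ F (cellIdx ε z) * φ.1 z ^ 2) - ∫ z, U z * φ.1 z ^ 2| ≤
      ρ * ‖testToH10 D φ‖ ^ 2 := by
  have hM0 : 0 < M := by rw [hM]; positivity
  have hUm : AEStronglyMeasurable (D.indicator U) volume :=
    (aestronglyMeasurable_indicator_iff hDo.measurableSet).2
      (hU.aestronglyMeasurable hDo.measurableSet)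
  set W : EuclideanSpace ℝ (Fin d) → ℝ := fun z =>
    siteField Λ F (cellIdx ε z) - D.indicator U z with hW
  have hWm : AEStronglyMeasurable W volume := (aestronglyMeasurable_comp_cellIdx _ ε _).sub hUm
  have hWM : ∀ z, |W z| ≤ M := by
    intro z
    refine (abs_sub _ _).trans ?_
    have h1 := abs_siteField_le hC₁0 hω (cellIdx ε z)
    have h2 : |D.indicator U z| ≤ |C| := by
      by_cases hz : z ∈ D
      · rw [Set.indicator_of_mem hz]
        exact (hC z hz).trans (le_abs_self C)
      · rw [Set.indicator_of_notMem hz, abs_zero]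
        exact abs_nonneg C
    linarith
  have hWint : ∀ φ : testFunctions D, ∫ z, W z * φ.1 z ^ 2 =
      (∫ z, siteField Λ F (cellIdx ε z) * φ.1 z ^ 2) - ∫ z, U z * φ.1 z ^ 2 := by
    intro φ
    have hi := (test_memLp φ volume).integrable_sq
    rw [← integral_indicator_mul_test_sq U φ, ← integral_sub]
    · exact integral_congr_ae (ae_of_all _ fun z => sub_mul _ _ _)
    · exact hi.bdd_mul (aestronglyMeasurable_comp_cellIdx _ ε _)
        (ae_of_all _ fun z => abs_siteField_le hC₁0 hω (cellIdx ε z))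
    · refine hi.bdd_mul (c := |C|) hUm (ae_of_all _ fun z => ?_)
      by_cases hz : z ∈ D
      · rw [Set.indicator_of_mem hz]
        exact (hC z hz).trans (le_abs_self C)
      · rw [Set.indicator_of_notMem hz, norm_zero]
        exact abs_nonneg C
  rw [← hWint]
  refine abs_integral_mul_test_sq_le hWm hM0 hWM hτ0 hτ hη ht1 ht (fun ψ hψ => ?_) φ
  rw [hWint]
  exact hgood ψ hψ

/-- The potential `F` on the lattice domain is bounded by `C₁`, and `ρ`-close to `U` as a quadratic
form relative to the `H¹` norm. Only the values of `F` on `D_ε` matter. -/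
def PotentialClose (D : Set (EuclideanSpace ℝ (Fin d))) (U : EuclideanSpace ℝ (Fin d) → ℝ)
    (C₁ ρ ε : ℝ) (F : (Fin d → ℤ) → ℝ) : Prop :=
  (∀ x ∈ latticeDomain D ε, |F x| ≤ C₁) ∧
    ∀ φ : testFunctions D, |(∫ z, siteField (latticeDomain D ε) F (cellIdx ε z) * φ.1 z ^ 2) -
      ∫ z, U z * φ.1 z ^ 2| ≤ ρ * ‖testToH10 D φ‖ ^ 2

/-- With high probability the random potential is close to its mean as a quadratic form, relative
to the `H¹` norm and uniformly over all test functions. -/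
theorem tendsto_prob_potential (hd : 1 ≤ d) (hDo : IsOpen D)
    (hDb : Bornology.IsBounded D) (hU : ContinuousOn U D) (hC : ∀ x ∈ D, |U x| ≤ C)
    (hC' : ∀ x ∈ D, |V x| ≤ C')
    (hmeas : ∀ ε > 0, ∀ x ∈ latticeDomain D ε, Measurable (ξ ε x))
    (hind : ∀ ε > 0, iIndepFun (fun x : latticeDomain D ε => ξ ε x) (P ε))
    (hbdd : ∀ ε > 0, ∀ x ∈ latticeDomain D ε, ∀ᵐ ω ∂(P ε), a ≤ ξ ε x ω ∧ ξ ε x ω ≤ b)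
    (hmean : ∀ ε > 0, ∀ x ∈ latticeDomain D ε, ∫ ω, ξ ε x ω ∂(P ε) = U (latticePoint ε x))
    (hvar : ∀ ε > 0, ∀ x ∈ latticeDomain D ε, variance (ξ ε x) (P ε) = V (latticePoint ε x))
    {ρ : ℝ} (hρ : 0 < ρ) :
    Tendsto (fun ε => P ε {ω | ¬ PotentialClose D U (max |a| |b|) ρ ε fun x => ξ ε x ω})
      (𝓝[>] (0 : ℝ)) (𝓝 0) := by
  set C₁ := max |a| |b| with hC₁
  have hC₁0 : 0 ≤ C₁ := (abs_nonneg a).trans (le_max_left _ _)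
  set M := C₁ + |C| + 1 with hM
  have hM0 : 0 < M := by positivity
  set τ := ρ / (4 * M) with hτ
  have hτ0 : 0 < τ := by positivity
  set η := ρ / (4 * M * (1 + τ⁻¹)) with hη
  have hη0 : 0 < η := by positivity
  -- `τ` and `η` make the error of passing to the net at most `ρ / 2`
  obtain ⟨t, ht1, ht⟩ := exists_finite_net hDo hDb hη0
  have hlim : Tendsto (fun ε => ∑ ψ ∈ t, P ε {ω | ρ / 2 ≤ |(∫ z, siteField (latticeDomain D ε)
      (fun x => ξ ε x ω) (cellIdx ε z) * ψ.1 z ^ 2) - ∫ z, U z * ψ.1 z ^ 2|})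
      (𝓝[>] (0 : ℝ)) (𝓝 0) := by
    have := tendsto_finsetSum t fun ψ _ => tendsto_prob_test hd hDo hDb hU hC hC' hmeas hind hbdd
      hmean hvar ψ (half_pos hρ)
    simpa using this
  refine tendsto_of_tendsto_of_tendsto_of_le_of_le' tendsto_const_nhds hlim
    (Eventually.of_forall fun _ => zero_le) ?_
  filter_upwards [self_mem_nhdsWithin] with ε (hε : 0 < ε)
  set Λ := latticeDomain D ε with hΛ
  have hae : ∀ᵐ ω ∂(P ε), ∀ x ∈ Λ, |ξ ε x ω| ≤ C₁ := by
    rw [Filter.eventually_all_finset]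
    intro x hx
    filter_upwards [hbdd ε hε x hx] with ω hω
    exact abs_le_max_abs_abs hω.1 hω.2
  refine le_trans ?_ (measure_biUnion_finset_le t _)
  refine measure_mono_ae ?_
  filter_upwards [hae] with ω hω hbad
  by_contra hgood
  have hgood' : ∀ ψ ∈ t, |(∫ z, siteField Λ (fun x => ξ ε x ω) (cellIdx ε z) * ψ.1 z ^ 2) -
      ∫ z, U z * ψ.1 z ^ 2| < ρ / 2 := by
    intro ψ hψ
    by_contra hcon
    exact hgood (Set.mem_biUnion (x := ψ) hψ (not_lt.1 hcon))
  refine hbad ⟨hω, abs_integral_siteField_sub_le hDo hU hC hC₁0 hω ε hM hτ0 ?_ ?_ ht1 ht hgood'⟩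
  · rw [hτ]
    field_simp
  · have : 0 < 1 + τ⁻¹ := by positivity
    rw [hη]
    field_simp

end Random

/-! ### Trial spaces under perturbation -/

theorem HasTrialSpace.mono {V : Type*} [AddCommGroup V] [Module ℝ V] {Q N : V → ℝ}
    (hN : ∀ v, 0 ≤ N v) {k : ℕ} {s t : ℝ} (hst : s ≤ t) (h : HasTrialSpace Q N k s) :
    HasTrialSpace Q N k t := by
  obtain ⟨P, hP, h⟩ := h
  exact ⟨P, hP, fun c => (h c).trans (mul_le_mul_of_nonneg_right hst (hN _))⟩

/-- A linear map which almost preserves `N` and almost does not increase `Q` carries trial spaces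
to trial spaces of almost the same level. -/
theorem hasTrialSpace_of_perturbation {V V' : Type*} [AddCommGroup V] [Module ℝ V]
    [AddCommGroup V'] [Module ℝ V'] {Q N : V → ℝ} {Q' N' : V' → ℝ} {k : ℕ} {t σ δ : ℝ}
    (T : V →ₗ[ℝ] V') (hN : ∀ v, 0 ≤ N v) (hN0 : ∀ v, N v = 0 → v = 0) (hN' : N' 0 = 0)
    (hσ : σ < 1) (hσδ : σ * (1 + |t + δ|) ≤ δ) {P : (Fin k → ℝ) →ₗ[ℝ] V}
    (hP : Function.Injective P) (hQ : ∀ c, Q (P c) ≤ t * N (P c))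
    (h1 : ∀ c, |N' (T (P c)) - N (P c)| ≤ σ * N (P c))
    (h2 : ∀ c, Q' (T (P c)) ≤ Q (P c) + σ * N (P c)) : HasTrialSpace Q' N' k (t + δ) := by
  refine ⟨T ∘ₗ P, ?_, fun c => ?_⟩
  · rw [injective_iff_map_eq_zero]
    intro c hc
    have hc' : T (P c) = 0 := hc
    have h := h1 c
    rw [hc', hN', zero_sub, abs_neg, abs_of_nonneg (hN _)] at h
    have h0 : N (P c) = 0 := by nlinarith [hN (P c)]
    exact (injective_iff_map_eq_zero _).1 hP c (hN0 _ h0)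
  · show Q' (T (P c)) ≤ (t + δ) * N' (T (P c))
    have h3 : |(t + δ) * (N' (T (P c)) - N (P c))| ≤ |t + δ| * (σ * N (P c)) := by
      rw [abs_mul]
      exact mul_le_mul_of_nonneg_left (h1 c) (abs_nonneg _)
    have h4 := (abs_le.1 h3).1
    have h5 := mul_le_mul_of_nonneg_right hσδ (hN (P c))
    have h6 := hQ c
    have h7 := h2 c
    linarith

/-- Over a finite-dimensional space on which `N` is definite, the form is bounded by a multiple
of `N`. -/
theorem exists_hasTrialSpace {H L T : Type*} [NormedAddCommGroup H] [NormedSpace ℝ H]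
    [NormedAddCommGroup L] [InnerProductSpace ℝ L] [AddCommGroup T] [Module ℝ T]
    (q : H →L[ℝ] H →L[ℝ] ℝ) (J : H →L[ℝ] L) (e : T →ₗ[ℝ] H) (he : ∀ f, J (e f) = 0 → f = 0)
    {k : ℕ} (P : (Fin k → ℝ) →ₗ[ℝ] T) (hP : Function.Injective P) :
    ∃ t, HasTrialSpace (fun u => q u u) (fun u => ‖J u‖ ^ 2) k t := by
  let S : (Fin k → ℝ) →ₗ[ℝ] H := e ∘ₗ P
  have hker : LinearMap.ker ((J : H →ₗ[ℝ] L) ∘ₗ S) = ⊥ := by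
    rw [LinearMap.ker_eq_bot, injective_iff_map_eq_zero]
    intro c hc
    exact (injective_iff_map_eq_zero _).1 hP c (he _ hc)
  obtain ⟨K, -, hK⟩ := LinearMap.exists_antilipschitzWith _ hker
  have hKc : ∀ c, ‖c‖ ≤ K * ‖J (S c)‖ := fun c => by
    have := hK.le_mul_dist c 0
    simpa using this
  have hS : ∀ c, ‖S c‖ ≤ ‖S.toContinuousLinearMap‖ * ‖c‖ := fun c =>
    S.toContinuousLinearMap.le_opNorm c
  refine ⟨‖q‖ * (‖S.toContinuousLinearMap‖ * K) ^ 2, S, ?_, fun c => ?_⟩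
  · rw [injective_iff_map_eq_zero]
    intro c hc
    refine (injective_iff_map_eq_zero _).1 hP c (he _ ?_)
    rw [show e (P c) = S c from rfl, hc, map_zero]
  · have h1 : q (S c) (S c) ≤ ‖q‖ * ‖S c‖ * ‖S c‖ :=
      (le_abs_self _).trans (q.le_opNorm₂ _ _)
    have h2 : ‖S c‖ ≤ ‖S.toContinuousLinearMap‖ * K * ‖J (S c)‖ :=
      (hS c).trans (by
        rw [mul_assoc]
        exact mul_le_mul_of_nonneg_left (hKc c) (norm_nonneg _))
    calc q (S c) (S c) ≤ ‖q‖ * ‖S c‖ ^ 2 := by rw [sq, ← mul_assoc]; exact h1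
      _ ≤ ‖q‖ * (‖S.toContinuousLinearMap‖ * K * ‖J (S c)‖) ^ 2 := by gcongr
      _ = _ := by ring

section DirichletSpectrum

variable {d : ℕ} {D : Set (EuclideanSpace ℝ (Fin d))}

/-- Bump functions at `k` distinct points of `D`, each vanishing at the other points. -/
theorem exists_injective_testFunctions (hd : 1 ≤ d) (hDo : IsOpen D) (hDne : D.Nonempty) (k : ℕ) :
    ∃ P : (Fin k → ℝ) →ₗ[ℝ] testFunctions D, Function.Injective P := by
  have : Nonempty (Fin d) := ⟨⟨0, hd⟩⟩
  have hinf : D.Infinite := by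
    obtain ⟨x, hx⟩ := hDne
    have : (𝓝[≠] x).NeBot := Module.punctured_nhds_neBot ℝ (EuclideanSpace ℝ (Fin d)) x
    exact infinite_of_mem_nhds x (hDo.mem_nhds hx)
  let y : Fin k → EuclideanSpace ℝ (Fin d) := fun i => hinf.natEmbedding D i
  have hyD : ∀ i, y i ∈ D := fun i => (hinf.natEmbedding D i).2
  have hyinj : Function.Injective y := fun i j h =>
    Fin.ext ((hinf.natEmbedding D).injective (Subtype.ext h))
  have hψ : ∀ i, ∃ ψ : testFunctions D, ψ.1 (y i) = 1 ∧ ∀ j, j ≠ i → ψ.1 (y j) = 0 := by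
    intro i
    have hs : D \ (y '' {j | j ≠ i}) ∈ 𝓝 (y i) := by
      refine (hDo.sdiff (Set.toFinite _).isClosed).mem_nhds ⟨hyD i, ?_⟩
      rintro ⟨j, hj, hij⟩
      exact hj (hyinj hij)
    obtain ⟨f, hfs, hfc, hfd, -, hf1⟩ := exists_contDiff_tsupport_subset (n := (⊤ : ℕ∞)) hs
    refine ⟨⟨f, hfd, hfc, fun z hz => (hfs hz).1⟩, hf1, fun j hj => ?_⟩
    exact image_eq_zero_of_notMem_tsupport fun h => (hfs h).2 ⟨j, hj, rfl⟩
  choose ψ hψ1 hψ0 using hψ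
  refine ⟨Fintype.linearCombination ℝ ψ, ?_⟩
  rw [injective_iff_map_eq_zero]
  intro c hc
  funext i
  have h : (Fintype.linearCombination ℝ ψ c).1 (y i) = 0 := by rw [hc]; rfl
  rw [Fintype.linearCombination_apply, Submodule.coe_sum, Finset.sum_apply,
    Finset.sum_eq_single_of_mem i (Finset.mem_univ i)] at h
  · have h' : c i * (ψ i).1 (y i) = 0 := h
    rw [hψ1, mul_one] at h'
    exact h'
  · intro j _ hj
    show c j * (ψ j).1 (y i) = 0
    rw [hψ0 j i hj.symm, mul_zero]

theorem test_eq_zero_of_integral_sq_eq_zero (φ : testFunctions D) (h : ∫ z, φ.1 z ^ 2 = 0) :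
    φ = 0 := by
  have hc := test_continuous φ
  have h1 := (integral_eq_zero_iff_of_nonneg (fun z => sq_nonneg (φ.1 z))
    (integrable_sq hc (test_hasCompactSupport φ))).1 h
  have h2 : (fun z => φ.1 z ^ 2) = fun _ => 0 :=
    (Continuous.ae_eq_iff_eq volume (hc.pow 2) continuous_const).1 h1
  refine Subtype.ext (funext fun z => ?_)
  exact pow_eq_zero_iff two_ne_zero |>.1 (congrFun h2 z)

/-- The min-max principle: the infimum of the levels of `k`-dimensional trial spaces is the `k`-th
smallest eigenvalue. -/
theorem exists_isKthDirichletEigenvalue (hd : 1 ≤ d) (hDo : IsOpen D) (hDb : Bornology.IsBounded D)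
    (hDne : D.Nonempty) {W : Lp ℝ ⊤ (volume.restrict D)} {U : EuclideanSpace ℝ (Fin d) → ℝ}
    (hW : W =ᵐ[volume.restrict D] U) {C : ℝ} (hC : ∀ x ∈ D, |U x| ≤ C) {k : ℕ} (hk : 1 ≤ k) :
    ∃ lam, IsKthDirichletEigenvalue D U k lam ∧
      (∀ t, HasTrialSpace (fun u => dirichletForm D W u u) (fun u => ‖h10ToL2 D u‖ ^ 2) k t →
        lam ≤ t) ∧
      ∀ t > lam, HasTrialSpace (fun u => dirichletForm D W u u) (fun u => ‖h10ToL2 D u‖ ^ 2) k t := by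
  set S := {t | HasTrialSpace (fun u => dirichletForm D W u u) (fun u => ‖h10ToL2 D u‖ ^ 2) k t}
    with hS
  have hcoer := dirichletForm_coercive hW hDo.measurableSet hC
  have hSne : S.Nonempty := by
    obtain ⟨P, hP⟩ := exists_injective_testFunctions hd hDo hDne k
    refine exists_hasTrialSpace (dirichletForm D W) (h10ToL2 D) (testToH10 D) (fun φ hφ => ?_) P hP
    refine test_eq_zero_of_integral_sq_eq_zero φ ?_
    rw [← norm_h10ToL2_testToH10_sq, hφ, norm_zero]
    norm_num
  have hSb : BddBelow S := by
    refine ⟨-(1 + C), fun t ht => ?_⟩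
    obtain ⟨P, hP, h⟩ := ht
    have : Nonempty (Fin k) := ⟨⟨0, hk⟩⟩
    have hne : P 1 ≠ 0 := fun h0 => one_ne_zero ((injective_iff_map_eq_zero _).1 hP 1 h0)
    have h1 := h 1
    have h2 := hcoer (P 1)
    have h3 : 0 < ‖P 1‖ ^ 2 := by positivity
    by_contra! hlt
    have h4 : (t + (1 + C)) * ‖h10ToL2 D (P 1)‖ ^ 2 ≤ 0 :=
      mul_nonpos_of_nonpos_of_nonneg (by linarith) (sq_nonneg _)
    simp only at h1
    linarith
  have hle : ∀ t ∈ S, sInf S ≤ t := fun t ht => csInf_le hSb ht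
  have hgt : ∀ t > sInf S, t ∈ S := fun t ht => by
    obtain ⟨s, hs, hst⟩ := exists_lt_of_csInf_lt hSne ht
    exact HasTrialSpace.mono (Q := fun u => dirichletForm D W u u)
      (N := fun u => ‖h10ToL2 D u‖ ^ 2) (fun u => sq_nonneg ‖h10ToL2 D u‖) hst.le hs
  have : CompleteSpace (H10 D) := (Submodule.isClosed_topologicalClosure _).completeSpace_coe
  refine ⟨sInf S, ⟨?_, ?_⟩, hle, hgt⟩
  · refine (Submodule.rank_mono (Submodule.span_mono ?_)).trans_lt
      (rank_eigenvectors_lt (dirichletForm_symm W) hk hle)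
    rintro u ⟨m, hm, hu⟩
    exact ⟨m, hm, (isFormEigenvector_iff hW m u).2 hu⟩
  · refine (le_rank_eigenvectors (dirichletForm_symm W)
      (isCompactOperator_h10ToL2 hDb hDo.measurableSet) hcoer hgt).trans
      (Submodule.rank_mono (Submodule.span_mono ?_))
    rintro u ⟨m, hm, hu⟩
    exact ⟨m, hm, (isFormEigenvector_iff hW m u).1 hu⟩

end DirichletSpectrum

/-! ### The quadratic form of the lattice operator -/

section LatticeForm

variable {d : ℕ}

/-- Summation by parts along one lattice direction. -/
theorem tsum_mul_second_difference {f : (Fin d → ℤ) → ℝ} (hf : f.support.Finite)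
    (e : Fin d → ℤ) :
    ∑' x, f x * ((f (x + e) - f x) + (f (x - e) - f x)) = -∑' x, (f (x + e) - f x) ^ 2 := by
  have s1 : Summable fun x => f x * (f (x + e) - f x) :=
    summable_of_hasFiniteSupport (hf.subset (Function.support_mul_subset_left _ _))
  have s2 : Summable fun x => f x * (f (x - e) - f x) :=
    summable_of_hasFiniteSupport (hf.subset (Function.support_mul_subset_left _ _))
  have s3 : Summable fun x => f (x + e) * (f x - f (x + e)) := by
    refine ((Equiv.addRight e).summable_iff.2 s2).congr fun x => ?_
    simp
  have h2 : ∑' x, f x * (f (x - e) - f x) = ∑' x, f (x + e) * (f x - f (x + e)) := by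
    rw [← (Equiv.addRight e).tsum_eq]
    simp
  simp only [mul_add]
  rw [s1.tsum_add s2, h2, ← s1.tsum_add s3, ← tsum_neg]
  exact tsum_congr fun x => by ring

theorem sum_mul_latticeLaplacian {Λ : Finset (Fin d → ℤ)} {f : (Fin d → ℤ) → ℝ}
    (hf : ∀ x ∉ Λ, f x = 0) : ∑ x ∈ Λ, f x * latticeLaplacian f x = -edgeEnergy f := by
  have hs := support_finite_of_eq_zero hf
  rw [edgeEnergy_eq_sum hs, ← Finset.sum_neg_distrib, ← tsum_eq_sum (L := .unconditional _) fun x hx => by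
    rw [hf x hx, zero_mul]]
  simp only [latticeLaplacian, Finset.mul_sum]
  rw [Summable.tsum_finsetSum fun i _ =>
    summable_of_hasFiniteSupport (hs.subset (Function.support_mul_subset_left _ _))]
  exact Finset.sum_congr rfl fun i _ => tsum_mul_second_difference hs _

theorem pow_mul_dotProduct_self {Λ : Finset (Fin d → ℤ)} {f : (Fin d → ℤ) → ℝ}
    (hf : ∀ x ∉ Λ, f x = 0) {ε : ℝ} (hε : 0 < ε) :
    ε ^ d * ((fun x : Λ => f x) ⬝ᵥ fun x : Λ => f x) = ∫ z, f (cellIdx ε z) ^ 2 := by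
  have hs := support_finite_of_eq_zero hf
  rw [integral_step (F := fun x => f x ^ 2) (hs.subset fun x hx => by
    simpa using hx) hε, tsum_eq_sum (L := .unconditional _) (s := Λ) fun x hx => by rw [hf x hx]; norm_num]
  simp only [dotProduct, ← sq]
  rw [Finset.sum_coe_sort Λ fun x => f x ^ 2]

/-- Multiplied by the volume `ε^d` of a cell, the form of the lattice operator is a Dirichlet energy
plus an integral over step functions. -/
theorem pow_mul_dotProduct_andersonMatrix {Λ : Finset (Fin d → ℤ)} {f : (Fin d → ℤ) → ℝ}
    (hf : ∀ x ∉ Λ, f x = 0) {ε : ℝ} (hε : 0 < ε) (F : (Fin d → ℤ) → ℝ) :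
    ε ^ d * ((fun x : Λ => f x) ⬝ᵥ (andersonMatrix Λ ε F).mulVec fun x : Λ => f x) =
      (ε ^ 2)⁻¹ * (ε ^ d * edgeEnergy f) +
        ∫ z, siteField Λ F (cellIdx ε z) * f (cellIdx ε z) ^ 2 := by
  have hs := support_finite_of_eq_zero hf
  have h1 : ((fun x : Λ => f x) ⬝ᵥ (andersonMatrix Λ ε F).mulVec fun x : Λ => f x) =
      (ε ^ 2)⁻¹ * edgeEnergy f + ∑ x ∈ Λ, F x * f x ^ 2 := by
    simp only [dotProduct, andersonMatrix_mulVec Λ ε F f hf]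
    rw [Finset.sum_coe_sort Λ fun x => f x * latticeSchrodinger ε F f x,
      show edgeEnergy f = -∑ x ∈ Λ, f x * latticeLaplacian f x by
        rw [sum_mul_latticeLaplacian hf, neg_neg], mul_neg, ← neg_mul, Finset.mul_sum,
      ← Finset.sum_add_distrib]
    refine Finset.sum_congr rfl fun x _ => ?_
    rw [latticeSchrodinger]
    ring
  rw [h1, integral_step (F := fun x => siteField Λ F x * f x ^ 2) (hs.subset fun x hx => by
    simp only [Function.mem_support, ne_eq, mul_eq_zero, not_or] at hx ⊢
    exact fun h => hx.2 (by rw [h]; norm_num)) hε,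
    tsum_eq_sum (L := .unconditional _) (s := Λ) fun x hx => by rw [siteField_of_notMem hx, zero_mul],
    Finset.sum_congr rfl fun x hx => show siteField Λ F x * f x ^ 2 = F x * f x ^ 2 by
      rw [siteField_of_mem hx]]
  ring

end LatticeForm

/-! ### Comparison of lattice and continuum trial spaces -/

section Comparison

variable {d : ℕ} {D : Set (EuclideanSpace ℝ (Fin d))}

/-- If `f - g` is of size `O(ε) ‖g‖` in `L²`, then `∫ W f²` and `∫ W g²` differ by `O(ε) ‖g‖²`. The
constant `K` is that of a Poincaré inequality, and `B ‖g‖²` the bound on the Dirichlet energy. -/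
theorem abs_integral_mul_sq_sub_le_of_close {X : Type*} [MeasurableSpace X] {μ : Measure X}
    {W f g : X → ℝ} (hW : AEStronglyMeasurable W μ) {C : ℝ} (hC0 : 0 ≤ C) (hC : ∀ z, |W z| ≤ C)
    (hf : MemLp f 2 μ) (hg : MemLp g 2 μ) {ε K B : ℝ} (hε : 0 < ε) (hε1 : ε ≤ 1) (hK : 0 ≤ K)
    (hB : 0 ≤ B) (h : ∫ z, (f z - g z) ^ 2 ∂μ ≤ K * ε ^ 2 * (B * ∫ z, g z ^ 2 ∂μ)) :
    |(∫ z, W z * f z ^ 2 ∂μ) - ∫ z, W z * g z ^ 2 ∂μ| ≤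
      C * (ε * (2 * K * B + 1)) * ∫ z, g z ^ 2 ∂μ := by
  refine (abs_integral_mul_sq_sub_le hW hC hf hg hε).trans ?_
  rw [mul_assoc C]
  refine mul_le_mul_of_nonneg_left ?_ hC0
  have hN : 0 ≤ ∫ z, g z ^ 2 ∂μ := integral_nonneg fun z => sq_nonneg _
  set N := ∫ z, g z ^ 2 ∂μ
  have h1 : (1 + ε⁻¹) * (∫ z, (f z - g z) ^ 2 ∂μ) ≤ (1 + ε⁻¹) * (K * ε ^ 2 * (B * N)) :=
    mul_le_mul_of_nonneg_left h (by positivity)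
  have h2 : (1 + ε⁻¹) * (K * ε ^ 2 * (B * N)) = (ε + 1) * ε * (K * B * N) := by
    field_simp
  have h3 : (ε + 1) * ε * (K * B * N) ≤ 2 * ε * (K * B * N) := by
    gcongr
    linarith
  rw [h2] at h1
  linarith

/-- The same comparison for the squared norms themselves. -/
theorem abs_integral_sq_sub_le_of_close {X : Type*} [MeasurableSpace X] {μ : Measure X}
    {f g : X → ℝ} (hf : MemLp f 2 μ) (hg : MemLp g 2 μ) {ε K B : ℝ} (hε : 0 < ε) (hε1 : ε ≤ 1)
    (hK : 0 ≤ K) (hB : 0 ≤ B)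
    (h : ∫ z, (f z - g z) ^ 2 ∂μ ≤ K * ε ^ 2 * (B * ∫ z, g z ^ 2 ∂μ)) :
    |(∫ z, f z ^ 2 ∂μ) - ∫ z, g z ^ 2 ∂μ| ≤ ε * (2 * K * B + 1) * ∫ z, g z ^ 2 ∂μ := by
  have := abs_integral_mul_sq_sub_le_of_close (W := fun _ => 1) (C := 1)
    aestronglyMeasurable_const zero_le_one (by simp) hf hg hε hε1 hK hB h
  simpa using this

theorem norm_testToH10_sq (φ : testFunctions D) :
    ‖testToH10 D φ‖ ^ 2 = (∫ z, φ.1 z ^ 2) + ∫ z, ‖gradient φ.1 z‖ ^ 2 := by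
  rw [h10_norm_sq, norm_h10ToL2_testToH10_sq, norm_h10Grad_testToH10_sq]

/-- Passing from a test function to its cell averages changes the squared norm little and does not
increase the form by much. -/
theorem cellAvg_comparison {U : EuclideanSpace ℝ (Fin d) → ℝ} {C C₁ ρ ε t B : ℝ}
    (hC : ∀ x ∈ D, |U x| ≤ C) (hC0 : 0 ≤ C) (hC₁ : 0 ≤ C₁) (hε : 0 < ε) (hε1 : ε ≤ 1) (hρ : 0 ≤ ρ)
    (hB0 : 0 ≤ B) (hB : 1 + t + C ≤ B) {F : (Fin d → ℤ) → ℝ} (hF : PotentialClose D U C₁ ρ ε F)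
    (φ : testFunctions D) (hφ : ∀ x ∉ latticeDomain D ε, cellAvg ε φ.1 x = 0)
    (ht : (∫ z, ‖gradient φ.1 z‖ ^ 2) + ∫ z, U z * φ.1 z ^ 2 ≤ t * ∫ z, φ.1 z ^ 2) :
    |(∫ z, cellAvg ε φ.1 (cellIdx ε z) ^ 2) - ∫ z, φ.1 z ^ 2| ≤
        ε * (2 * (2 ^ d * d) * B + 1) * ∫ z, φ.1 z ^ 2 ∧
      (ε ^ 2)⁻¹ * (ε ^ d * edgeEnergy (cellAvg ε φ.1)) +
        ∫ z, siteField (latticeDomain D ε) F (cellIdx ε z) * cellAvg ε φ.1 (cellIdx ε z) ^ 2 ≤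
      (∫ z, ‖gradient φ.1 z‖ ^ 2) + (∫ z, U z * φ.1 z ^ 2) +
        (C₁ * (ε * (2 * (2 ^ d * d) * B + 1)) + ρ * B) * ∫ z, φ.1 z ^ 2 := by
  have hgm := test_memLp φ volume
  have hfm : MemLp (fun z : EuclideanSpace ℝ (Fin d) => cellAvg ε φ.1 (cellIdx ε z)) 2 :=
    memLp_step (support_finite_of_eq_zero hφ) hε
  have hUφ : |∫ z, U z * φ.1 z ^ 2| ≤ C * ∫ z, φ.1 z ^ 2 := by
    rw [← integral_indicator_mul_test_sq, ← integral_const_mul, ← Real.norm_eq_abs]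
    refine norm_integral_le_of_norm_le (hgm.integrable_sq.const_mul C) (ae_of_all _ fun z => ?_)
    rw [norm_mul, Real.norm_eq_abs, Real.norm_eq_abs, abs_of_nonneg (sq_nonneg (φ.1 z))]
    refine mul_le_mul_of_nonneg_right ?_ (sq_nonneg _)
    by_cases hz : z ∈ D
    · rw [Set.indicator_of_mem hz]
      exact hC z hz
    · rw [Set.indicator_of_notMem hz, abs_zero]
      exact hC0
  have hN : 0 ≤ ∫ z, φ.1 z ^ 2 := integral_nonneg fun z => sq_nonneg _
  have hH := norm_testToH10_sq φ
  have hav := integral_sub_cellAvg_sq_le (test_contDiff_one φ) (test_hasCompactSupport φ) hε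
  have hen := edgeEnergy_cellAvg_le (test_contDiff_one φ) (test_hasCompactSupport φ) hε
  have hF2 := (abs_le.1 (hF.2 φ)).2
  set N := ∫ z, φ.1 z ^ 2 with hNdef
  set E := ∫ z, ‖gradient φ.1 z‖ ^ 2 with hE
  have hUφ' := (abs_le.1 hUφ).1
  have hBN : (1 + t + C) * N ≤ B * N := mul_le_mul_of_nonneg_right hB hN
  have hEB : E ≤ B * N := by linarith
  have hHB : ‖testToH10 D φ‖ ^ 2 ≤ B * N := by linarith
  have hclose : ∫ z, (cellAvg ε φ.1 (cellIdx ε z) - φ.1 z) ^ 2 ≤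
      2 ^ d * d * ε ^ 2 * (B * N) := by
    simp only [sub_sq_comm (cellAvg ε φ.1 _)]
    exact hav.trans (mul_le_mul_of_nonneg_left hEB (by positivity))
  refine ⟨abs_integral_sq_sub_le_of_close hfm hgm hε hε1 (by positivity) hB0 hclose, ?_⟩
  have hpot := (abs_le.1 (abs_integral_mul_sq_sub_le_of_close
    (aestronglyMeasurable_comp_cellIdx (siteField (latticeDomain D ε) F) ε volume) hC₁
    (fun z => abs_siteField_le hC₁ hF.1 _) hfm hgm hε hε1 (by positivity) hB0 hclose)).2
  have h1 : (ε ^ 2)⁻¹ * (ε ^ d * edgeEnergy (cellAvg ε φ.1)) ≤ E := by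
    rw [inv_mul_le_iff₀ (by positivity)]
    exact hen
  have h2 := mul_le_mul_of_nonneg_left hHB hρ
  linarith

/-- Passing from a lattice function to its smooth interpolation changes the squared norm little and
does not increase the form by much. -/
theorem interp_comparison {U : EuclideanSpace ℝ (Fin d) → ℝ} {C₁ ρ ε t B κ : ℝ}
    (p : RampDensity κ) (hC₁ : 0 ≤ C₁) (hε : 0 < ε) (hε1 : ε ≤ 1) (hρ : 0 ≤ ρ) (hκ1 : 1 ≤ κ)
    (hκ2 : κ ≤ 2) (hB0 : 0 ≤ B) (hB : 1 + t + C₁ ≤ B) {F : (Fin d → ℤ) → ℝ}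
    (hF : PotentialClose D U C₁ ρ ε F) {f : (Fin d → ℤ) → ℝ}
    (hf : ∀ x ∉ latticeDomain D ε, f x = 0) (φ : testFunctions D)
    (hφ : φ.1 = interp p ε (latticeDomain D ε) f)
    (ht : (ε ^ 2)⁻¹ * (ε ^ d * edgeEnergy f) +
      ∫ z, siteField (latticeDomain D ε) F (cellIdx ε z) * f (cellIdx ε z) ^ 2 ≤
        t * ∫ z : EuclideanSpace ℝ (Fin d), f (cellIdx ε z) ^ 2) :
    |(∫ z, φ.1 z ^ 2) - ∫ z : EuclideanSpace ℝ (Fin d), f (cellIdx ε z) ^ 2| ≤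
        ε * (2 * 8 ^ d * B + 1) * ∫ z : EuclideanSpace ℝ (Fin d), f (cellIdx ε z) ^ 2 ∧
      (∫ z, ‖gradient φ.1 z‖ ^ 2) + ∫ z, U z * φ.1 z ^ 2 ≤
      (ε ^ 2)⁻¹ * (ε ^ d * edgeEnergy f) +
        (∫ z, siteField (latticeDomain D ε) F (cellIdx ε z) * f (cellIdx ε z) ^ 2) +
        (C₁ * (ε * (2 * 8 ^ d * B + 1)) + (κ - 1) * B + ρ * (2 + 2 * 8 ^ d * B + 2 * B)) *
          ∫ z : EuclideanSpace ℝ (Fin d), f (cellIdx ε z) ^ 2 := by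
  have hfm := test_memLp φ volume
  have hgm : MemLp (fun z : EuclideanSpace ℝ (Fin d) => f (cellIdx ε z)) 2 :=
    memLp_step (support_finite_of_eq_zero hf) hε
  have hWf : |∫ z, siteField (latticeDomain D ε) F (cellIdx ε z) * f (cellIdx ε z) ^ 2| ≤
      C₁ * ∫ z : EuclideanSpace ℝ (Fin d), f (cellIdx ε z) ^ 2 := by
    rw [← integral_const_mul, ← Real.norm_eq_abs]
    refine norm_integral_le_of_norm_le (hgm.integrable_sq.const_mul C₁) (ae_of_all _ fun z => ?_)
    rw [norm_mul, Real.norm_eq_abs, Real.norm_eq_abs, abs_of_nonneg (sq_nonneg (f _))]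
    exact mul_le_mul_of_nonneg_right (abs_siteField_le hC₁ hF.1 _) (sq_nonneg _)
  have hN : 0 ≤ ∫ z : EuclideanSpace ℝ (Fin d), f (cellIdx ε z) ^ 2 :=
    integral_nonneg fun z => sq_nonneg _
  have hH := norm_testToH10_sq φ
  have hav : ∫ z, (φ.1 z - f (cellIdx ε z)) ^ 2 ≤ 8 ^ d * (ε ^ d * edgeEnergy f) := by
    rw [hφ]
    exact integral_interp_sub_sq_le hε hf
  have hen : ∫ z, ‖gradient φ.1 z‖ ^ 2 ≤ κ * (ε ^ 2)⁻¹ * (ε ^ d * edgeEnergy f) := by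
    have hc := test_hasCompactSupport φ
    rw [hφ] at hc ⊢
    exact integral_gradient_interp_sq_le hε hf hc
  have hF2 := (abs_le.1 (hF.2 φ)).1
  set N := ∫ z : EuclideanSpace ℝ (Fin d), f (cellIdx ε z) ^ 2 with hNdef
  set E := (ε ^ 2)⁻¹ * (ε ^ d * edgeEnergy f) with hE
  have hWf' := (abs_le.1 hWf).1
  have hBN : (1 + t + C₁) * N ≤ B * N := mul_le_mul_of_nonneg_right hB hN
  have hE0 : 0 ≤ E := mul_nonneg (by positivity)
    (mul_nonneg (by positivity) (edgeEnergy_nonneg f))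
  have hEB : E ≤ B * N := by linarith
  have hclose : ∫ z, (φ.1 z - f (cellIdx ε z)) ^ 2 ≤ 8 ^ d * ε ^ 2 * (B * N) := by
    refine hav.trans ?_
    have : ε ^ d * edgeEnergy f = ε ^ 2 * E := by
      rw [hE]
      field_simp
    rw [this, ← mul_assoc]
    exact mul_le_mul_of_nonneg_left hEB (by positivity)
  have hnorm := abs_integral_sq_sub_le_of_close hfm hgm hε hε1 (by positivity) hB0 hclose
  refine ⟨hnorm, ?_⟩
  have hpot := (abs_le.1 (abs_integral_mul_sq_sub_le_of_close
    (aestronglyMeasurable_comp_cellIdx (siteField (latticeDomain D ε) F) ε volume) hC₁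
    (fun z => abs_siteField_le hC₁ hF.1 _) hfm hgm hε hε1 (by positivity) hB0 hclose)).2
  have hen' : ∫ z, ‖gradient φ.1 z‖ ^ 2 ≤ κ * E := by
    rw [hE, ← mul_assoc]
    exact hen
  have h1 : (κ - 1) * E ≤ (κ - 1) * (B * N) := mul_le_mul_of_nonneg_left hEB (by linarith)
  have h2 : ∫ z, φ.1 z ^ 2 ≤ (2 + 2 * 8 ^ d * B) * N := by
    have h3 := (abs_le.1 hnorm).2
    have h4 : ε * (2 * 8 ^ d * B + 1) * N ≤ 1 * (2 * 8 ^ d * B + 1) * N := by gcongr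
    linarith
  have h5 : κ * E ≤ 2 * (B * N) :=
    (mul_le_mul_of_nonneg_right hκ2 hE0).trans (mul_le_mul_of_nonneg_left hEB (by norm_num))
  have h6 : ‖testToH10 D φ‖ ^ 2 ≤ (2 + 2 * 8 ^ d * B + 2 * B) * N := by linarith
  have h7 := mul_le_mul_of_nonneg_left h6 hρ
  linarith

end Comparison

/-! ### Transfer of trial spaces and convergence of eigenvalues -/

section Transfer

variable {d : ℕ} {D : Set (EuclideanSpace ℝ (Fin d))}

theorem PotentialClose.mono {U : EuclideanSpace ℝ (Fin d) → ℝ} {C₁ ρ ρ' ε : ℝ}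
    {F : (Fin d → ℤ) → ℝ} (hρ : ρ ≤ ρ') (h : PotentialClose D U C₁ ρ ε F) :
    PotentialClose D U C₁ ρ' ε F :=
  ⟨h.1, fun φ => (h.2 φ).trans (mul_le_mul_of_nonneg_right hρ (sq_nonneg _))⟩

theorem hasTrialSpace_const_mul_iff {V : Type*} [AddCommGroup V] [Module ℝ V] {Q N : V → ℝ}
    {k : ℕ} {t a : ℝ} (ha : 0 < a) :
    HasTrialSpace (fun v => a * Q v) (fun v => a * N v) k t ↔ HasTrialSpace Q N k t := by
  refine exists_congr fun P => and_congr_right fun _ => forall_congr' fun c => ?_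
  rw [mul_left_comm, mul_le_mul_iff_right₀ ha]

/-- The restriction to `Λ` of the cell averages of a test function. -/
noncomputable def cellAvgMap (D : Set (EuclideanSpace ℝ (Fin d))) (Λ : Finset (Fin d → ℤ)) (ε : ℝ) :
    testFunctions D →ₗ[ℝ] (Λ → ℝ) where
  toFun φ := fun x => cellAvg ε φ.1 x
  map_add' φ ψ := by
    have hi : ∀ φ : testFunctions D, Integrable φ.1 := fun φ =>
      (test_continuous φ).integrable_of_hasCompactSupport (test_hasCompactSupport φ)
    funext x
    show (ε ^ d)⁻¹ * ∫ z in cell ε x, (φ.1 z + ψ.1 z) =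
      (ε ^ d)⁻¹ * (∫ z in cell ε x, φ.1 z) + (ε ^ d)⁻¹ * ∫ z in cell ε x, ψ.1 z
    rw [integral_add (hi φ).integrableOn (hi ψ).integrableOn, mul_add]
  map_smul' c φ := by
    funext x
    show (ε ^ d)⁻¹ * ∫ z in cell ε x, c * φ.1 z = c * ((ε ^ d)⁻¹ * ∫ z in cell ε x, φ.1 z)
    rw [integral_const_mul]
    ring

theorem extend_val_of_notMem {Λ : Finset (Fin d → ℤ)} (g : Λ → ℝ) {x : Fin d → ℤ} (hx : x ∉ Λ) :
    Function.extend Subtype.val g 0 x = 0 :=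
  Function.extend_apply' _ _ _ fun ⟨y, hy⟩ => hx (hy ▸ y.2)

/-- The interpolation lives within `ℓ^∞`-distance `ε` of points whose distance to `Dᶜ` exceeds `ε`. -/
theorem tsupport_interp_subset {κ : ℝ} (p : RampDensity κ) (hDb : Bornology.IsBounded D) {ε : ℝ}
    (hε : 0 < ε) (f : (Fin d → ℤ) → ℝ) : tsupport (interp p ε (latticeDomain D ε) f) ⊆ D := by
  have hclosed : IsClosed (⋃ x ∈ latticeDomain D ε,
      {z : EuclideanSpace ℝ (Fin d) | ∀ j, |z j - ε * x j| ≤ ε}) := by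
    refine (latticeDomain D ε).finite_toSet.isClosed_biUnion fun x _ => ?_
    rw [Set.ofPred_forall]
    exact isClosed_iInter fun j => isClosed_le (by fun_prop) continuous_const
  refine (closure_minimal (fun z hz => ?_) hclosed).trans fun z hz => ?_
  · obtain ⟨x, hx, hzx⟩ := interp_ne_zero hε hz
    exact Set.mem_biUnion hx hzx
  · obtain ⟨x, hx, hzx⟩ := Set.mem_iUnion₂.1 hz
    rw [mem_latticeDomain hDb hε] at hx
    by_contra hzD
    have h1 := Metric.infDist_le_dist_of_mem (x := WithLp.ofLp (latticePoint ε x))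
      (Set.mem_image_of_mem WithLp.ofLp (show z ∈ Dᶜ from hzD))
    have h2 : dist (WithLp.ofLp (latticePoint ε x)) (WithLp.ofLp z) ≤ ε := by
      rw [dist_pi_le_iff hε.le]
      intro j
      rw [dist_comm]
      exact hzx j
    linarith

/-- The smooth interpolation of lattice functions on `D_ε`, extended by zero, as a linear map into
the test functions. -/
noncomputable def interpMap {κ : ℝ} (p : RampDensity κ) (hDb : Bornology.IsBounded D) {ε : ℝ}
    (hε : 0 < ε) : (latticeDomain D ε → ℝ) →ₗ[ℝ] testFunctions D where
  toFun g := ⟨interp p ε (latticeDomain D ε) (Function.extend Subtype.val g 0),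
    contDiff_interp p ε _ _, Metric.isCompact_of_isClosed_isBounded (isClosed_tsupport _)
      (hDb.subset (tsupport_interp_subset p hDb hε _)), tsupport_interp_subset p hDb hε _⟩
  map_add' g h := by
    refine Subtype.ext (funext fun z => ?_)
    show interp p ε _ _ z = interp p ε _ _ z + interp p ε _ _ z
    simp only [interp]
    rw [← Finset.sum_add_distrib]
    refine Finset.sum_congr rfl fun x hx => ?_
    have he : ∀ g : latticeDomain D ε → ℝ, Function.extend Subtype.val g 0 x = g ⟨x, hx⟩ :=
      fun g => Subtype.val_injective.extend_apply g 0 ⟨x, hx⟩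
    rw [he, he, he, Pi.add_apply, add_mul]
  map_smul' c g := by
    refine Subtype.ext (funext fun z => ?_)
    show interp p ε _ _ z = c * interp p ε _ _ z
    simp only [interp]
    rw [Finset.mul_sum]
    refine Finset.sum_congr rfl fun x hx => ?_
    have he : ∀ g : latticeDomain D ε → ℝ, Function.extend Subtype.val g 0 x = g ⟨x, hx⟩ :=
      fun g => Subtype.val_injective.extend_apply g 0 ⟨x, hx⟩
    rw [he, he, Pi.smul_apply, smul_eq_mul, mul_assoc]

/-- An admissible error in the perturbation of a trial space from level `t` to level `t + δ`. -/
theorem exists_perturbation_bound (t : ℝ) {δ : ℝ} (hδ : 0 < δ) :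
    ∃ σ > 0, σ < 1 ∧ σ * (1 + |t + δ|) ≤ δ := by
  have h : 0 < 1 + |t + δ| := by positivity
  refine ⟨min (1 / 2) (δ / (1 + |t + δ|)), by positivity,
    (min_le_left _ _).trans_lt (by norm_num), ?_⟩
  rw [← le_div_iff₀ h]
  exact min_le_right _ _

/-- Trial spaces of test functions pass to the lattice by cell averages. -/
theorem exists_forall_hasTrialSpace_lattice (hd : 1 ≤ d) (hDo : IsOpen D)
    (hDb : Bornology.IsBounded D) {W : Lp ℝ ⊤ (volume.restrict D)}
    {U : EuclideanSpace ℝ (Fin d) → ℝ} (hW : W =ᵐ[volume.restrict D] U) {C C₁ : ℝ} (hC0 : 0 ≤ C)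
    (hC : ∀ x ∈ D, |U x| ≤ C) (hC₁ : 0 ≤ C₁) {k : ℕ} {t δ : ℝ} (hδ : 0 < δ)
    (h : HasTrialSpace (fun φ => dirichletForm D W (testToH10 D φ) (testToH10 D φ))
      (fun φ => ‖h10ToL2 D (testToH10 D φ)‖ ^ 2) k t) :
    ∃ ρ > 0, ∃ r > 0, ∀ ε, 0 < ε → ε < r → ∀ F, PotentialClose D U C₁ ρ ε F →
      HasTrialSpace (fun g : latticeDomain D ε → ℝ =>
        g ⬝ᵥ (andersonMatrix (latticeDomain D ε) ε F).mulVec g) (fun g => g ⬝ᵥ g) k (t + δ) := by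
  obtain ⟨P, hP, hPt⟩ := h
  obtain ⟨σ, hσ0, hσ1, hσδ⟩ := exists_perturbation_bound t hδ
  -- a compact subset of `D` that contains the supports of all functions of the trial space
  set K : Set (EuclideanSpace ℝ (Fin d)) := ⋃ j, tsupport (P (Pi.single j 1)).1 with hK
  have hKc : IsCompact K := isCompact_iUnion fun j => test_hasCompactSupport _
  have hKD : K ⊆ D := Set.iUnion_subset fun j => (P (Pi.single j 1)).2.2.2
  have hPK : ∀ c z, (P c).1 z ≠ 0 → z ∈ K := by
    intro c z hz
    by_contra hzK
    refine hz ?_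
    rw [LinearMap.pi_apply_eq_sum_univ P c, Submodule.coe_sum, Finset.sum_apply]
    refine Finset.sum_eq_zero fun j _ => ?_
    have h0 : (P (Pi.single j 1)).1 z = 0 :=
      image_eq_zero_of_notMem_tsupport fun h => hzK (Set.mem_iUnion.2 ⟨j, h⟩)
    have he : (fun l => if j = l then (1 : ℝ) else 0) = Pi.single j 1 := by
      funext l
      simp [Pi.single_apply, eq_comm]
    show c j * (P fun l => if j = l then (1 : ℝ) else 0).1 z = 0
    rw [he, h0, mul_zero]
  obtain ⟨r₀, hr₀, hr₀K⟩ := exists_forall_mem_latticeDomain hd hDo hDb hKc hKD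
  set B : ℝ := 1 + |t| + C with hB
  have hB0 : 0 < B := by positivity
  set R : ℝ := 2 * (2 ^ d * d) * B + 1 with hR
  have hR0 : 0 < R := by positivity
  refine ⟨σ / (2 * B), by positivity, min (min 1 r₀) (σ / (2 * (1 + C₁) * R)), by positivity,
    fun ε hε hεr F hF => ?_⟩
  have hε1 : ε ≤ 1 := hεr.le.trans ((min_le_left _ _).trans (min_le_left _ _))
  have hεr₀ : ε < r₀ := hεr.trans_le ((min_le_left _ _).trans (min_le_right _ _))
  have hεσ : ε * (2 * (1 + C₁) * R) ≤ σ := by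
    rw [← le_div_iff₀ (by positivity)]
    exact hεr.le.trans (min_le_right _ _)
  have hεR : 0 < ε * R := by positivity
  have hCR : 0 ≤ C₁ * (ε * R) := by positivity
  have hρB : σ / (2 * B) * B = σ / 2 := by field_simp
  have hvan : ∀ c, ∀ x ∉ latticeDomain D ε, cellAvg ε (P c).1 x = 0 := by
    intro c x hx
    by_contra hne
    obtain ⟨z, hzx, hz⟩ := exists_of_cellAvg_ne_zero hne
    refine hx (hr₀K ε hε hεr₀ z (hPK c z hz) x ?_)
    rw [← hzx]
    exact abs_sub_cellIdx_le hε z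
  have hcmp : ∀ c, _ := fun c => cellAvg_comparison (B := B) hC hC0 hC₁ hε hε1
    (by positivity : 0 ≤ σ / (2 * B)) hB0.le (by have := le_abs_self t; linarith) hF (P c) (hvan c)
    (t := t) (by
      have := hPt c
      simp only [dirichletForm_testToH10 hW, norm_h10ToL2_testToH10_sq] at this
      exact this)
  have hN0 : ∀ φ : testFunctions D, 0 ≤ ∫ z, φ.1 z ^ 2 := fun φ => integral_nonneg fun z => sq_nonneg _
  refine (hasTrialSpace_const_mul_iff (pow_pos hε d)).1 (hasTrialSpace_of_perturbation
    (Q := fun φ : testFunctions D => (∫ z, ‖gradient φ.1 z‖ ^ 2) + ∫ z, U z * φ.1 z ^ 2)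
    (N := fun φ => ∫ z, φ.1 z ^ 2) (cellAvgMap D (latticeDomain D ε) ε) hN0
    test_eq_zero_of_integral_sq_eq_zero (by simp) hσ1 hσδ hP (fun c => ?_) (fun c => ?_)
    fun c => ?_)
  · have := hPt c
    simp only [dirichletForm_testToH10 hW, norm_h10ToL2_testToH10_sq] at this
    exact this
  · have h1 := pow_mul_dotProduct_self (hvan c) hε
    have h2 := (hcmp c).1
    rw [← h1] at h2
    refine h2.trans (mul_le_mul_of_nonneg_right ?_ (hN0 _))
    rw [← hR]
    linarith
  · have h1 := pow_mul_dotProduct_andersonMatrix (hvan c) hε F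
    have h2 := (hcmp c).2
    rw [← h1] at h2
    refine h2.trans (add_le_add_right (mul_le_mul_of_nonneg_right ?_ (hN0 _)) _)
    rw [← hR, hρB]
    linarith

/-- `interp_comparison` in terms of the matrix of the lattice operator. -/
theorem interpMap_comparison {U : EuclideanSpace ℝ (Fin d) → ℝ} {C₁ ρ ε t B κ : ℝ}
    (hDb : Bornology.IsBounded D) (p : RampDensity κ) (hC₁ : 0 ≤ C₁) (hε : 0 < ε) (hε1 : ε ≤ 1)
    (hρ : 0 ≤ ρ) (hκ1 : 1 ≤ κ) (hκ2 : κ ≤ 2) (hB0 : 0 ≤ B) (hB : 1 + t + C₁ ≤ B)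
    {F : (Fin d → ℤ) → ℝ} (hF : PotentialClose D U C₁ ρ ε F) (g : latticeDomain D ε → ℝ)
    (ht : ε ^ d * (g ⬝ᵥ (andersonMatrix (latticeDomain D ε) ε F).mulVec g) ≤
      t * (ε ^ d * (g ⬝ᵥ g))) :
    |(∫ z, (interpMap p hDb hε g).1 z ^ 2) - ε ^ d * (g ⬝ᵥ g)| ≤
        ε * (2 * 8 ^ d * B + 1) * (ε ^ d * (g ⬝ᵥ g)) ∧
      (∫ z, ‖gradient (interpMap p hDb hε g).1 z‖ ^ 2) +
          ∫ z, U z * (interpMap p hDb hε g).1 z ^ 2 ≤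
        ε ^ d * (g ⬝ᵥ (andersonMatrix (latticeDomain D ε) ε F).mulVec g) +
          (C₁ * (ε * (2 * 8 ^ d * B + 1)) + (κ - 1) * B + ρ * (2 + 2 * 8 ^ d * B + 2 * B)) *
            (ε ^ d * (g ⬝ᵥ g)) := by
  set f : (Fin d → ℤ) → ℝ := Function.extend Subtype.val g 0 with hf
  have hvan : ∀ x ∉ latticeDomain D ε, f x = 0 := fun x hx => extend_val_of_notMem g hx
  have hval : (fun x : latticeDomain D ε => f x) = g :=
    funext fun x => Subtype.val_injective.extend_apply g 0 x
  have hN := pow_mul_dotProduct_self hvan hε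
  have hQ := pow_mul_dotProduct_andersonMatrix hvan hε F
  rw [hval] at hN hQ
  rw [hN, hQ] at ht ⊢
  exact interp_comparison p hC₁ hε hε1 hρ hκ1 hκ2 hB0 hB hF hvan (interpMap p hDb hε g) rfl ht

/-- Smooth interpolation carries trial spaces, with an explicit bound on the errors. -/
theorem hasTrialSpace_interp (hDb : Bornology.IsBounded D)
    {W : Lp ℝ ⊤ (volume.restrict D)} {U : EuclideanSpace ℝ (Fin d) → ℝ}
    (hW : W =ᵐ[volume.restrict D] U) {C₁ ρ ε t B κ σ δ : ℝ} (p : RampDensity κ) (hC₁ : 0 ≤ C₁)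
    (hε : 0 < ε) (hε1 : ε ≤ 1) (hρ : 0 ≤ ρ) (hκ1 : 1 ≤ κ) (hκ2 : κ ≤ 2) (hB0 : 0 ≤ B)
    (hB : 1 + t + C₁ ≤ B) {F : (Fin d → ℤ) → ℝ} (hF : PotentialClose D U C₁ ρ ε F)
    (hσ1 : σ < 1) (hσδ : σ * (1 + |t + δ|) ≤ δ) (h1 : ε * (2 * 8 ^ d * B + 1) ≤ σ)
    (h2 : C₁ * (ε * (2 * 8 ^ d * B + 1)) + (κ - 1) * B + ρ * (2 + 2 * 8 ^ d * B + 2 * B) ≤ σ)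
    {k : ℕ} (hT : HasTrialSpace (fun g : latticeDomain D ε → ℝ =>
      g ⬝ᵥ (andersonMatrix (latticeDomain D ε) ε F).mulVec g) (fun g => g ⬝ᵥ g) k t) :
    HasTrialSpace (fun u => dirichletForm D W u u) (fun u => ‖h10ToL2 D u‖ ^ 2) k (t + δ) := by
  obtain ⟨P, hP, hPt⟩ := (hasTrialSpace_const_mul_iff (pow_pos hε d)).2 hT
  have hcmp := fun c => interpMap_comparison hDb p hC₁ hε hε1 hρ hκ1 hκ2 hB0 hB hF (P c) (hPt c)
  have hN0 : ∀ g : latticeDomain D ε → ℝ, 0 ≤ ε ^ d * (g ⬝ᵥ g) := fun g =>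
    mul_nonneg (by positivity) (by simpa using dotProduct_star_self_nonneg g)
  have hN00 : ∀ g : latticeDomain D ε → ℝ, ε ^ d * (g ⬝ᵥ g) = 0 → g = 0 := by
    intro g hg
    rcases mul_eq_zero.1 hg with h | h
    · exact absurd h (pow_pos hε d).ne'
    · exact dotProduct_self_eq_zero.1 h
  refine hasTrialSpace_of_perturbation
    (Q := fun g : latticeDomain D ε → ℝ =>
      ε ^ d * (g ⬝ᵥ (andersonMatrix (latticeDomain D ε) ε F).mulVec g))
    (N := fun g => ε ^ d * (g ⬝ᵥ g)) (Q' := fun u => dirichletForm D W u u)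
    (N' := fun u => ‖h10ToL2 D u‖ ^ 2) (testToH10 D ∘ₗ interpMap p hDb hε) hN0 hN00
    (by simp only [map_zero, norm_zero]; norm_num) hσ1 hσδ hP hPt (fun c => ?_) fun c => ?_
  · rw [LinearMap.comp_apply, norm_h10ToL2_testToH10_sq]
    exact (hcmp c).1.trans (mul_le_mul_of_nonneg_right h1 (hN0 _))
  · rw [LinearMap.comp_apply, dirichletForm_testToH10 hW]
    exact (hcmp c).2.trans (add_le_add_right (mul_le_mul_of_nonneg_right h2 (hN0 _)) _)

/-- Parameters for which the errors of the smooth interpolation are at most `σ`. -/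
theorem exists_interp_parameters {C₁ B R S σ : ℝ} (hC₁ : 0 ≤ C₁) (hB0 : 0 < B) (hR0 : 0 < R)
    (hS0 : 0 < S) (hσ0 : 0 < σ) :
    ∃ κ ρ r : ℝ, 1 < κ ∧ κ ≤ 2 ∧ 0 < ρ ∧ 0 < r ∧ r ≤ 1 ∧ ∀ ε, 0 < ε → ε < r →
      ε * R ≤ σ ∧ C₁ * (ε * R) + (κ - 1) * B + ρ * S ≤ σ := by
  have h0 : 0 < min 1 (σ / (3 * B)) := by positivity
  have h1 := min_le_left 1 (σ / (3 * B))
  have h2 := mul_le_mul_of_nonneg_right (min_le_right 1 (σ / (3 * B))) hB0.le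
  have h3 : σ / (3 * B) * B = σ / 3 := by field_simp
  -- the three error terms are each at most `σ / 3`
  refine ⟨1 + min 1 (σ / (3 * B)), σ / (3 * S), min 1 (σ / (3 * (1 + C₁) * R)), by linarith,
    by linarith, by positivity, by positivity, min_le_left _ _, fun ε hε hεr => ?_⟩
  have hεσ : ε * (3 * (1 + C₁) * R) ≤ σ := by
    rw [← le_div_iff₀ (by positivity)]
    exact hεr.le.trans (min_le_right _ _)
  have hεR : 0 < ε * R := by positivity
  have hCR : 0 ≤ C₁ * (ε * R) := by positivity
  have hρS : σ / (3 * S) * S = σ / 3 := by field_simp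
  rw [hρS]
  constructor <;> linarith

/-- Trial spaces of lattice functions pass to `H¹₀(D)` by smooth interpolation. -/
theorem exists_forall_hasTrialSpace_continuum (hDb : Bornology.IsBounded D)
    {W : Lp ℝ ⊤ (volume.restrict D)} {U : EuclideanSpace ℝ (Fin d) → ℝ}
    (hW : W =ᵐ[volume.restrict D] U) {C₁ : ℝ} (hC₁ : 0 ≤ C₁) (k : ℕ) (t : ℝ) {δ : ℝ} (hδ : 0 < δ) :
    ∃ ρ > 0, ∃ r > 0, ∀ ε, 0 < ε → ε < r → ∀ F, PotentialClose D U C₁ ρ ε F →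
      HasTrialSpace (fun g : latticeDomain D ε → ℝ =>
        g ⬝ᵥ (andersonMatrix (latticeDomain D ε) ε F).mulVec g) (fun g => g ⬝ᵥ g) k t →
      HasTrialSpace (fun u => dirichletForm D W u u) (fun u => ‖h10ToL2 D u‖ ^ 2) k (t + δ) := by
  obtain ⟨σ, hσ0, hσ1, hσδ⟩ := exists_perturbation_bound t hδ
  have hB0 : 0 < 1 + |t| + C₁ := by positivity
  have hB : 1 + t + C₁ ≤ 1 + |t| + C₁ := by linarith [le_abs_self t]
  obtain ⟨κ, ρ, r, hκ1, hκ2, hρ, hr, hr1, h⟩ := exists_interp_parameters hC₁ hB0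
    (show 0 < 2 * 8 ^ d * (1 + |t| + C₁) + 1 by positivity)
    (show 0 < 2 + 2 * 8 ^ d * (1 + |t| + C₁) + 2 * (1 + |t| + C₁) by positivity) hσ0
  obtain ⟨p⟩ := RampDensity.nonempty hκ1
  exact ⟨ρ, hρ, r, hr, fun ε hε hεr F hF hT => hasTrialSpace_interp hDb hW p hC₁ hε
    (hεr.le.trans hr1) hρ.le hκ1.le hκ2 hB0.le hB hF hσ1 hσδ (h ε hε hεr).1 (h ε hε hεr).2 hT⟩

theorem HasTrialSpace.le_card {ι : Type*} [Fintype ι] {Q N : (ι → ℝ) → ℝ} {k : ℕ} {t : ℝ}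
    (h : HasTrialSpace Q N k t) : k ≤ Fintype.card ι := by
  obtain ⟨P, hP, -⟩ := h
  simpa using LinearMap.finrank_le_finrank_of_injective hP

/-- For small `ε`, the lattice eigenvalue is close to the continuum one as soon as the potential
is close to `U` as a form. -/
theorem exists_forall_abs_andersonEigenvalue_sub_lt (hd : 1 ≤ d) (hDo : IsOpen D)
    (hDb : Bornology.IsBounded D) {W : Lp ℝ ⊤ (volume.restrict D)}
    {U : EuclideanSpace ℝ (Fin d) → ℝ} (hW : W =ᵐ[volume.restrict D] U) {C C₁ : ℝ} (hC0 : 0 ≤ C)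
    (hC : ∀ x ∈ D, |U x| ≤ C) (hC₁ : 0 ≤ C₁) {k : ℕ} (hk : 1 ≤ k) {lam : ℝ}
    (hle : ∀ t, HasTrialSpace (fun u => dirichletForm D W u u) (fun u => ‖h10ToL2 D u‖ ^ 2) k t →
      lam ≤ t)
    (hgt : ∀ t > lam, HasTrialSpace (fun u => dirichletForm D W u u)
      (fun u => ‖h10ToL2 D u‖ ^ 2) k t) {δ : ℝ} (hδ : 0 < δ) :
    ∃ ρ > 0, ∃ r > 0, ∀ ε, 0 < ε → ε < r → ∀ F, PotentialClose D U C₁ ρ ε F →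
      k ≤ (latticeDomain D ε).card ∧
        |andersonEigenvalue (latticeDomain D ε) ε F k - lam| < δ := by
  have htrial := HasTrialSpace.of_denseRange (dirichletForm_coercive hW hDo.measurableSet hC)
    (testToH10 D) (denseRange_testToH10 D) (show lam + δ / 8 < lam + δ / 4 by linarith)
    (hgt (lam + δ / 8) (by linarith))
  obtain ⟨ρ₁, hρ₁, r₁, hr₁, hup⟩ := exists_forall_hasTrialSpace_lattice hd hDo hDb hW hC0 hC hC₁
    (show 0 < δ / 4 by linarith) htrial
  obtain ⟨ρ₂, hρ₂, r₂, hr₂, hlow⟩ := exists_forall_hasTrialSpace_continuum hDb hW hC₁ k (lam - δ)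
    (show 0 < δ / 2 by linarith)
  refine ⟨min ρ₁ ρ₂, lt_min hρ₁ hρ₂, min r₁ r₂, lt_min hr₁ hr₂, fun ε hε hεr F hF => ?_⟩
  have h1 := hup ε hε (hεr.trans_le (min_le_left _ _)) F (hF.mono (min_le_left _ _))
  have hcard := h1.le_card
  refine ⟨by rwa [Fintype.card_coe] at hcard, ?_⟩
  have hA := andersonMatrix_isHermitian (latticeDomain D ε) ε F
  rw [andersonEigenvalue, dif_pos ⟨hk, hcard⟩]
  have h2 := hA.eigenvalues₀_le_of_hasTrialSpace hk hcard h1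
  rw [abs_lt]
  refine ⟨?_, by linarith⟩
  by_contra! hcon
  have h3 := HasTrialSpace.mono (fun g : latticeDomain D ε → ℝ =>
    show 0 ≤ g ⬝ᵥ g by simpa using dotProduct_star_self_nonneg g)
    (show _ ≤ lam - δ by linarith) (hA.hasTrialSpace_eigenvalues₀ hk hcard)
  have h4 := hle _ (hlow ε hε (hεr.trans_le (min_le_right _ _)) F (hF.mono (min_le_right _ _)) h3)
  linarith

end Transfer

theorem theorem1p1 {d : ℕ} (hd : 1 ≤ d)
    (D : Set (EuclideanSpace ℝ (Fin d))) (hD_open : IsOpen D)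
    (hD_bdd : Bornology.IsBounded D) (hD_ne : D.Nonempty)
    (α : ℝ≥0) (hα : 0 < α) (hD_bdry : HasC1HolderBoundary α D)
    (a b : ℝ) (hab : a < b)
    (U V : EuclideanSpace ℝ (Fin d) → ℝ)
    (hU_cont : ContinuousOn U D) (hU_bdd : ∃ C : ℝ, ∀ x ∈ D, |U x| ≤ C)
    (hV_cont : ContinuousOn V D) (hV_bdd : ∃ C : ℝ, ∀ x ∈ D, |V x| ≤ C)
    (hV_pos : ∀ x ∈ D, 0 < V x)
    {Ω : ℝ → Type*} [∀ ε, MeasurableSpace (Ω ε)]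
    (P : ∀ ε, Measure (Ω ε)) [∀ ε, IsProbabilityMeasure (P ε)]
    (ξ : ∀ ε, (Fin d → ℤ) → Ω ε → ℝ)
    (hξ_meas : ∀ ε > 0, ∀ x ∈ latticeDomain D ε, Measurable (ξ ε x))
    (hξ_indep : ∀ ε > 0, iIndepFun (fun x : latticeDomain D ε => ξ ε x) (P ε))
    (hξ_bdd : ∀ ε > 0, ∀ x ∈ latticeDomain D ε, ∀ᵐ ω ∂(P ε), a ≤ ξ ε x ω ∧ ξ ε x ω ≤ b)
    (hξ_mean : ∀ ε > 0, ∀ x ∈ latticeDomain D ε,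
      ∫ ω, ξ ε x ω ∂(P ε) = U (latticePoint ε x))
    (hξ_var : ∀ ε > 0, ∀ x ∈ latticeDomain D ε,
      variance (ξ ε x) (P ε) = V (latticePoint ε x))
    (k : ℕ) (hk : 1 ≤ k) :
    (∀ᶠ ε in 𝓝[>] (0 : ℝ), k ≤ (latticeDomain D ε).card) ∧
    ∃ lam : ℝ, IsKthDirichletEigenvalue D U k lam ∧
      ∀ δ > 0, Tendsto
        (fun ε => P ε {ω | δ ≤
          |andersonEigenvalue (latticeDomain D ε) ε (fun x => ξ ε x ω) k - lam|})
        (𝓝[>] (0 : ℝ)) (𝓝 0) := by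
  obtain ⟨C₀, hC₀⟩ := hU_bdd
  obtain ⟨C', hC'⟩ := hV_bdd
  have hC : ∀ x ∈ D, |U x| ≤ |C₀| := fun x hx => (hC₀ x hx).trans (le_abs_self _)
  have hUtop : MemLp U ⊤ (volume.restrict D) :=
    memLp_top_of_bound (hU_cont.aestronglyMeasurable hD_open.measurableSet) |C₀|
      ((ae_restrict_mem hD_open.measurableSet).mono fun x hx => hC x hx)
  have hW := hUtop.coeFn_toLp
  obtain ⟨lam, hlam, hle, hgt⟩ := exists_isKthDirichletEigenvalue hd hD_open hD_bdd hD_ne hW hC hk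
  have hbad := fun (ρ : ℝ) (hρ : 0 < ρ) => tendsto_prob_potential hd hD_open hD_bdd hU_cont hC hC'
    hξ_meas hξ_indep hξ_bdd hξ_mean hξ_var hρ
  have hcmp := fun (δ : ℝ) (hδ : 0 < δ) => exists_forall_abs_andersonEigenvalue_sub_lt hd hD_open
    hD_bdd hW (abs_nonneg C₀) hC ((abs_nonneg a).trans (le_max_left |a| |b|)) hk hle hgt hδ
  refine ⟨?_, lam, hlam, fun δ hδ => ?_⟩
  · obtain ⟨ρ, hρ, r, hr, h⟩ := hcmp 1 one_pos
    filter_upwards [self_mem_nhdsWithin, Ioo_mem_nhdsGT hr,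
      (hbad ρ hρ).eventually (gt_mem_nhds zero_lt_one)] with ε hε hεr hPε
    -- the good event has positive probability, hence is not empty
    by_contra hcard
    refine hPε.ne ?_
    rw [← measure_univ (μ := P ε)]
    congr 1
    exact Set.eq_univ_of_forall fun ω hω => hcard (h ε hε hεr.2 _ hω).1
  · obtain ⟨ρ, hρ, r, hr, h⟩ := hcmp δ hδ
    refine tendsto_of_tendsto_of_tendsto_of_le_of_le' tendsto_const_nhds (hbad ρ hρ)
      (Eventually.of_forall fun _ => zero_le) ?_
    filter_upwards [self_mem_nhdsWithin, Ioo_mem_nhdsGT hr] with ε hε hεr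
    exact measure_mono fun ω hω hgood => absurd (h ε hε hεr.2 _ hgood).2 (not_lt.2 hω)
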